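/- **Setting.** All algebras are complex and unital; graded differential $*$-algebras $(\Omega,d,*)$ satisfy $d(\varphi\psi)=(d\varphi)\psi+(-1)^{k}\varphi\,d\psi$, $(\varphi\psi)^*=(-1)^{kl}\psi^*\varphi^*$ ($\deg\varphi=k,\deg\psi=l$), $d(\varphi^*)=(d\varphi)^*$, and are generated by their degree $0$ part, unless said otherwise. * *Group.* $G$ is the dense Hopf $*$-algebra of a compact matrix quantum group, with coproduct $\phi$ and antipode $\kappa$; $(\Gamma,d)$ is a bicovariant first order differential $*$-calculus on $G$, $\Gamma^\wedge=\big(\bigoplus_k\Gamma^{\otimes_G k}\big)/\mathcal Q$ its universal differential envelope, $\mathrm{inv}\,\Gamma$ the left-invariant elements of $\Gamma$, $\pi(g)=\kappa(g^{(1)})dg^{(2)}$ the quantum germs map, and $\mathrm{ad}:\mathrm{inv}\,\Gamma\to\mathrm{inv}\,\Gamma\otimes G$ the restriction of the right coaction of $G$ on $\Gamma$. An embedded differential $\delta:\mathrm{inv}\,\Gamma\to\mathrm{inv}\,\Gamma\otimes\mathrm{inv}\,\Gamma$ is fixed: it intertwines $\mathrm{ad}$ with $\mathrm{ad}^{\otimes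 2}$, and $\delta(\theta)=\sum\theta^{1}\otimes\theta^{2}$ implies $\sum\theta^1\theta^2=d\theta$ in $\Gamma^\wedge$. * *Bundle.* $GM$ is a $*$-algebra with a $*$-morphism $\Phi:GM\to GM\otimes G$ that is a corepresentation such that $x\otimes y\mapsto(x\otimes 1)\Phi(y)$ maps $GM\otimes GM$ onto $GM\otimes G$; $M=\{p:\Phi(p)=p\otimes 1\}$. $\Omega^\bullet(GM)$ is a graded differential $*$-algebra generated by $\Omega^0(GM)=GM$, with a morphism $\Psi:\Omega^\bullet(GM)\to\Omega^\bullet(GM)\otimes\Gamma^\wedge$ (graded tensor product) of graded differential $*$-algebras that extends $\Phi$; $\Omega^\bullet(M)=\{\mu:\Psi(\mu)=\mu\otimes1\}$ and $\mathrm{Hor}=\{\varphi:\Psi(\varphi)\in\Omega^\bullet(GM)\otimes G\}$, on which $\Psi(\varphi)=\varphi^{(0)}\otimes\varphi^{(1)}$. * *Riemannian structure.* $M$ is a $*$-subalgebra of a $C^*$-algebra. $\Omega^k(M)=0$ for $k>n$, and $\Omega^n(M)=M\,\mathrm{dvol}$ with $\mathrm{dvol}\neq0$ and $p\,\mathrm{dvol}=0\Rightarrow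 p=0$. $\langle-,-\rangle_L$ is a left quantum Riemannian metric: a positive, definite, hermitian form $\Omega^\bullet(M)\times\Omega^\bullet(M)\to M$, left $M$-linear in the first and antilinear in the second variable, with $\langle\hat\mu p,\mu\rangle_L=\langle\hat\mu,\mu p^*\rangle_L$, $\langle\hat p,p\rangle_L=\hat p p^*=\langle\hat p\,\mathrm{dvol},p\,\mathrm{dvol}\rangle_L$, and forms of different degrees orthogonal; $\langle\hat\mu,\mu\rangle_R:=\langle\hat\mu^*,\mu^*\rangle_L$. A state $s$ of $M$ gives the integral $\int_M p\,\mathrm{dvol}:=s(p)$, and $\int_M d\mu=0$ for $\mu\in\Omega^{n-1}(M)$. The left Hodge operator exists: an antilinear bijection $\star_L$ of $\Omega^\bullet(M)$ that maps $\Omega^k(M)$ onto $\Omega^{n-k}(M)$ and satisfies $\hat\mu\,(\star_L\mu)=\langle\hat\mu,\mu\rangle_L\,\mathrm{dvol}$ for $\hat\mu,\mu\in\Omega^k(M)$; $\star_R:=*\circ\star_L\circ*$. * *Associated bundles.* $\mathrm{inv}\,\Gamma$ has a finite basis $(e_i)$, orthonormal for an inner product that makes $\mathrm{ad}$ unitary.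 Let $\mathrm{Mor}(\mathrm{ad},\Phi)$ be the $M$-bimodule of linear $T:\mathrm{inv}\,\Gamma\to GM$ with $\Phi\circ T=(T\otimes\mathrm{id})\mathrm{ad}$, and $\mathrm{Mor}(\mathrm{ad},\mathrm{Hor})$ the analogous space for $\mathrm{Hor}$. Assume that there are $T_1,\dots,T_r\in\mathrm{Mor}(\mathrm{ad},\Phi)$, with matrix $X=(T_k(e_i))_{ki}$, a strictly positive complex matrix $Z$ and the strictly positive matrix $C$ of the canonical isomorphism of $\mathrm{ad}$ with $(\mathrm{id}\otimes\kappa^2)\mathrm{ad}$ such that $\sum_k T_k(e_i)^*T_k(e_j)=\delta_{ij}1$ and $W^{T}\overline X=1$, where $W=ZX(C^{-1})^*$ and $\overline X=(T_k(e_i)^*)$. Put $\langle T_1,T_2\rangle_L=\sum_kT_1(e_k)T_2(e_k)^*$ and $\langle T_1,T_2\rangle_R=\sum_kT_1(e_k)^*T_2(e_k)$; assume that $\langle-,-\rangle_R$ takes its values in $M$ (for $\langle-,-\rangle_L$ this is automatic). On $E_L=\Omega^\bullet(M)\otimes_M\mathrm{Mor}(\mathrm{ad},\Phi)$ and $E_R=\mathrm{Mor}(\mathrm{ad},\Phi)\otimes_M\Omega^\bullet(M)$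 let $\langle\mu_1\otimes T_1,\mu_2\otimes T_2\rangle_L=\langle\mu_1\langle T_1,T_2\rangle_L,\mu_2\rangle_L$, $\langle T_1\otimes\mu_1,T_2\otimes\mu_2\rangle_R=\langle\mu_1,\langle T_1,T_2\rangle_R\,\mu_2\rangle_R$, and $\langle-|-\rangle_{L/R}=s(\langle-,-\rangle_{L/R})$. Let $\Upsilon$ and $\widetilde\Upsilon$ be the inverses of the isomorphisms $E_L\to\mathrm{Mor}(\mathrm{ad},\mathrm{Hor})$, $\mu\otimes T\mapsto\mu T$, and $E_R\to\mathrm{Mor}(\mathrm{ad},\mathrm{Hor})$, $T\otimes\mu\mapsto T\mu$. * *Connections.* A quantum principal connection (qpc) is a linear $\omega:\mathrm{inv}\,\Gamma\to\Omega^1(GM)$ with $\Psi(\omega(\theta))=(\omega\otimes\mathrm{id})\mathrm{ad}(\theta)+1\otimes\theta$; a displacement is a linear $\lambda:\mathrm{inv}\,\Gamma\to\Omega^1(GM)$ with $\Psi(\lambda(\theta))=(\lambda\otimes\mathrm{id})\mathrm{ad}(\theta)$. Put $\hat\tau=*\circ\tau\circ*$, $\langle T_1,T_2\rangle=m(T_1\otimes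 T_2)\delta$, $[T_1,T_2]=m(T_1\otimes T_2)(\mathrm{id}\otimes\pi)\mathrm{ad}$, $R^\omega=d\circ\omega-\langle\omega,\omega\rangle$, $D^\omega\varphi=d\varphi-(-1)^k\varphi^{(0)}\omega(\pi(\varphi^{(1)}))$ and $S^\omega(\tau)=\langle\omega,\tau\rangle-(-1)^k\langle\tau,\omega\rangle-(-1)^k[\tau,\omega]$ (for $\varphi$, and values of $\tau$, of degree $k$), $\widehat D^\omega=*\circ D^\omega\circ*$, $\widehat S^\omega(\tau)=\widehat{S^\omega(\hat\tau)}$, $\widehat R^\omega=\widehat{(R^\omega)}$, and $d^{\nabla^\omega}=\Upsilon D^\omega\Upsilon^{-1}$, $d^{\widehat\nabla^\omega}=\widetilde\Upsilon\widehat D^\omega\widetilde\Upsilon^{-1}$, $d^{S^\omega}=\Upsilon S^\omega\Upsilon^{-1}$, $d^{\widehat S^\omega}=\widetilde\Upsilon\widehat S^\omega\widetilde\Upsilon^{-1}$. Assume that $d^{S^\omega}$ and $d^{\widehat S^\omega}$ are adjointable with respect to $\langle-|-\rangle_L$, $\langle-|-\rangle_R$ for every qpc $\omega$. On forms of degree $k$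 put $$d^{\nabla^\omega\star_L}=(-1)^k\big((\star_L^{-1}\circ*)\otimes\mathrm{id}\big)\,d^{\nabla^{\hat\omega}}\,\big((*\circ\star_L)\otimes\mathrm{id}\big),\qquad d^{\widehat\nabla^\omega\star_R}=(-1)^k\big(\mathrm{id}\otimes(\star_R^{-1}\circ*)\big)\,d^{\widehat\nabla^{\hat\omega}}\,\big(\mathrm{id}\otimes(*\circ\star_R)\big).$$ * *Action.* $\mathscr S(\omega)=-\tfrac14\big(\langle\Upsilon R^\omega|\Upsilon R^\omega\rangle_L+\langle\widetilde\Upsilon\widehat R^\omega|\widetilde\Upsilon\widehat R^\omega\rangle_R\big)$. A qpc $\omega$ is a Yang–Mills connection if, for every displacement $\lambda$, the function $z\mapsto\mathscr S(\omega+z\lambda)$ of the complex variable $z=x+iy$ is real differentiable at $0$ and $\frac{\partial}{\partial z}\big|_{z=0}\mathscr S(\omega+z\lambda)=0$, where $\frac{\partial}{\partial z}=\frac12\big(\frac{\partial}{\partial x}-i\frac{\partial}{\partial y}\big)$. **Theorem.** Let $\omega$ be a qpc. Then $d^{\nabla^\omega\star_L}$ and $d^{\widehat\nabla^\omega\star_R}$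 are adjoints of $d^{\nabla^\omega}$ and $d^{\widehat\nabla^\omega}$ with respect to $\langle-|-\rangle_L$ and $\langle-|-\rangle_R$. Moreover, if $d^{S^\omega\star_L}$ and $d^{\widehat S^\omega\star_R}$ are adjoints of $d^{S^\omega}$ and $d^{\widehat S^\omega}$, then $\omega$ is a Yang–Mills connection if and only if $$\big\langle\Upsilon\lambda\,\big|\,(d^{\nabla^\omega\star_L}-d^{S^\omega\star_L})\Upsilon R^\omega\big\rangle_L+\big\langle\widetilde\Upsilon\hat\lambda\,\big|\,(d^{\widehat\nabla^\omega\star_R}-d^{\widehat S^\omega\star_R})\widetilde\Upsilon\widehat R^\omega\big\rangle_R=0$$ for all displacements $\lambda$. -/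

import Mathlib

open scoped TensorProduct

noncomputable section

set_option linter.unusedSectionVars false

namespace QYM

/-! ### Graded differential star-algebras -/

section Graded

variable {Ω : Type*} [Ring Ω] [Algebra ℂ Ω] (𝒜 : ℕ → Submodule ℂ Ω) [GradedAlgebra 𝒜]

/-- The structure of a graded differential `*`-algebra, generated by its degree `0` elements,
on a graded complex unital algebra `Ω = ⨁ₖ 𝒜 k`. The involution is graded-antimultiplicative
and commutes with the differential. -/
structure DiffStar where
  d : Ω →ₗ[ℂ] Ω
  cj : Ω →ₗ⋆[ℂ] Ω
  d_mem : ∀ {k a}, a ∈ 𝒜 k → d a ∈ 𝒜 (k + 1)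
  d_d : ∀ a, d (d a) = 0
  leibniz : ∀ {k a}, a ∈ 𝒜 k → ∀ b, d (a * b) = d a * b + ((-1 : ℂ) ^ k) • (a * d b)
  cj_mem : ∀ {k a}, a ∈ 𝒜 k → cj a ∈ 𝒜 k
  cj_cj : ∀ a, cj (cj a) = a
  cj_mul : ∀ {k l a b}, a ∈ 𝒜 k → b ∈ 𝒜 l →
    cj (a * b) = ((-1 : ℂ) ^ (k * l)) • (cj b * cj a)
  d_cj : ∀ a, d (cj a) = cj (d a)
  generated : ∀ k, 𝒜 (k + 1) = Submodule.span ℂ {x | ∃ a ∈ 𝒜 k, ∃ b ∈ 𝒜 0, x = a * d b}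

/-- The grading involution, `a ↦ (-1)ᵏ a` for `a` of degree `k`. -/
def degSign : Ω →ₗ[ℂ] Ω :=
  DirectSum.toModule ℂ ℕ Ω (fun k => ((-1 : ℂ) ^ k) • (𝒜 k).subtype) ∘ₗ
    (DirectSum.decomposeLinearEquiv 𝒜).toLinearMap

theorem degSign_of_mem {k : ℕ} {a : Ω} (ha : a ∈ 𝒜 k) :
    degSign 𝒜 a = ((-1 : ℂ) ^ k) • a := by
  lift a to 𝒜 k using ha
  simp only [degSign, LinearMap.comp_apply, LinearEquiv.coe_coe,
    DirectSum.decomposeLinearEquiv_apply, DirectSum.decompose_coe]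
  rw [← DirectSum.lof_eq_of ℂ, DirectSum.toModule_lof]
  simp

end Graded

/-! ### Compact matrix quantum groups -/

section Group

variable (G : Type*) [Ring G] [StarRing G] [HopfAlgebra ℂ G] [StarModule ℂ G]

open Coalgebra

/-- Hopf `*`-algebras which are the dense Hopf `*`-algebra of a compact matrix quantum group:
comultiplication and counit are `*`-maps, and the algebra is generated, as a `*`-algebra, by
the matrix coefficients of one unitary finite-dimensional corepresentation. -/
structure IsCompactMatrixQuantumGroup : Prop where
  comul_star : ∀ g : G, comul (R := ℂ) (star g) = star (comul (R := ℂ) g)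
  counit_star : ∀ g : G, counit (R := ℂ) (star g) = starRingEnd ℂ (counit (R := ℂ) g)
  exists_fundamental : ∃ (n : ℕ) (v : Matrix (Fin n) (Fin n) G),
    v.conjTranspose * v = 1 ∧ v * v.conjTranspose = 1 ∧
    (∀ i j, comul (R := ℂ) (v i j) = ∑ k, v i k ⊗ₜ[ℂ] v k j) ∧
    (∀ i j, counit (R := ℂ) (v i j) = if i = j then 1 else 0) ∧
    StarAlgebra.adjoin ℂ {g : G | ∃ i j, g = v i j} = ⊤

variable {G}
variable {Γ : Type*} [Ring Γ] [Algebra ℂ Γ] {𝒢 : ℕ → Submodule ℂ Γ} [GradedAlgebra 𝒢]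

/-- The relations that present, on generators `g ∈ G` and `γ ∈ Γ¹`, the algebra
`(⨁ₖ Γ¹ ⊗_G ⋯ ⊗_G Γ¹) / 𝒬`, where `𝒬` is the two-sided ideal generated by the elements
`∑ᵢ dgᵢ ⊗_G dhᵢ` with `∑ᵢ gᵢ dhᵢ = 0`. The first four relations say that `G` is a subalgebra
and that the product of `G` with `Γ¹` is the bimodule structure of `Γ¹`. -/
inductive EnvelopeRel (ι : G →ₐ[ℂ] Γ) (d : Γ →ₗ[ℂ] Γ) :
    TensorAlgebra ℂ (G × 𝒢 1) → TensorAlgebra ℂ (G × 𝒢 1) → Prop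
  | one : EnvelopeRel ι d (TensorAlgebra.ι ℂ (1, 0)) 1
  | mul (g h : G) : EnvelopeRel ι d (TensorAlgebra.ι ℂ (g * h, 0))
      (TensorAlgebra.ι ℂ (g, 0) * TensorAlgebra.ι ℂ (h, 0))
  | left (g : G) (γ γ' : 𝒢 1) : (γ' : Γ) = ι g * γ →
      EnvelopeRel ι d (TensorAlgebra.ι ℂ (0, γ'))
        (TensorAlgebra.ι ℂ (g, 0) * TensorAlgebra.ι ℂ (0, γ))
  | right (g : G) (γ γ' : 𝒢 1) : (γ' : Γ) = γ * ι g →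
      EnvelopeRel ι d (TensorAlgebra.ι ℂ (0, γ'))
        (TensorAlgebra.ι ℂ (0, γ) * TensorAlgebra.ι ℂ (g, 0))
  | quad (n : ℕ) (g h : Fin n → G) (γ η : Fin n → 𝒢 1) :
      (∀ i, (γ i : Γ) = d (ι (g i))) → (∀ i, (η i : Γ) = d (ι (h i))) →
      ∑ i, ι (g i) * d (ι (h i)) = 0 →
      EnvelopeRel ι d
        (∑ i, TensorAlgebra.ι ℂ (0, γ i) * TensorAlgebra.ι ℂ (0, η i)) 0

variable (G 𝒢)

/-- The universal differential envelope `*`-calculus `(Γ^∧, d, *)` of a bicovariant first order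
differential `*`-calculus `(Γ¹, d)` on `G`. Here `Γ = Γ^∧`, its degree `0` part is `G`, and its
degree `1` part `𝒢 1` is the first order calculus; `universal` says that the canonical map from
`(⨁ₖ Γ¹ ⊗_G ⋯ ⊗_G Γ¹) / 𝒬` to `Γ^∧` is injective (it is onto by `generated`). -/
structure GroupCalculus extends DiffStar 𝒢 where
  cmqg : IsCompactMatrixQuantumGroup G
  ι : G →ₐ[ℂ] Γ
  ι_injective : Function.Injective ι
  ι_range : LinearMap.range ι.toLinearMap = 𝒢 0
  ι_star : ∀ g, ι (star g) = cj (ι g)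
  universal : ∀ x : TensorAlgebra ℂ (G × 𝒢 1),
    TensorAlgebra.lift ℂ (ι.toLinearMap.coprod (𝒢 1).subtype) x = 0 →
      RingQuot.mkAlgHom ℂ (EnvelopeRel ι d) x = 0
  /-- left covariance: `g dh ↦ φ(g) (id ⊗ d) φ(h)` is well defined -/
  coactL : 𝒢 1 →ₗ[ℂ] G ⊗[ℂ] 𝒢 1
  coactL_spec : ∀ (g h : G) (γ : 𝒢 1), (γ : Γ) = ι g * d (ι h) →
    TensorProduct.map LinearMap.id (𝒢 1).subtype (coactL γ) =
      TensorProduct.map LinearMap.id ι.toLinearMap (comul g) *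
        TensorProduct.map LinearMap.id (d ∘ₗ ι.toLinearMap) (comul h)
  /-- right covariance: `g dh ↦ φ(g) (d ⊗ id) φ(h)` is well defined -/
  coactR : 𝒢 1 →ₗ[ℂ] 𝒢 1 ⊗[ℂ] G
  coactR_spec : ∀ (g h : G) (γ : 𝒢 1), (γ : Γ) = ι g * d (ι h) →
    TensorProduct.map (𝒢 1).subtype LinearMap.id (coactR γ) =
      TensorProduct.map ι.toLinearMap LinearMap.id (comul g) *
        TensorProduct.map (d ∘ₗ ι.toLinearMap) LinearMap.id (comul h)

variable {G 𝒢}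

namespace GroupCalculus

variable (C : GroupCalculus G 𝒢)

/-- The space `inv Γ` of left-invariant elements of `Γ¹`. -/
def inv : Submodule ℂ (𝒢 1) :=
  LinearMap.eqLocus C.coactL (TensorProduct.mk ℂ G (𝒢 1) 1)

theorem ι_mem (g : G) : C.ι g ∈ 𝒢 0 := by
  rw [← C.ι_range]; exact ⟨g, rfl⟩

/-- `dg` as an element of the first order calculus. -/
def d₁ : G →ₗ[ℂ] 𝒢 1 :=
  (C.d ∘ₗ C.ι.toLinearMap).codRestrict (𝒢 1) fun g => C.d_mem (C.ι_mem g)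

/-- The left `G`-module structure of the first order calculus. -/
def lact : G →ₗ[ℂ] 𝒢 1 →ₗ[ℂ] 𝒢 1 :=
  LinearMap.mk₂ ℂ (fun g γ => ⟨C.ι g * γ, by
      have := SetLike.mul_mem_graded (C.ι_mem g) γ.2
      rwa [zero_add] at this⟩)
    (fun a b c => by ext; simp [add_mul]) (fun a b c => by ext; simp)
    (fun a b c => by ext; simp [mul_add]) (fun a b c => by ext; simp)

/-- The quantum germs map with values in `Γ¹`, `g ↦ κ(g⁽¹⁾) dg⁽²⁾`. -/
def germ₁ : G →ₗ[ℂ] 𝒢 1 :=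
  TensorProduct.lift C.lact ∘ₗ
    TensorProduct.map (HopfAlgebra.antipode ℂ) C.d₁ ∘ₗ comul

theorem lact_ext {X : Type*} [AddCommGroup X] [Module ℂ X] {f f' : 𝒢 1 →ₗ[ℂ] X}
    (h : ∀ a b, f (C.lact a (C.d₁ b)) = f' (C.lact a (C.d₁ b))) : f = f' := by
  ext ⟨γ, hγ⟩
  have hγ' := hγ
  rw [show (1 : ℕ) = 0 + 1 from rfl, C.generated 0] at hγ'
  have key : ∀ γ ∈ Submodule.span ℂ {x | ∃ a ∈ 𝒢 0, ∃ b ∈ 𝒢 0, x = a * C.d b},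
      ∀ hγ : γ ∈ 𝒢 1, f ⟨γ, hγ⟩ = f' ⟨γ, hγ⟩ := by
    intro γ hγ
    have hle : ∀ y ∈ Submodule.span ℂ {x | ∃ a ∈ 𝒢 0, ∃ b ∈ 𝒢 0, x = a * C.d b}, y ∈ 𝒢 1 := by
      intro y hy
      rw [show (1 : ℕ) = 0 + 1 from rfl, C.generated 0]; exact hy
    induction hγ using Submodule.span_induction with
    | mem x hx =>
      intro hx1
      obtain ⟨a, ha, b, hb, rfl⟩ := hx
      rw [← C.ι_range] at ha hb
      obtain ⟨a, rfl⟩ := ha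
      obtain ⟨b, rfl⟩ := hb
      exact h a b
    | zero =>
      intro h0
      have : (⟨0, h0⟩ : 𝒢 1) = 0 := rfl
      rw [this, map_zero, map_zero]
    | add x y hx hy ihx ihy =>
      intro hxy
      have : (⟨x + y, hxy⟩ : 𝒢 1) = ⟨x, hle x hx⟩ + ⟨y, hle y hy⟩ := rfl
      rw [this, map_add, map_add, ihx, ihy]
    | smul c x hx ih =>
      intro hcx
      have : (⟨c • x, hcx⟩ : 𝒢 1) = c • ⟨x, hle x hx⟩ := rfl
      rw [this, map_smul, map_smul, ih]
  exact key γ hγ' hγ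

/-- `G ⊗ G` acts on `G ⊗ Γ¹` from the left. -/
def actL : G ⊗[ℂ] G →ₗ[ℂ] G ⊗[ℂ] 𝒢 1 →ₗ[ℂ] G ⊗[ℂ] 𝒢 1 :=
  TensorProduct.map₂ (LinearMap.mul ℂ G) C.lact

/-- `G ⊗ G` acts on `Γ¹ ⊗ G` from the left. -/
def actR : G ⊗[ℂ] G →ₗ[ℂ] 𝒢 1 ⊗[ℂ] G →ₗ[ℂ] 𝒢 1 ⊗[ℂ] G :=
  TensorProduct.map₂ C.lact (LinearMap.mul ℂ G)

@[simp] theorem actL_tmul (a b c : G) (γ : 𝒢 1) :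
    C.actL (a ⊗ₜ b) (c ⊗ₜ γ) = (a * c) ⊗ₜ C.lact b γ := rfl

@[simp] theorem actR_tmul (a b c : G) (γ : 𝒢 1) :
    C.actR (a ⊗ₜ b) (γ ⊗ₜ c) = C.lact a γ ⊗ₜ (b * c) := rfl

@[simp] theorem lact_coe (a : G) (γ : 𝒢 1) : (C.lact a γ : Γ) = C.ι a * γ := rfl

@[simp] theorem d₁_coe (a : G) : (C.d₁ a : Γ) = C.d (C.ι a) := rfl

theorem lact_one (γ : 𝒢 1) : C.lact 1 γ = γ := by ext; simp

theorem lact_mul (a b : G) (γ : 𝒢 1) : C.lact (a * b) γ = C.lact a (C.lact b γ) := by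
  ext; simp [mul_assoc]

theorem actL_one (x : G ⊗[ℂ] 𝒢 1) : C.actL 1 x = x := by
  induction x with
  | zero => simp
  | tmul a b => rw [Algebra.TensorProduct.one_def, actL_tmul, one_mul, lact_one]
  | add x y hx hy => rw [map_add, hx, hy]

theorem actL_mul (s t : G ⊗[ℂ] G) (x : G ⊗[ℂ] 𝒢 1) :
    C.actL (s * t) x = C.actL s (C.actL t x) := by
  induction s with
  | zero => simp
  | add s s' h h' => simp only [add_mul, map_add, LinearMap.add_apply, h, h']
  | tmul a b =>
    induction t with
    | zero => simp
    | add s s' h h' => simp only [mul_add, map_add, LinearMap.add_apply, h, h']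
    | tmul c e =>
      induction x with
      | zero => simp
      | add s s' h h' => simp only [map_add, h, h']
      | tmul f γ => simp [mul_assoc, lact_mul]

theorem coactL_lact_d₁ (g h : G) : C.coactL (C.lact g (C.d₁ h)) =
    C.actL (comul g) (TensorProduct.map LinearMap.id C.d₁ (comul h)) := by
  have hinj : Function.Injective
      (TensorProduct.map (LinearMap.id : G →ₗ[ℂ] G) (𝒢 1).subtype) :=
    Module.Flat.lTensor_preserves_injective_linearMap _ (𝒢 1).injective_subtype
  apply hinj
  rw [C.coactL_spec g h _ rfl]
  generalize (comul g : G ⊗[ℂ] G) = s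
  generalize (comul h : G ⊗[ℂ] G) = t
  induction s with
  | zero => simp
  | add s s' h h' => simp only [add_mul, map_add, LinearMap.add_apply, h, h']
  | tmul a b =>
    induction t with
    | zero => simp
    | add s s' h h' => simp only [mul_add, map_add, h, h']
    | tmul c e => simp

theorem coactR_lact_d₁ (g h : G) : C.coactR (C.lact g (C.d₁ h)) =
    C.actR (comul g) (TensorProduct.map C.d₁ LinearMap.id (comul h)) := by
  have hinj : Function.Injective
      (TensorProduct.map (𝒢 1).subtype (LinearMap.id : G →ₗ[ℂ] G)) :=
    Module.Flat.rTensor_preserves_injective_linearMap _ (𝒢 1).injective_subtype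
  apply hinj
  rw [C.coactR_spec g h _ rfl]
  generalize (comul g : G ⊗[ℂ] G) = s
  generalize (comul h : G ⊗[ℂ] G) = t
  induction s with
  | zero => simp
  | add s s' h h' => simp only [add_mul, map_add, LinearMap.add_apply, h, h']
  | tmul a b =>
    induction t with
    | zero => simp
    | add s s' h h' => simp only [mul_add, map_add, h, h']
    | tmul c e => simp

theorem coactL_lact (a : G) (γ : 𝒢 1) :
    C.coactL (C.lact a γ) = C.actL (comul a) (C.coactL γ) := by
  have : C.coactL ∘ₗ C.lact a = C.actL (comul a) ∘ₗ C.coactL := by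
    apply C.lact_ext
    intro b c
    simp only [LinearMap.comp_apply]
    rw [← lact_mul, coactL_lact_d₁, coactL_lact_d₁, ← actL_mul, Bialgebra.comul_mul]
  exact LinearMap.congr_fun this γ

theorem coactL_d₁ (h : G) :
    C.coactL (C.d₁ h) = TensorProduct.map LinearMap.id C.d₁ (comul h) := by
  have := C.coactL_lact_d₁ 1 h
  rwa [lact_one, Bialgebra.comul_one, actL_one] at this

/-- `∑ g⁽¹⁾ π(g⁽²⁾) = dg`. -/
theorem lact_germ₁ (g : G) :
    TensorProduct.lift C.lact (TensorProduct.map LinearMap.id C.germ₁ (comul g)) = C.d₁ g := by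
  let S : (G ⊗[ℂ] G) ⊗[ℂ] G →ₗ[ℂ] 𝒢 1 :=
    TensorProduct.lift C.lact ∘ₗ TensorProduct.map
      (LinearMap.mul' ℂ G ∘ₗ TensorProduct.map LinearMap.id (HopfAlgebra.antipode ℂ)) C.d₁
  have h1 : ∀ x : G ⊗[ℂ] G,
      TensorProduct.lift C.lact (TensorProduct.map LinearMap.id C.germ₁ x) =
      S ((TensorProduct.assoc ℂ G G G).symm (TensorProduct.map LinearMap.id comul x)) := by
    intro x
    induction x with
    | zero => simp
    | add x y hx hy => simp only [map_add, hx, hy]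
    | tmul a b =>
      simp only [TensorProduct.map_tmul, LinearMap.id_apply, TensorProduct.lift.tmul, germ₁,
        LinearMap.comp_apply]
      generalize (comul b : G ⊗[ℂ] G) = t
      induction t with
      | zero => simp
      | add x y hx hy => simp only [map_add, TensorProduct.tmul_add, hx, hy]
      | tmul c e => simp [S, lact_mul]
  have h2 : ∀ x : G ⊗[ℂ] G, S (TensorProduct.map comul LinearMap.id x) =
      TensorProduct.lift C.lact (TensorProduct.map
        (Algebra.linearMap ℂ G ∘ₗ counit) C.d₁ x) := by
    intro x
    induction x with
    | zero => simp
    | add x y hx hy => simp only [map_add, hx, hy]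
    | tmul a b =>
      have := HopfAlgebra.mul_antipode_lTensor_comul_apply (R := ℂ) a
      simp only [LinearMap.lTensor] at this
      simp only [S, TensorProduct.map_tmul, LinearMap.comp_apply, this]
      simp
  have h3 := Coalgebra.coassoc_symm_apply (R := ℂ) g
  rw [h1]
  change S ((TensorProduct.assoc ℂ G G G).symm (LinearMap.lTensor G comul (comul g))) = _
  rw [h3]
  change S (TensorProduct.map comul LinearMap.id (comul g)) = _
  rw [h2]
  have h4 := Coalgebra.rTensor_counit_comul (R := ℂ) g
  have h5 : ∀ x : G ⊗[ℂ] G, TensorProduct.map (Algebra.linearMap ℂ G ∘ₗ counit) C.d₁ x =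
      TensorProduct.map (Algebra.linearMap ℂ G) C.d₁ (LinearMap.rTensor G counit x) := by
    intro x
    induction x with
    | zero => simp
    | add x y hx hy => simp only [map_add, hx, hy]
    | tmul a b => simp
  rw [h5, h4]
  simp [lact_one]

theorem conv_injective {f f' : G →ₗ[ℂ] G ⊗[ℂ] 𝒢 1}
    (h : ∀ g, TensorProduct.lift C.actL (TensorProduct.map comul f (comul g)) =
      TensorProduct.lift C.actL (TensorProduct.map comul f' (comul g))) : f = f' := by
  have key : ∀ f : G →ₗ[ℂ] G ⊗[ℂ] 𝒢 1, ∀ g, f g =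
      TensorProduct.lift C.actL (TensorProduct.map (comul ∘ₗ HopfAlgebra.antipode ℂ)
        (TensorProduct.lift C.actL ∘ₗ TensorProduct.map comul f ∘ₗ comul) (comul g)) := by
    intro f g
    let S : (G ⊗[ℂ] G) ⊗[ℂ] G →ₗ[ℂ] G ⊗[ℂ] 𝒢 1 :=
      TensorProduct.lift C.actL ∘ₗ TensorProduct.map
        (comul ∘ₗ LinearMap.mul' ℂ G ∘ₗ
          TensorProduct.map (HopfAlgebra.antipode ℂ) LinearMap.id) f
    have h1 : ∀ x : G ⊗[ℂ] G,
        TensorProduct.lift C.actL (TensorProduct.map (comul ∘ₗ HopfAlgebra.antipode ℂ)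
          (TensorProduct.lift C.actL ∘ₗ TensorProduct.map comul f ∘ₗ comul) x) =
        S ((TensorProduct.assoc ℂ G G G).symm (TensorProduct.map LinearMap.id comul x)) := by
      intro x
      induction x with
      | zero => simp
      | add x y hx hy => simp only [map_add, hx, hy]
      | tmul a b =>
        simp only [TensorProduct.map_tmul, LinearMap.id_apply, TensorProduct.lift.tmul,
          LinearMap.comp_apply]
        generalize (comul b : G ⊗[ℂ] G) = t
        induction t with
        | zero => simp
        | add x y hx hy => simp only [map_add, TensorProduct.tmul_add, hx, hy]
        | tmul c e => simp [S, actL_mul]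
    have h2 : ∀ x : G ⊗[ℂ] G, S (TensorProduct.map comul LinearMap.id x) =
        TensorProduct.lift C.actL (TensorProduct.map
          (comul ∘ₗ Algebra.linearMap ℂ G ∘ₗ counit) f x) := by
      intro x
      induction x with
      | zero => simp
      | add x y hx hy => simp only [map_add, hx, hy]
      | tmul a b =>
        have := HopfAlgebra.mul_antipode_rTensor_comul_apply (R := ℂ) a
        simp only [LinearMap.rTensor] at this
        simp only [S, TensorProduct.map_tmul, LinearMap.comp_apply, this]
        simp
    have h3 := Coalgebra.coassoc_symm_apply (R := ℂ) g
    rw [h1]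
    change _ = S ((TensorProduct.assoc ℂ G G G).symm (LinearMap.lTensor G comul (comul g)))
    rw [h3]
    change _ = S (TensorProduct.map comul LinearMap.id (comul g))
    rw [h2]
    have h4 := Coalgebra.rTensor_counit_comul (R := ℂ) g
    have h5 : ∀ x : G ⊗[ℂ] G,
        TensorProduct.map (comul ∘ₗ Algebra.linearMap ℂ G ∘ₗ counit) f x =
        TensorProduct.map (comul ∘ₗ Algebra.linearMap ℂ G) f (LinearMap.rTensor G counit x) := by
      intro x
      induction x with
      | zero => simp
      | add x y hx hy => simp only [map_add, hx, hy]
      | tmul a b => simp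
    rw [h5, h4]
    simp [actL_one]
  ext1 g
  rw [key f g, key f' g]
  congr 3
  ext1 g
  exact h g

theorem germ₁_mem (g : G) : C.germ₁ g ∈ C.inv := by
  have : C.coactL ∘ₗ C.germ₁ = TensorProduct.mk ℂ G (𝒢 1) 1 ∘ₗ C.germ₁ := by
    apply C.conv_injective
    intro g
    have h1 : ∀ x : G ⊗[ℂ] G,
        TensorProduct.lift C.actL (TensorProduct.map comul (C.coactL ∘ₗ C.germ₁) x) =
        C.coactL (TensorProduct.lift C.lact (TensorProduct.map LinearMap.id C.germ₁ x)) := by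
      intro x
      induction x with
      | zero => simp
      | add x y hx hy => simp only [map_add, hx, hy]
      | tmul a b => simp [coactL_lact]
    have h2 : ∀ x : G ⊗[ℂ] G,
        TensorProduct.lift C.actL (TensorProduct.map comul
          (TensorProduct.mk ℂ G (𝒢 1) 1 ∘ₗ C.germ₁) x) =
        TensorProduct.map LinearMap.id (TensorProduct.lift C.lact ∘ₗ
          TensorProduct.map LinearMap.id C.germ₁)
            (TensorProduct.assoc ℂ G G G (LinearMap.rTensor G comul x)) := by
      intro x
      induction x with
      | zero => simp
      | add x y hx hy => simp only [map_add, hx, hy]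
      | tmul a b =>
        simp only [TensorProduct.map_tmul, LinearMap.comp_apply, TensorProduct.lift.tmul,
          LinearMap.rTensor_tmul, TensorProduct.mk_apply]
        generalize (comul a : G ⊗[ℂ] G) = t
        induction t with
        | zero => simp
        | add x y hx hy =>
          simp only [map_add, TensorProduct.add_tmul, LinearMap.add_apply, hx, hy]
        | tmul c e => simp
    rw [h1, h2, lact_germ₁, coactL_d₁, Coalgebra.coassoc_apply]
    have h3 : ∀ x : G ⊗[ℂ] G, TensorProduct.map LinearMap.id C.d₁ x =
        TensorProduct.map LinearMap.id (TensorProduct.lift C.lact ∘ₗ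
          TensorProduct.map LinearMap.id C.germ₁) (LinearMap.lTensor G comul x) := by
      intro x
      induction x with
      | zero => simp
      | add x y hx hy => simp only [map_add, hx, hy]
      | tmul a b => simp [lact_germ₁]
    exact h3 _
  exact LinearMap.congr_fun this g

/-- The quantum germs map `π : G → inv Γ`, `π(g) = κ(g⁽¹⁾) dg⁽²⁾`. -/
def germ : G →ₗ[ℂ] C.inv := C.germ₁.codRestrict C.inv C.germ₁_mem

/-- The left and the right coaction commute. -/
theorem coact_comm (γ : 𝒢 1) :
    TensorProduct.assoc ℂ G (𝒢 1) G (LinearMap.rTensor G C.coactL (C.coactR γ)) =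
      LinearMap.lTensor G C.coactR (C.coactL γ) := by
  have : (TensorProduct.assoc ℂ G (𝒢 1) G).toLinearMap ∘ₗ LinearMap.rTensor G C.coactL ∘ₗ
      C.coactR = LinearMap.lTensor G C.coactR ∘ₗ C.coactL := by
    apply C.lact_ext
    intro g h
    simp only [LinearMap.comp_apply, LinearEquiv.coe_coe, coactL_lact_d₁, coactR_lact_d₁]
    let B' : G ⊗[ℂ] (G ⊗[ℂ] G) →ₗ[ℂ] G ⊗[ℂ] (G ⊗[ℂ] G) →ₗ[ℂ] G ⊗[ℂ] (𝒢 1 ⊗[ℂ] G) :=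
      (TensorProduct.map₂ (LinearMap.mul ℂ G) C.actR).compl₂
        (LinearMap.lTensor G (LinearMap.rTensor G C.d₁))
    have hR : ∀ x y : G ⊗[ℂ] G,
        LinearMap.lTensor G C.coactR (C.actL x (TensorProduct.map LinearMap.id C.d₁ y)) =
        B' (LinearMap.lTensor G comul x) (LinearMap.lTensor G comul y) := by
      intro x y
      induction x with
      | zero => simp
      | add x y hx hy => simp only [map_add, LinearMap.add_apply, hx, hy]
      | tmul a b =>
        induction y with
        | zero => simp
        | add x y hx hy => simp only [map_add, hx, hy]
        | tmul c e =>
          simp only [TensorProduct.map_tmul, LinearMap.id_apply, actL_tmul,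
            LinearMap.lTensor_tmul, coactR_lact_d₁]
          rfl
    have hL : ∀ x y : G ⊗[ℂ] G,
        TensorProduct.assoc ℂ G (𝒢 1) G (LinearMap.rTensor G C.coactL
          (C.actR x (TensorProduct.map C.d₁ LinearMap.id y))) =
        B' (TensorProduct.assoc ℂ G G G (LinearMap.rTensor G comul x))
          (TensorProduct.assoc ℂ G G G (LinearMap.rTensor G comul y)) := by
      intro x y
      induction x with
      | zero => simp
      | add x y hx hy => simp only [map_add, LinearMap.add_apply, hx, hy]
      | tmul a b =>
        induction y with
        | zero => simp
        | add x y hx hy => simp only [map_add, hx, hy]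
        | tmul c e =>
          simp only [TensorProduct.map_tmul, LinearMap.id_apply, actR_tmul,
            LinearMap.rTensor_tmul, coactL_lact_d₁]
          generalize (comul a : G ⊗[ℂ] G) = s
          generalize (comul c : G ⊗[ℂ] G) = t
          induction s with
          | zero => simp
          | add x y hx hy =>
            simp only [map_add, LinearMap.add_apply, TensorProduct.add_tmul, hx, hy]
          | tmul p q =>
            induction t with
            | zero => simp
            | add x y hx hy => simp only [map_add, TensorProduct.add_tmul, hx, hy]
            | tmul r w => simp [B']
    rw [hL, hR, Coalgebra.coassoc_apply, Coalgebra.coassoc_apply]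
  exact LinearMap.congr_fun this γ

theorem coactR_mem (θ : C.inv) :
    C.coactR θ ∈ LinearMap.range (LinearMap.rTensor G C.inv.subtype) := by
  have hex : Function.Exact C.inv.subtype (C.coactL - TensorProduct.mk ℂ G (𝒢 1) 1) := by
    intro x
    rw [LinearMap.sub_apply, sub_eq_zero]
    constructor
    · intro h
      exact ⟨⟨x, h⟩, rfl⟩
    · rintro ⟨y, rfl⟩
      exact y.2
  have hex' := Module.Flat.rTensor_exact (R := ℂ) (M := G) (N := C.inv) (N' := 𝒢 1)
    (N'' := G ⊗[ℂ] 𝒢 1) (f := C.inv.subtype)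
    (g := C.coactL - TensorProduct.mk ℂ G (𝒢 1) 1) hex
  apply (hex' _).1
  rw [LinearMap.rTensor_sub]
  change LinearMap.rTensor G C.coactL (C.coactR θ) -
    LinearMap.rTensor G (TensorProduct.mk ℂ G (𝒢 1) 1) (C.coactR θ) = 0
  rw [sub_eq_zero]
  apply (TensorProduct.assoc ℂ G (𝒢 1) G).injective
  have hθ : C.coactL θ = 1 ⊗ₜ (θ : 𝒢 1) := θ.2
  rw [coact_comm, hθ, LinearMap.lTensor_tmul]
  generalize C.coactR (θ : 𝒢 1) = t
  induction t with
  | zero => simp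
  | add x y hx hy => simp only [map_add, TensorProduct.tmul_add, hx, hy]
  | tmul a b => simp

/-- The adjoint corepresentation of `G` on `inv Γ`: the restriction to `inv Γ` of the right
coaction on `Γ¹`. -/
def ad : C.inv →ₗ[ℂ] C.inv ⊗[ℂ] G :=
  (LinearEquiv.ofInjective (LinearMap.rTensor G C.inv.subtype)
      (Module.Flat.rTensor_preserves_injective_linearMap _ C.inv.injective_subtype)).symm ∘ₗ
    (C.coactR ∘ₗ C.inv.subtype).codRestrict _ C.coactR_mem

theorem ad_spec (θ : C.inv) :
    LinearMap.rTensor G C.inv.subtype (C.ad θ) = C.coactR θ := by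
  have := LinearEquiv.apply_symm_apply (LinearEquiv.ofInjective
    (LinearMap.rTensor G C.inv.subtype)
      (Module.Flat.rTensor_preserves_injective_linearMap _ C.inv.injective_subtype))
      ((C.coactR ∘ₗ C.inv.subtype).codRestrict _ C.coactR_mem θ)
  exact congrArg Subtype.val this

/-- The involution on `Γ¹`. -/
def cj₁ : 𝒢 1 →ₗ⋆[ℂ] 𝒢 1 :=
  (C.cj ∘ₛₗ (𝒢 1).subtype).codRestrict (𝒢 1) fun γ => C.cj_mem γ.2

theorem cj₁_lact_d₁ (g h : G) : C.cj₁ (C.lact g (C.d₁ h)) =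
    C.d₁ (star h * star g) - C.lact (star h) (C.d₁ (star g)) := by
  ext
  change C.cj (C.ι g * C.d (C.ι h)) = C.d (C.ι (star h * star g)) - C.ι (star h) * C.d (C.ι (star g))
  rw [C.cj_mul (C.ι_mem g) (C.d_mem (C.ι_mem h)), ← C.d_cj, ← C.ι_star, ← C.ι_star, map_mul,
    C.leibniz (C.ι_mem (star h))]
  simp

theorem coactL_cj₁ (γ : 𝒢 1) : C.coactL (C.cj₁ γ) =
    TensorProduct.map (starLinearEquiv ℂ (A := G)).toLinearMap C.cj₁ (C.coactL γ) := by
  let F : 𝒢 1 →ₗ[ℂ] G ⊗[ℂ] 𝒢 1 :=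
    (TensorProduct.map (starLinearEquiv ℂ (A := G)).toLinearMap C.cj₁) ∘ₛₗ (C.coactL ∘ₛₗ C.cj₁)
  have hcc : ∀ γ, C.cj₁ (C.cj₁ γ) = γ := fun γ => by
    ext; exact C.cj_cj _
  have hF : F = C.coactL := by
    apply C.lact_ext
    intro g h
    simp only [F, LinearMap.comp_apply, cj₁_lact_d₁, map_sub, coactL_d₁, coactL_lact_d₁,
      Bialgebra.comul_mul, C.cmqg.comul_star]
    generalize (comul g : G ⊗[ℂ] G) = s
    generalize (comul h : G ⊗[ℂ] G) = t
    induction s with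
    | zero => simp
    | add x y hx hy =>
      simp only [map_add, LinearMap.add_apply, mul_add, star_add, ← hx, ← hy]
      abel
    | tmul a b =>
      induction t with
      | zero => simp
      | add x y hx hy =>
        simp only [map_add, LinearMap.add_apply, add_mul, star_add, ← hx, ← hy]
        abel
      | tmul c e =>
        have : C.cj₁ (C.d₁ (star e * star b)) - C.cj₁ (C.lact (star e) (C.d₁ (star b))) =
            C.lact b (C.d₁ e) := by
          rw [← map_sub, ← cj₁_lact_d₁, hcc]
        simp only [TensorProduct.star_tmul, Algebra.TensorProduct.tmul_mul_tmul,
          TensorProduct.map_tmul, LinearMap.id_apply, actL_tmul, LinearEquiv.coe_coe,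
          starLinearEquiv_apply, star_mul, star_star, ← TensorProduct.tmul_sub, this]
  have h2 := LinearMap.congr_fun hF (C.cj₁ γ)
  simp only [F, LinearMap.comp_apply, hcc] at h2
  exact h2.symm

/-- The involution on `inv Γ`. -/
def invCj : C.inv →ₗ⋆[ℂ] C.inv :=
  (C.cj₁ ∘ₛₗ C.inv.subtype).codRestrict C.inv fun θ => by
    have hθ : C.coactL θ = 1 ⊗ₜ (θ : 𝒢 1) := θ.2
    change C.coactL (C.cj₁ θ) = 1 ⊗ₜ C.cj₁ (θ : 𝒢 1)
    rw [coactL_cj₁, hθ]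
    simp

end GroupCalculus

end Group

/-! ### Quantum principal bundles and their differential calculi -/

section Bundle

variable (G : Type*) [Ring G] [StarRing G] [HopfAlgebra ℂ G] [StarModule ℂ G]
variable (P : Type*) [Ring P] [StarRing P] [Algebra ℂ P] [StarModule ℂ P]

open Coalgebra

/-- A quantum principal `G`-bundle with total space `P` (the algebra `GM`): a `*`-algebra
morphism `Φ : P → P ⊗ G` which is a corepresentation and for which
`x ⊗ y ↦ (x ⊗ 1) Φ(y)` is onto. Its base `M` is the algebra of coinvariants `QuantumBundle.base`. -/
structure QuantumBundle where
  Φ : P →⋆ₐ[ℂ] P ⊗[ℂ] G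
  coassoc : ∀ x, TensorProduct.assoc ℂ P G G
      (LinearMap.rTensor G Φ.toAlgHom.toLinearMap (Φ x)) = LinearMap.lTensor P comul (Φ x)
  counit : ∀ x, TensorProduct.rid ℂ P (LinearMap.lTensor P counit (Φ x)) = x
  canonical_surjective : Function.Surjective
    (LinearMap.mul' ℂ (P ⊗[ℂ] G) ∘ₗ TensorProduct.map
      (Algebra.TensorProduct.includeLeft (R := ℂ) (S := ℂ) (A := P) (B := G)).toLinearMap
      Φ.toAlgHom.toLinearMap)

variable {G P}

/-- The base `M = {x | Φ(x) = x ⊗ 1}` of a quantum principal bundle. -/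
def QuantumBundle.base (B : QuantumBundle G P) : StarSubalgebra ℂ P where
  carrier := {x | B.Φ x = x ⊗ₜ 1}
  mul_mem' {a b} ha hb := by
    simp only [Set.mem_ofPred_eq] at *
    rw [map_mul, ha, hb, Algebra.TensorProduct.tmul_mul_tmul, one_mul]
  add_mem' {a b} ha hb := by
    simp only [Set.mem_ofPred_eq] at *
    rw [map_add, ha, hb, TensorProduct.add_tmul]
  algebraMap_mem' c := by
    simp only [Set.mem_ofPred_eq, AlgHomClass.commutes, Algebra.TensorProduct.algebraMap_apply]
  star_mem' {a} ha := by
    simp only [Set.mem_ofPred_eq] at *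
    rw [map_star, ha, TensorProduct.star_tmul, star_one]

variable {Γ : Type*} [Ring Γ] [Algebra ℂ Γ] {𝒢 : ℕ → Submodule ℂ Γ} [GradedAlgebra 𝒢]
variable {Ω : Type*} [Ring Ω] [Algebra ℂ Ω] (𝒜 : ℕ → Submodule ℂ Ω) [GradedAlgebra 𝒜]

/-- A differential calculus on a quantum principal bundle: a graded differential `*`-algebra
`Ω = Ω•(GM)` generated by its degree `0` part `GM`, a calculus on the quantum group, and an
extension of `Φ` to a morphism `Ψ` of graded differential `*`-algebras from `Ω` to the graded
tensor product of `Ω` with `Γ^∧`. -/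
structure BundleCalculus (B : QuantumBundle G P) (C : GroupCalculus G 𝒢) extends DiffStar 𝒜 where
  ιP : P →ₐ[ℂ] Ω
  ιP_injective : Function.Injective ιP
  ιP_range : LinearMap.range ιP.toLinearMap = 𝒜 0
  ιP_star : ∀ x, ιP (star x) = cj (ιP x)
  Ψ : Ω →ₐ[ℂ] 𝒜 ᵍ⊗[ℂ] 𝒢
  Ψ_ιP : ∀ x, Ψ (ιP x) = GradedTensorProduct.of ℂ 𝒜 𝒢
    (TensorProduct.map ιP.toLinearMap C.ι.toLinearMap (B.Φ x))
  Ψ_proj : ∀ k φ, (GradedTensorProduct.of ℂ 𝒜 𝒢).symm (Ψ (GradedAlgebra.proj 𝒜 k φ)) =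
    ∑ i ∈ Finset.range (k + 1), TensorProduct.map (GradedAlgebra.proj 𝒜 i)
      (GradedAlgebra.proj 𝒢 (k - i)) ((GradedTensorProduct.of ℂ 𝒜 𝒢).symm (Ψ φ))
  Ψ_d : ∀ φ, (GradedTensorProduct.of ℂ 𝒜 𝒢).symm (Ψ (d φ)) =
    TensorProduct.map d LinearMap.id ((GradedTensorProduct.of ℂ 𝒜 𝒢).symm (Ψ φ)) +
      TensorProduct.map (degSign 𝒜) C.d ((GradedTensorProduct.of ℂ 𝒜 𝒢).symm (Ψ φ))
  Ψ_cj : ∀ φ, (GradedTensorProduct.of ℂ 𝒜 𝒢).symm (Ψ (cj φ)) =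
    TensorProduct.map cj C.cj ((GradedTensorProduct.of ℂ 𝒜 𝒢).symm (Ψ φ))

/-- The space `Mor(ad, Φ)` of intertwiners, i.e. the sections of the associated (left or right)
quantum vector bundle of `ad`. -/
def MorP (B : QuantumBundle G P) (C : GroupCalculus G 𝒢) : Submodule ℂ (C.inv →ₗ[ℂ] P) where
  carrier := {T | ∀ θ, B.Φ (T θ) = LinearMap.rTensor G T (C.ad θ)}
  zero_mem' θ := by simp
  add_mem' {S T} hS hT θ := by
    rw [LinearMap.add_apply, map_add, hS, hT, LinearMap.rTensor_add, LinearMap.add_apply]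
  smul_mem' c T hT θ := by
    rw [LinearMap.smul_apply, map_smul, hT, LinearMap.rTensor_smul, LinearMap.smul_apply]

variable {𝒜} {B : QuantumBundle G P} {C : GroupCalculus G 𝒢}

/-- The left `M`-module structure of the space of sections. -/
def lsmul (p : B.base) (T : MorP B C) : MorP B C :=
  ⟨LinearMap.mulLeft ℂ (p : P) ∘ₗ T.1, fun θ => by
    have hp : B.Φ p = (p : P) ⊗ₜ 1 := p.2
    rw [LinearMap.comp_apply, LinearMap.mulLeft_apply, map_mul, hp, T.2 θ]
    generalize C.ad θ = t
    induction t with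
    | zero => simp
    | add x y hx hy => simp only [map_add, mul_add, hx, hy]
    | tmul a b => simp⟩

/-- The right `M`-module structure of the space of sections. -/
def rsmul (T : MorP B C) (p : B.base) : MorP B C :=
  ⟨LinearMap.mulRight ℂ (p : P) ∘ₗ T.1, fun θ => by
    have hp : B.Φ p = (p : P) ⊗ₜ 1 := p.2
    rw [LinearMap.comp_apply, LinearMap.mulRight_apply, map_mul, hp, T.2 θ]
    generalize C.ad θ = t
    induction t with
    | zero => simp
    | add x y hx hy => simp only [map_add, add_mul, hx, hy]
    | tmul a b => simp⟩

namespace BundleCalculus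

variable (X : BundleCalculus 𝒜 B C)

/-- `Ψ` as a linear map into the underlying tensor product. -/
def psi : Ω →ₗ[ℂ] Ω ⊗[ℂ] Γ :=
  (GradedTensorProduct.of ℂ 𝒜 𝒢).symm.toLinearMap ∘ₗ X.Ψ.toLinearMap

/-- The projection of `Γ^∧` onto its degree `0` part `G`. -/
def projG (C : GroupCalculus G 𝒢) : Γ →ₗ[ℂ] G :=
  (LinearEquiv.ofInjective C.ι.toLinearMap C.ι_injective).symm.toLinearMap ∘ₗ
    (GradedAlgebra.proj 𝒢 0).codRestrict _ fun x => by
      rw [C.ι_range]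
      exact (DirectSum.decompose 𝒢 x 0).2

/-- The right coaction `φ ↦ φ⁽⁰⁾ ⊗ φ⁽¹⁾` of `G` on `Ω`. On horizontal forms, i.e. where `Ψ` takes
values in `Ω ⊗ G`, it is the corestriction of `Ψ`. -/
def coactΩ : Ω →ₗ[ℂ] Ω ⊗[ℂ] G := LinearMap.lTensor Ω (projG C) ∘ₗ X.psi

/-- The algebra `Ω•(M)` of forms `μ` with `Ψ(μ) = μ ⊗ 1`. -/
def baseForms : Subalgebra ℂ Ω :=
  AlgHom.equalizer X.Ψ (GradedTensorProduct.includeLeft 𝒜 𝒢)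

theorem mem_baseForms {μ : Ω} : μ ∈ X.baseForms ↔ X.psi μ = μ ⊗ₜ 1 := Iff.rfl

/-- The inclusion of `M` in `Ω•(M)`. -/
def ιM : B.base →ₐ[ℂ] X.baseForms :=
  (X.ιP.comp B.base.subtype.toAlgHom).codRestrict X.baseForms fun p => by
    have hp : B.Φ p = (p : P) ⊗ₜ 1 := p.2
    change X.Ψ (X.ιP p) = _
    rw [X.Ψ_ιP, hp]
    simp

@[simp] theorem ιM_coe (p : B.base) : (X.ιM p : Ω) = X.ιP p := rfl

theorem ιM_mem (p : B.base) : (X.ιM p : Ω) ∈ 𝒜 0 := by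
  rw [← X.ιP_range]; exact ⟨p, rfl⟩

/-- The differential of `Ω•(M)`. -/
def dM : X.baseForms →ₗ[ℂ] X.baseForms :=
  (X.d ∘ₗ X.baseForms.val.toLinearMap).codRestrict (Subalgebra.toSubmodule X.baseForms)
    fun μ => by
      have hμ : X.psi μ = (μ : Ω) ⊗ₜ 1 := μ.2
      change X.psi (X.d μ) = X.d μ ⊗ₜ 1
      have h1 : C.d 1 = 0 := by
        have := C.leibniz (SetLike.GradedOne.one_mem (A := 𝒢)) 1
        simpa using this
      refine (X.Ψ_d μ).trans ?_
      change TensorProduct.map X.d LinearMap.id (X.psi μ) +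
        TensorProduct.map (degSign 𝒜) C.d (X.psi μ) = _
      rw [hμ]
      simp [h1]

/-- The involution of `Ω•(M)`. -/
def cjM : X.baseForms →ₗ⋆[ℂ] X.baseForms :=
  (X.cj ∘ₛₗ X.baseForms.val.toLinearMap).codRestrict (Subalgebra.toSubmodule X.baseForms)
    fun μ => by
      have hμ : X.psi μ = (μ : Ω) ⊗ₜ 1 := μ.2
      change X.psi (X.cj μ) = X.cj μ ⊗ₜ 1
      have h1 : C.cj 1 = 1 := by
        have := C.ι_star 1
        simpa using this.symm
      refine (X.Ψ_cj μ).trans ?_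
      change TensorProduct.map X.cj C.cj (X.psi μ) = _
      rw [hμ]
      simp [h1]

theorem proj_mem (k : ℕ) (μ : X.baseForms) : GradedAlgebra.proj 𝒜 k μ ∈ X.baseForms := by
  have hμ : X.psi μ = (μ : Ω) ⊗ₜ 1 := μ.2
  rw [mem_baseForms]
  refine (X.Ψ_proj k μ).trans ?_
  change ∑ i ∈ Finset.range (k + 1), TensorProduct.map (GradedAlgebra.proj 𝒜 i)
      (GradedAlgebra.proj 𝒢 (k - i)) (X.psi μ) = _
  rw [hμ, Finset.sum_eq_single k]
  · rw [TensorProduct.map_tmul, Nat.sub_self]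
    congr 1
    exact DirectSum.decompose_of_mem_same 𝒢 (SetLike.GradedOne.one_mem (A := 𝒢))
  · intro i hi hne
    rw [Finset.mem_range] at hi
    have hj : 0 ≠ k - i := by omega
    rw [TensorProduct.map_tmul]
    have : GradedAlgebra.proj 𝒢 (k - i) 1 = 0 :=
      DirectSum.decompose_of_mem_ne 𝒢 (SetLike.GradedOne.one_mem (A := 𝒢)) hj
    rw [this, TensorProduct.tmul_zero]
  · intro h
    simp at h

/-- Two maps out of `Ω•(M)` agree if they agree on homogeneous base forms. -/
theorem baseForms_induction {p : X.baseForms → Prop} (h0 : p 0)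
    (hadd : ∀ μ ν, p μ → p ν → p (μ + ν))
    (hom : ∀ k (μ : X.baseForms), (μ : Ω) ∈ 𝒜 k → p μ) (μ : X.baseForms) : p μ := by
  classical
  have hsum : μ = ∑ k ∈ (DirectSum.decompose 𝒜 (μ : Ω)).support,
      (⟨GradedAlgebra.proj 𝒜 k μ, X.proj_mem k μ⟩ : X.baseForms) := by
    ext
    rw [AddSubmonoidClass.coe_finsetSum]
    exact (DirectSum.sum_support_decompose 𝒜 (μ : Ω)).symm
  rw [hsum]
  exact Finset.sum_induction _ p hadd h0
    fun k _ => hom k _ (DirectSum.decompose 𝒜 (μ : Ω) k).2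

/-- The grading involution `μ ↦ (-1)ᵏ μ` of `Ω•(M)`. -/
def sgnM : X.baseForms →ₗ[ℂ] X.baseForms :=
  (degSign 𝒜 ∘ₗ X.baseForms.val.toLinearMap).codRestrict (Subalgebra.toSubmodule X.baseForms)
    fun μ => by
      change degSign 𝒜 (μ : Ω) ∈ X.baseForms
      refine X.baseForms_induction (p := fun μ => degSign 𝒜 (μ : Ω) ∈ X.baseForms)
        (by simp) ?_ ?_ μ
      · intro μ ν hμ hν
        rw [AddMemClass.coe_add, map_add]
        exact add_mem hμ hν
      · intro k μ hμ
        rw [degSign_of_mem 𝒜 hμ]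
        exact X.baseForms.smul_mem μ.2 _

theorem sgnM_of_mem {k : ℕ} {μ : X.baseForms} (hμ : (μ : Ω) ∈ 𝒜 k) :
    X.sgnM μ = ((-1 : ℂ) ^ k) • μ := Subtype.ext (degSign_of_mem 𝒜 hμ)

theorem cjM_cjM (μ : X.baseForms) : X.cjM (X.cjM μ) = μ := Subtype.ext (X.cj_cj _)

theorem cjM_mul_ιM (μ : X.baseForms) (p : B.base) :
    X.cjM (μ * X.ιM p) = X.ιM (star p) * X.cjM μ := by
  refine X.baseForms_induction
    (p := fun μ => X.cjM (μ * X.ιM p) = X.ιM (star p) * X.cjM μ) (by simp) ?_ ?_ μ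
  · intro μ ν hμ hν
    rw [add_mul, map_add, map_add, mul_add, hμ, hν]
  · intro k μ hμ
    ext
    change X.cj ((μ : Ω) * X.ιP p) = X.ιP (star (p : P)) * X.cj μ
    have h := X.cj_mul hμ (X.ιM_mem p)
    rw [ιM_coe] at h
    rw [h, X.ιP_star]
    simp

theorem cjM_ιM_mul (μ : X.baseForms) (p : B.base) :
    X.cjM (X.ιM p * μ) = X.cjM μ * X.ιM (star p) := by
  have := X.cjM_mul_ιM (X.cjM μ) (star p)
  rw [cjM_cjM, star_star] at this
  rw [← this, cjM_cjM]

theorem sgnM_mul_ιM (μ : X.baseForms) (p : B.base) :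
    X.sgnM (μ * X.ιM p) = X.sgnM μ * X.ιM p := by
  refine X.baseForms_induction
    (p := fun μ => X.sgnM (μ * X.ιM p) = X.sgnM μ * X.ιM p) (by simp) ?_ ?_ μ
  · intro μ ν hμ hν
    rw [add_mul, map_add, map_add, add_mul, hμ, hν]
  · intro k μ hμ
    have h2 : ((μ * X.ιM p : X.baseForms) : Ω) ∈ 𝒜 k := by
      have := SetLike.mul_mem_graded hμ (X.ιM_mem p)
      rwa [add_zero] at this
    rw [X.sgnM_of_mem hμ, X.sgnM_of_mem h2, smul_mul_assoc]

theorem sgnM_ιM_mul (μ : X.baseForms) (p : B.base) :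
    X.sgnM (X.ιM p * μ) = X.ιM p * X.sgnM μ := by
  refine X.baseForms_induction
    (p := fun μ => X.sgnM (X.ιM p * μ) = X.ιM p * X.sgnM μ) (by simp) ?_ ?_ μ
  · intro μ ν hμ hν
    rw [mul_add, map_add, map_add, mul_add, hμ, hν]
  · intro k μ hμ
    have h2 : ((X.ιM p * μ : X.baseForms) : Ω) ∈ 𝒜 k := by
      have := SetLike.mul_mem_graded (X.ιM_mem p) hμ
      rwa [zero_add] at this
    rw [X.sgnM_of_mem hμ, X.sgnM_of_mem h2, mul_smul_comm]

end BundleCalculus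

open scoped ComplexOrder

/-! ### The associated bundle of `ad` -/

/-- The matrix `(u j i)` of `ad` in a basis `e` of `inv Γ`: `ad (e i) = ∑ⱼ e j ⊗ u j i`. -/
def adMatrix (C : GroupCalculus G 𝒢) {m : ℕ} (e : Module.Basis (Fin m) ℂ C.inv) :
    Matrix (Fin m) (Fin m) G :=
  Matrix.of fun j i => TensorProduct.lid ℂ G (LinearMap.rTensor G (e.coord j) (C.ad (e i)))

theorem ad_basis (C : GroupCalculus G 𝒢) {m : ℕ} (e : Module.Basis (Fin m) ℂ C.inv)
    (i : Fin m) : C.ad (e i) = ∑ j, e j ⊗ₜ adMatrix C e j i := by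
  simp only [adMatrix, Matrix.of_apply]
  generalize C.ad (e i) = t
  induction t with
  | zero => simp
  | add x y hx hy =>
    simp only [map_add, TensorProduct.tmul_add, Finset.sum_add_distrib, ← hx, ← hy]
  | tmul θ g =>
    conv_lhs => rw [← e.sum_repr θ, TensorProduct.sum_tmul]
    refine Finset.sum_congr rfl fun j _ => ?_
    simp [TensorProduct.smul_tmul]

variable (B C)

/-- The standing assumptions under which the left and the right associated bundle of `ad` are
defined: a (finite) orthonormal basis `e` of `inv Γ` with respect to an inner product for which
`ad` is unitary, intertwiners `T k` whose matrix `X = (T k (e i))` satisfies `X* X = 1` and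
`Wᵀ X̄ = 1`, where `W = Z X (K⁻¹)*` for a strictly positive complex matrix `Z` and the matrix `K`
of the canonical isomorphism of `ad` with `(id ⊗ κ²) ad`, and the right canonical hermitian
structure takes its values in `M`. -/
structure AdFrame where
  m : ℕ
  e : Module.Basis (Fin m) ℂ C.inv
  unitary_left : (adMatrix C e).conjTranspose * adMatrix C e = 1
  unitary_right : adMatrix C e * (adMatrix C e).conjTranspose = 1
  r : ℕ
  T : Fin r → MorP B C
  left_frame : (Matrix.of fun k i => (T k).1 (e i)).conjTranspose *
    (Matrix.of fun k i => (T k).1 (e i)) = 1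
  Z : Matrix (Fin r) (Fin r) ℂ
  Z_pos : Z.PosDef
  K : Matrix (Fin m) (Fin m) ℂ
  K_pos : K.PosDef
  K_intertwines : K.map (algebraMap ℂ G) * adMatrix C e =
    (adMatrix C e).map (fun g => HopfAlgebra.antipode ℂ (HopfAlgebra.antipode ℂ g)) *
      K.map (algebraMap ℂ G)
  right_frame : (Z.map (algebraMap ℂ P) * (Matrix.of fun k i => (T k).1 (e i)) *
      (K⁻¹.conjTranspose).map (algebraMap ℂ P)).transpose *
    (Matrix.of fun k i => star ((T k).1 (e i))) = 1
  right_mem : ∀ T₁ T₂ : MorP B C, ∑ k, star (T₁.1 (e k)) * T₂.1 (e k) ∈ B.base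

variable {B C}

namespace AdFrame

variable (F : AdFrame B C)

theorem left_mem (T₁ T₂ : MorP B C) : ∑ k, T₁.1 (F.e k) * star (T₂.1 (F.e k)) ∈ B.base := by
  change B.Φ _ = _ ⊗ₜ 1
  have h : ∀ (T : MorP B C) k, B.Φ (T.1 (F.e k)) =
      ∑ j, T.1 (F.e j) ⊗ₜ adMatrix C F.e j k := by
    intro T k
    rw [T.2, ad_basis, map_sum]
    simp
  have hu : ∀ i j, ∑ k, adMatrix C F.e i k * star (adMatrix C F.e j k) =
      if i = j then 1 else 0 := by
    intro i j
    have := congrFun (congrFun F.unitary_right i) j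
    rw [Matrix.mul_apply, Matrix.one_apply] at this
    simpa only [Matrix.conjTranspose_apply] using this
  simp only [map_sum, map_mul, map_star, h, star_sum, TensorProduct.star_tmul, Finset.sum_mul_sum,
    Algebra.TensorProduct.tmul_mul_tmul]
  rw [Finset.sum_comm, TensorProduct.sum_tmul]
  refine Finset.sum_congr rfl fun i _ => ?_
  rw [Finset.sum_comm]
  have hj : ∀ j, ∑ k, (T₁.1 (F.e i) * star (T₂.1 (F.e j))) ⊗ₜ[ℂ]
      (adMatrix C F.e i k * star (adMatrix C F.e j k)) =
      (T₁.1 (F.e i) * star (T₂.1 (F.e j))) ⊗ₜ[ℂ] (if i = j then 1 else 0) := by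
    intro j
    rw [← hu i j, TensorProduct.tmul_sum]
  rw [Finset.sum_congr rfl fun j _ => hj j, Finset.sum_eq_single i]
  · simp
  · intro j _ hne
    rw [if_neg (Ne.symm hne), TensorProduct.tmul_zero]
  · simp

/-- The canonical hermitian structure `⟨T₁, T₂⟩ = ∑ₖ T₁(eₖ) T₂(eₖ)*` of the left bundle. -/
def hermL : MorP B C →ₗ[ℂ] MorP B C →ₗ⋆[ℂ] B.base :=
  LinearMap.mk₂'ₛₗ (RingHom.id ℂ) (starRingEnd ℂ)
    (fun T₁ T₂ => ⟨∑ k, T₁.1 (F.e k) * star (T₂.1 (F.e k)), F.left_mem T₁ T₂⟩)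
    (fun a b c => by ext; simp [add_mul, Finset.sum_add_distrib])
    (fun a b c => by ext; simp [Finset.smul_sum])
    (fun a b c => by ext; simp [mul_add, Finset.sum_add_distrib])
    (fun a b c => by ext; simp [Finset.smul_sum])

/-- The canonical hermitian structure `⟨T₁, T₂⟩ = ∑ₖ T₁(eₖ)* T₂(eₖ)` of the right bundle. -/
def hermR : MorP B C →ₗ⋆[ℂ] MorP B C →ₗ[ℂ] B.base :=
  LinearMap.mk₂'ₛₗ (starRingEnd ℂ) (RingHom.id ℂ)
    (fun T₁ T₂ => ⟨∑ k, star (T₁.1 (F.e k)) * T₂.1 (F.e k), F.right_mem T₁ T₂⟩)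
    (fun a b c => by ext; simp [add_mul, Finset.sum_add_distrib])
    (fun a b c => by ext; simp [Finset.smul_sum])
    (fun a b c => by ext; simp [mul_add, Finset.sum_add_distrib])
    (fun a b c => by ext; simp [Finset.smul_sum])

theorem hermL_lsmul_left (p : B.base) (T₁ T₂ : MorP B C) :
    F.hermL (lsmul p T₁) T₂ = p * F.hermL T₁ T₂ := by
  ext; simp [hermL, lsmul, Finset.mul_sum, mul_assoc]

theorem hermL_lsmul_right (p : B.base) (T₁ T₂ : MorP B C) :
    F.hermL T₁ (lsmul p T₂) = F.hermL T₁ T₂ * star p := by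
  ext; simp [hermL, lsmul, Finset.sum_mul, mul_assoc]

theorem hermR_rsmul_left (p : B.base) (T₁ T₂ : MorP B C) :
    F.hermR (rsmul T₁ p) T₂ = star p * F.hermR T₁ T₂ := by
  ext; simp [hermR, rsmul, Finset.mul_sum, mul_assoc]

theorem hermR_rsmul_right (p : B.base) (T₁ T₂ : MorP B C) :
    F.hermR T₁ (rsmul T₂ p) = F.hermR T₁ T₂ * p := by
  ext; simp [hermR, rsmul, Finset.sum_mul, mul_assoc]

end AdFrame

/-! ### Quantum Riemannian structures and the Hodge star -/

/-- The base `M`, a `*`-subalgebra of the `C*`-algebra `A`, with its forms `Ω•(M)`, is oriented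
by a quantum Riemannian `n`-volume form `dvol` for a left quantum Riemannian metric `gL` (forms
of different degrees are orthogonal), has a quantum integral `p dvol ↦ s p` for a state `s`, for
which it is without boundary, and has a left quantum Hodge operator `starL`. -/
structure HodgeData (X : BundleCalculus 𝒜 B C) (A : Type*) [CStarAlgebra A] where
  toC : B.base →⋆ₐ[ℂ] A
  toC_injective : Function.Injective toC
  n : ℕ
  dvol : X.baseForms
  dvol_mem : (dvol : Ω) ∈ 𝒜 n
  dvol_ne_zero : dvol ≠ 0
  eq_zero_of_lt : ∀ {k} {μ : X.baseForms}, n < k → (μ : Ω) ∈ 𝒜 k → μ = 0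
  exists_dvol : ∀ {μ : X.baseForms}, (μ : Ω) ∈ 𝒜 n → ∃ p, μ = X.ιM p * dvol
  dvol_faithful : ∀ {p}, X.ιM p * dvol = 0 → p = 0
  gL : X.baseForms →ₗ[ℂ] X.baseForms →ₗ⋆[ℂ] B.base
  gL_left : ∀ p μ ν, gL (X.ιM p * μ) ν = p * gL μ ν
  gL_star : ∀ μ ν, star (gL μ ν) = gL ν μ
  gL_nonneg : ∀ μ, ∃ a : A, toC (gL μ μ) = star a * a
  gL_definite : ∀ {μ}, gL μ μ = 0 → μ = 0
  gL_right : ∀ p μ ν, gL (μ * X.ιM p) ν = gL μ (ν * X.ιM (star p))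
  gL_zero : ∀ p q, gL (X.ιM p) (X.ιM q) = p * star q
  gL_dvol : ∀ p q, gL (X.ιM p * dvol) (X.ιM q * dvol) = p * star q
  gL_orthogonal : ∀ {k l} {μ ν : X.baseForms}, k ≠ l → (μ : Ω) ∈ 𝒜 k → (ν : Ω) ∈ 𝒜 l →
    gL μ ν = 0
  s : B.base →ₗ[ℂ] ℂ
  s_one : s 1 = 1
  s_nonneg : ∀ p, (∃ a : A, toC p = star a * a) → 0 ≤ s p
  no_boundary : ∀ μ p, X.dM μ = X.ιM p * dvol → s p = 0
  starL : X.baseForms ≃ₛₗ[starRingEnd ℂ] X.baseForms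
  starL_mem : ∀ {k}, k ≤ n → ∀ μ : X.baseForms, (μ : Ω) ∈ 𝒜 k ↔ (starL μ : Ω) ∈ 𝒜 (n - k)
  mul_starL : ∀ {k} {μ ν : X.baseForms}, (μ : Ω) ∈ 𝒜 k → (ν : Ω) ∈ 𝒜 k →
    μ * starL ν = X.ιM (gL μ ν) * dvol

namespace HodgeData

variable {X : BundleCalculus 𝒜 B C} {A : Type*} [CStarAlgebra A] (H : HodgeData X A)

theorem starL_mul (μ : X.baseForms) (p : B.base) :
    H.starL (μ * X.ιM p) = X.ιM (star p) * H.starL μ := by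
  refine X.baseForms_induction
    (p := fun μ => H.starL (μ * X.ιM p) = X.ιM (star p) * H.starL μ) (by simp) ?_ ?_ μ
  · intro μ ν hμ hν
    rw [add_mul, map_add, map_add, mul_add, hμ, hν]
  · intro k μ hμ
    rcases lt_or_ge H.n k with hk | hk
    · rw [H.eq_zero_of_lt hk hμ]; simp
    have hμp : ((μ * X.ιM p : X.baseForms) : Ω) ∈ 𝒜 k := by
      have := SetLike.mul_mem_graded hμ (X.ιM_mem p)
      rwa [add_zero] at this
    have h1 : ((X.ιM (star p) * H.starL μ : X.baseForms) : Ω) ∈ 𝒜 (H.n - k) := by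
      have := SetLike.mul_mem_graded (X.ιM_mem (star p)) ((H.starL_mem hk μ).1 hμ)
      rwa [zero_add] at this
    rw [← sub_eq_zero]
    set ν := H.starL (μ * X.ιM p) - X.ιM (star p) * H.starL μ with hν
    have hνmem : (ν : Ω) ∈ 𝒜 (H.n - k) := sub_mem ((H.starL_mem hk _).1 hμp) h1
    obtain ⟨ρ, hρ⟩ := H.starL.surjective ν
    have hρmem : (ρ : Ω) ∈ 𝒜 k := by
      rw [H.starL_mem hk, hρ]; exact hνmem
    have h2 : ((ρ * X.ιM (star p) : X.baseForms) : Ω) ∈ 𝒜 k := by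
      have := SetLike.mul_mem_graded hρmem (X.ιM_mem (star p))
      rwa [add_zero] at this
    have h3 : ρ * ν = 0 := by
      rw [hν, mul_sub, H.mul_starL hρmem hμp, ← mul_assoc, H.mul_starL h2 hμ, H.gL_right,
        star_star, sub_self]
    rw [← hρ, H.mul_starL hρmem hρmem] at h3
    rw [← hρ, H.gL_definite (H.dvol_faithful h3), map_zero]

theorem starL_symm_mul (p : B.base) (μ : X.baseForms) :
    H.starL.symm (X.ιM p * μ) = H.starL.symm μ * X.ιM (star p) := by
  apply H.starL.injective
  rw [starL_mul]
  simp

/-- `∗ ∘ ⋆_L`. -/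
def cjStarL : X.baseForms →ₗ[ℂ] X.baseForms := X.cjM ∘ₛₗ H.starL.toLinearMap

/-- `⋆_L⁻¹ ∘ ∗`. -/
def starLInvCj : X.baseForms →ₗ[ℂ] X.baseForms := H.starL.symm.toLinearMap ∘ₛₗ X.cjM

/-- The right quantum Hodge operator `⋆_R = ∗ ∘ ⋆_L ∘ ∗`. -/
def starR : X.baseForms →ₗ⋆[ℂ] X.baseForms := X.cjM ∘ₛₗ (H.starL.toLinearMap ∘ₛₗ X.cjM)

/-- The inverse `∗ ∘ ⋆_L⁻¹ ∘ ∗` of the right quantum Hodge operator. -/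
def starRInv : X.baseForms →ₗ⋆[ℂ] X.baseForms :=
  X.cjM ∘ₛₗ (H.starL.symm.toLinearMap ∘ₛₗ X.cjM)

theorem starRInv_starR (μ : X.baseForms) : H.starRInv (H.starR μ) = μ := by
  simp [starRInv, starR, X.cjM_cjM]

theorem starR_starRInv (μ : X.baseForms) : H.starR (H.starRInv μ) = μ := by
  simp [starRInv, starR, X.cjM_cjM]

/-- `∗ ∘ ⋆_R`. -/
def cjStarR : X.baseForms →ₗ[ℂ] X.baseForms := X.cjM ∘ₛₗ H.starR

/-- `⋆_R⁻¹ ∘ ∗`. -/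
def starRInvCj : X.baseForms →ₗ[ℂ] X.baseForms := H.starRInv ∘ₛₗ X.cjM

theorem cjStarL_mul (μ : X.baseForms) (p : B.base) :
    H.cjStarL (μ * X.ιM p) = H.cjStarL μ * X.ιM p := by
  change X.cjM (H.starL _) = X.cjM (H.starL μ) * _
  rw [starL_mul, X.cjM_ιM_mul, star_star]

theorem starLInvCj_mul (μ : X.baseForms) (p : B.base) :
    H.starLInvCj (μ * X.ιM p) = H.starLInvCj μ * X.ιM p := by
  change H.starL.symm (X.cjM _) = H.starL.symm (X.cjM μ) * _
  rw [X.cjM_mul_ιM, starL_symm_mul, star_star]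

theorem cjStarR_mul (μ : X.baseForms) (p : B.base) :
    H.cjStarR (X.ιM p * μ) = X.ιM p * H.cjStarR μ := by
  change X.cjM (X.cjM (H.starL (X.cjM _))) = _ * X.cjM (X.cjM (H.starL (X.cjM μ)))
  rw [X.cjM_cjM, X.cjM_cjM, X.cjM_ιM_mul, starL_mul, star_star]

theorem starRInvCj_mul (μ : X.baseForms) (p : B.base) :
    H.starRInvCj (X.ιM p * μ) = X.ιM p * H.starRInvCj μ := by
  change X.cjM (H.starL.symm (X.cjM (X.cjM _))) =
    _ * X.cjM (H.starL.symm (X.cjM (X.cjM μ)))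
  rw [X.cjM_cjM, X.cjM_cjM, starL_symm_mul, X.cjM_mul_ιM, star_star]

/-- The right quantum Riemannian metric `⟨μ, ν⟩_R = ⟨μ*, ν*⟩_L`. -/
def gR (μ ν : X.baseForms) : B.base := H.gL (X.cjM μ) (X.cjM ν)

end HodgeData

/-! ### Bundle-valued differential forms -/

section Forms

variable (X : BundleCalculus 𝒜 B C)

instance instAddCommGroupRight : AddCommGroup (MorP B C ⊗[ℂ] X.baseForms) :=
  @TensorProduct.addCommGroup ℂ _ (MorP B C) X.baseForms (Submodule.addCommGroup _) _ _ _

/-- The relations of the balanced tensor product `Ω•(M) ⊗_M Mor(ad, Φ)`. -/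
def relL : Submodule ℂ (X.baseForms ⊗[ℂ] MorP B C) :=
  Submodule.span ℂ {x | ∃ (μ : X.baseForms) (p : B.base) (T : MorP B C),
    x = (μ * X.ιM p) ⊗ₜ[ℂ] T - μ ⊗ₜ[ℂ] lsmul p T}

/-- The relations of the balanced tensor product `Mor(ad, Φ) ⊗_M Ω•(M)`. -/
def relR : Submodule ℂ (MorP B C ⊗[ℂ] X.baseForms) :=
  Submodule.span ℂ {x | ∃ (T : MorP B C) (p : B.base) (μ : X.baseForms),
    x = rsmul T p ⊗ₜ[ℂ] μ - T ⊗ₜ[ℂ] (X.ιM p * μ)}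

/-- Left bundle-valued differential forms `Ω•(M) ⊗_M Γ^L(M, V M)`. -/
abbrev FormsL := (X.baseForms ⊗[ℂ] MorP B C) ⧸ relL X

/-- Right bundle-valued differential forms `Γ^R(M, V M) ⊗_M Ω•(M)`. -/
abbrev FormsR := (MorP B C ⊗[ℂ] X.baseForms) ⧸ relR X

/-- The canonical map `Υ⁻¹ : μ ⊗ T ↦ μ T`. -/
def upsInvL : FormsL X →ₗ[ℂ] C.inv →ₗ[ℂ] Ω :=
  (relL X).liftQ
    (TensorProduct.lift (LinearMap.mk₂ ℂ
      (fun (μ : X.baseForms) (T : MorP B C) =>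
        LinearMap.mulLeft ℂ (μ : Ω) ∘ₗ X.ιP.toLinearMap ∘ₗ T.1)
      (fun a b c => by ext; simp [add_mul]) (fun a b c => by ext; simp)
      (fun a b c => by ext; simp [mul_add]) (fun a b c => by ext; simp)))
    (by
      refine Submodule.span_le.2 ?_
      rintro _ ⟨μ, p, T, rfl⟩
      rw [SetLike.mem_coe, LinearMap.mem_ker, map_sub, sub_eq_zero]
      ext θ
      simp [lsmul])

/-- The canonical map `Υ̃⁻¹ : T ⊗ μ ↦ T μ`. -/
def upsInvR : FormsR X →ₗ[ℂ] C.inv →ₗ[ℂ] Ω :=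
  (relR X).liftQ
    (TensorProduct.lift (LinearMap.mk₂ ℂ
      (fun (T : MorP B C) (μ : X.baseForms) =>
        LinearMap.mulRight ℂ (μ : Ω) ∘ₗ X.ιP.toLinearMap ∘ₗ T.1)
      (fun a b c => by ext; simp [add_mul]) (fun a b c => by ext; simp)
      (fun a b c => by ext; simp [mul_add]) (fun a b c => by ext; simp)))
    (by
      refine Submodule.span_le.2 ?_
      rintro _ ⟨T, p, μ, rfl⟩
      rw [SetLike.mem_coe, LinearMap.mem_ker, map_sub, sub_eq_zero]
      ext θ
      simp [rsmul, mul_assoc])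

/-- `Υ`, the inverse of the isomorphism of `Ω•(M) ⊗_M Γ^L(M, V M)` with the intertwiners from
`ad` to the horizontal forms. -/
def upsL : (C.inv →ₗ[ℂ] Ω) → FormsL X := Function.invFun (upsInvL X)

/-- `Υ̃`, the inverse of the isomorphism of `Γ^R(M, V M) ⊗_M Ω•(M)` with the intertwiners from
`ad` to the horizontal forms. -/
def upsR : (C.inv →ₗ[ℂ] Ω) → FormsR X := Function.invFun (upsInvR X)

/-- `f ⊗_M id` for a right `M`-linear map `f`. -/
def mapFormsL (f : X.baseForms →ₗ[ℂ] X.baseForms)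
    (hf : ∀ μ p, f (μ * X.ιM p) = f μ * X.ιM p) : FormsL X →ₗ[ℂ] FormsL X :=
  (relL X).mapQ (relL X) (LinearMap.rTensor _ f) (by
    refine Submodule.span_le.2 ?_
    rintro _ ⟨μ, p, T, rfl⟩
    refine Submodule.subset_span ⟨f μ, p, T, ?_⟩
    rw [map_sub, LinearMap.rTensor_tmul, LinearMap.rTensor_tmul, hf])

/-- `id ⊗_M f` for a left `M`-linear map `f`. -/
def mapFormsR (f : X.baseForms →ₗ[ℂ] X.baseForms)
    (hf : ∀ μ p, f (X.ιM p * μ) = X.ιM p * f μ) : FormsR X →ₗ[ℂ] FormsR X :=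
  (relR X).mapQ (relR X) (LinearMap.lTensor _ f) (by
    refine Submodule.span_le.2 ?_
    rintro _ ⟨T, p, μ, rfl⟩
    refine Submodule.subset_span ⟨T, p, f μ, ?_⟩
    rw [map_sub, LinearMap.lTensor_tmul, LinearMap.lTensor_tmul, hf])

variable {X} {A : Type*} [CStarAlgebra A] (H : HodgeData X A) (F : AdFrame B C)

/-- `⟨μ₁ ⊗ T₁, -⟩` on left bundle-valued forms. -/
def formL₁ (μ₁ : X.baseForms) (T₁ : MorP B C) : FormsL X →ₗ⋆[ℂ] B.base :=
  (relL X).liftQ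
    (TensorProduct.lift (LinearMap.mk₂'ₛₗ (starRingEnd ℂ) (starRingEnd ℂ)
      (fun (μ₂ : X.baseForms) (T₂ : MorP B C) =>
        H.gL (μ₁ * X.ιM (F.hermL T₁ T₂)) μ₂)
      (fun a b c => by simp) (fun a b c => by simp)
      (fun a b c => by simp [mul_add]) (fun a b c => by simp)))
    (by
      refine Submodule.span_le.2 ?_
      rintro _ ⟨μ, p, T, rfl⟩
      rw [SetLike.mem_coe, LinearMap.mem_ker, map_sub, sub_eq_zero]
      simp only [TensorProduct.lift.tmul, LinearMap.mk₂'ₛₗ_apply]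
      rw [F.hermL_lsmul_right, map_mul X.ιM, ← mul_assoc,
        H.gL_right (star p) (μ₁ * X.ιM (F.hermL T₁ T)) μ, star_star])

theorem formL₁_mk (μ₁ μ₂ : X.baseForms) (T₁ T₂ : MorP B C) :
    formL₁ H F μ₁ T₁ (Submodule.Quotient.mk (μ₂ ⊗ₜ T₂)) =
      H.gL (μ₁ * X.ιM (F.hermL T₁ T₂)) μ₂ := rfl

/-- The hermitian structure `⟨μ₁ ⊗ T₁, μ₂ ⊗ T₂⟩ = ⟨μ₁ ⟨T₁, T₂⟩, μ₂⟩` of left bundle-valued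
forms. -/
def formL : FormsL X →ₗ[ℂ] FormsL X →ₗ⋆[ℂ] B.base :=
  (relL X).liftQ
    (TensorProduct.lift (LinearMap.mk₂ ℂ (formL₁ H F)
      (fun a b c => by
        refine Submodule.linearMap_qext _ (TensorProduct.ext' fun μ T => ?_)
        simp [formL₁_mk, add_mul])
      (fun a b c => by
        refine Submodule.linearMap_qext _ (TensorProduct.ext' fun μ T => ?_)
        simp [formL₁_mk])
      (fun a b c => by
        refine Submodule.linearMap_qext _ (TensorProduct.ext' fun μ T => ?_)
        simp [formL₁_mk, mul_add])
      (fun a b c => by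
        refine Submodule.linearMap_qext _ (TensorProduct.ext' fun μ T => ?_)
        simp [formL₁_mk])))
    (by
      refine Submodule.span_le.2 ?_
      rintro _ ⟨μ, p, T, rfl⟩
      rw [SetLike.mem_coe, LinearMap.mem_ker, map_sub, sub_eq_zero]
      refine Submodule.linearMap_qext _ (TensorProduct.ext' fun ν S => ?_)
      simp [formL₁_mk, F.hermL_lsmul_left, mul_assoc])

/-- `T₂, μ₂ ↦ ⟨T₁ ⊗ μ₁, T₂ ⊗ μ₂⟩` for right bundle-valued forms. -/
def formR₀ (T₁ : MorP B C) (μ₁ : X.baseForms) : MorP B C →ₗ[ℂ] X.baseForms →ₗ[ℂ] B.base :=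
  LinearMap.mk₂ ℂ
    (fun (T₂ : MorP B C) (μ₂ : X.baseForms) => H.gR μ₁ (X.ιM (F.hermR T₁ T₂) * μ₂))
    (fun a b c => by simp [HodgeData.gR, add_mul]) (fun a b c => by simp [HodgeData.gR])
    (fun a b c => by simp [HodgeData.gR, mul_add]) (fun a b c => by simp [HodgeData.gR])

theorem formR₀_apply (T₁ T₂ : MorP B C) (μ₁ μ₂ : X.baseForms) :
    formR₀ H F T₁ μ₁ T₂ μ₂ = H.gR μ₁ (X.ιM (F.hermR T₁ T₂) * μ₂) := rfl

/-- `⟨T₁ ⊗ μ₁, -⟩` on right bundle-valued forms. -/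
def formR₁ (T₁ : MorP B C) (μ₁ : X.baseForms) : FormsR X →ₗ[ℂ] B.base :=
  (relR X).liftQ (TensorProduct.lift (formR₀ H F T₁ μ₁)) (by
    refine Submodule.span_le.2 ?_
    rintro _ ⟨T, p, μ, rfl⟩
    rw [SetLike.mem_coe, LinearMap.mem_ker, map_sub, sub_eq_zero, TensorProduct.lift.tmul,
      TensorProduct.lift.tmul, formR₀_apply, formR₀_apply, F.hermR_rsmul_right,
      map_mul X.ιM, mul_assoc])

theorem formR₁_mk (μ₁ μ₂ : X.baseForms) (T₁ T₂ : MorP B C) :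
    formR₁ H F T₁ μ₁ (Submodule.Quotient.mk (T₂ ⊗ₜ μ₂)) =
      H.gR μ₁ (X.ιM (F.hermR T₁ T₂) * μ₂) := rfl

/-- The hermitian structure `⟨T₁ ⊗ μ₁, T₂ ⊗ μ₂⟩ = ⟨μ₁, ⟨T₁, T₂⟩ μ₂⟩` of right bundle-valued
forms. -/
def formR : FormsR X →ₗ⋆[ℂ] FormsR X →ₗ[ℂ] B.base :=
  (relR X).liftQ
    (TensorProduct.lift (LinearMap.mk₂'ₛₗ (starRingEnd ℂ) (starRingEnd ℂ) (formR₁ H F)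
      (fun a b c => by
        refine Submodule.linearMap_qext _ (TensorProduct.ext' fun μ T => ?_)
        simp [formR₁_mk, HodgeData.gR, add_mul])
      (fun a b c => by
        refine Submodule.linearMap_qext _ (TensorProduct.ext' fun μ T => ?_)
        simp [formR₁_mk, HodgeData.gR])
      (fun a b c => by
        refine Submodule.linearMap_qext _ (TensorProduct.ext' fun μ T => ?_)
        simp [formR₁_mk, HodgeData.gR])
      (fun a b c => by
        refine Submodule.linearMap_qext _ (TensorProduct.ext' fun μ T => ?_)
        simp [formR₁_mk, HodgeData.gR])))
    (by
      refine Submodule.span_le.2 ?_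
      rintro _ ⟨T, p, μ, rfl⟩
      rw [SetLike.mem_coe, LinearMap.mem_ker, map_sub, sub_eq_zero]
      refine Submodule.linearMap_qext _ (TensorProduct.ext' fun S ν => ?_)
      change formR₁ H F (rsmul T p) μ (Submodule.Quotient.mk (S ⊗ₜ ν)) =
        formR₁ H F T (X.ιM p * μ) (Submodule.Quotient.mk (S ⊗ₜ ν))
      simp only [formR₁_mk, HodgeData.gR]
      rw [F.hermR_rsmul_left, X.cjM_ιM_mul, X.cjM_ιM_mul, X.cjM_ιM_mul, H.gL_right, star_star,
        star_mul, star_star, map_mul X.ιM, mul_assoc])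

/-- `⟨ψ | φ⟩_L = ∫ ⟨ψ, φ⟩_L dvol`. -/
def pairL (ψ φ : FormsL X) : ℂ := H.s (formL H F ψ φ)

/-- `⟨ψ | φ⟩_R = ∫ ⟨ψ, φ⟩_R dvol`. -/
def pairR (ψ φ : FormsR X) : ℂ := H.s (formR H F ψ φ)

/-- `S` is an adjoint of the operator `T` on left bundle-valued forms. -/
def IsAdjointL (T S : FormsL X → FormsL X) : Prop :=
  ∀ ψ φ, pairL H F (T ψ) φ = pairL H F ψ (S φ)

/-- `S` is an adjoint of the operator `T` on right bundle-valued forms. -/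
def IsAdjointR (T S : FormsR X → FormsR X) : Prop :=
  ∀ ψ φ, pairR H F (T ψ) φ = pairR H F ψ (S φ)

end Forms

/-! ### Quantum principal connections -/

section Connections

variable (X : BundleCalculus 𝒜 B C)

/-- Quantum principal connections `ω : inv Γ → Ω¹(GM)`. -/
def IsQPC (ω : C.inv →ₗ[ℂ] Ω) : Prop :=
  (∀ θ, ω θ ∈ 𝒜 1) ∧
    ∀ θ, X.psi (ω θ) = TensorProduct.map ω C.ι.toLinearMap (C.ad θ) + 1 ⊗ₜ ((θ : 𝒢 1) : Γ)

/-- Quantum connection displacements `lam : inv Γ → Ω¹(GM)`. -/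
def IsDisplacement (lam : C.inv →ₗ[ℂ] Ω) : Prop :=
  (∀ θ, lam θ ∈ 𝒜 1) ∧ ∀ θ, X.psi (lam θ) = TensorProduct.map lam C.ι.toLinearMap (C.ad θ)

/-- `τ̂ = ∗ ∘ τ ∘ ∗`. -/
def hat (τ : C.inv →ₗ[ℂ] Ω) : C.inv →ₗ[ℂ] Ω := X.cj ∘ₛₗ (τ ∘ₛₗ C.invCj)

/-- The covariant derivative `φ ↦ dφ - (-1)ᵏ φ⁽⁰⁾ ω(π(φ⁽¹⁾))`, for `φ` of degree `k`. -/
def covD (ω : C.inv →ₗ[ℂ] Ω) : Ω →ₗ[ℂ] Ω :=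
  X.d - LinearMap.mul' ℂ Ω ∘ₗ TensorProduct.map (degSign 𝒜) (ω ∘ₗ C.germ) ∘ₗ X.coactΩ

/-- The dual covariant derivative `∗ ∘ D^ω ∘ ∗`. -/
def covDHat (ω : C.inv →ₗ[ℂ] Ω) : Ω →ₗ[ℂ] Ω := X.cj ∘ₛₗ (covD X ω ∘ₛₗ X.cj)

/-- `⟨T₁, T₂⟩ = m ∘ (T₁ ⊗ T₂) ∘ δ`. -/
def bracket (δ : C.inv →ₗ[ℂ] C.inv ⊗[ℂ] C.inv) (T₁ T₂ : C.inv →ₗ[ℂ] Ω) : C.inv →ₗ[ℂ] Ω :=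
  LinearMap.mul' ℂ Ω ∘ₗ TensorProduct.map T₁ T₂ ∘ₗ δ

/-- The transposed commutator `(id ⊗ π) ∘ ad`. -/
def transComm (C : GroupCalculus G 𝒢) : C.inv →ₗ[ℂ] C.inv ⊗[ℂ] C.inv :=
  LinearMap.lTensor _ C.germ ∘ₗ C.ad

/-- `δ : inv Γ → inv Γ ⊗ inv Γ` is an embedded differential: a lift of the differential of `Γ^∧`
which intertwines `ad` with `ad ⊗ ad`. -/
structure IsEmbeddedDifferential (C : GroupCalculus G 𝒢)
    (δ : C.inv →ₗ[ℂ] C.inv ⊗[ℂ] C.inv) : Prop where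
  lift : ∀ θ, LinearMap.mul' ℂ Γ (TensorProduct.map ((𝒢 1).subtype ∘ₗ C.inv.subtype)
    ((𝒢 1).subtype ∘ₗ C.inv.subtype) (δ θ)) = C.d ((θ : 𝒢 1) : Γ)
  covariant : ∀ θ, LinearMap.rTensor G δ (C.ad θ) =
    LinearMap.lTensor (C.inv ⊗[ℂ] C.inv) (LinearMap.mul' ℂ G)
      (TensorProduct.tensorTensorTensorComm ℂ C.inv G C.inv G
        (TensorProduct.map C.ad C.ad (δ θ)))

/-- The curvature `R^ω = d ∘ ω - ⟨ω, ω⟩`. -/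
def curvature (δ : C.inv →ₗ[ℂ] C.inv ⊗[ℂ] C.inv) (ω : C.inv →ₗ[ℂ] Ω) : C.inv →ₗ[ℂ] Ω :=
  X.d ∘ₗ ω - bracket δ ω ω

/-- `S^ω(τ) = ⟨ω, τ⟩ - (-1)ᵏ ⟨τ, ω⟩ - (-1)ᵏ [τ, ω]`, for `τ` with values in degree `k`. -/
def opS (δ : C.inv →ₗ[ℂ] C.inv ⊗[ℂ] C.inv) (ω τ : C.inv →ₗ[ℂ] Ω) : C.inv →ₗ[ℂ] Ω :=
  bracket δ ω τ - bracket δ (degSign 𝒜 ∘ₗ τ) ω - bracket (transComm C) (degSign 𝒜 ∘ₗ τ) ω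

/-- `d^∇ = Υ ∘ D^ω ∘ Υ⁻¹`. -/
def dNablaL (ω : C.inv →ₗ[ℂ] Ω) (ψ : FormsL X) : FormsL X :=
  upsL X (covD X ω ∘ₗ upsInvL X ψ)

/-- `d^∇̂ = Υ̃ ∘ D̂^ω ∘ Υ̃⁻¹`. -/
def dNablaR (ω : C.inv →ₗ[ℂ] Ω) (ψ : FormsR X) : FormsR X :=
  upsR X (covDHat X ω ∘ₗ upsInvR X ψ)

/-- `d^S = Υ ∘ S^ω ∘ Υ⁻¹`. -/
def dSL (δ : C.inv →ₗ[ℂ] C.inv ⊗[ℂ] C.inv) (ω : C.inv →ₗ[ℂ] Ω) (ψ : FormsL X) : FormsL X :=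
  upsL X (opS (𝒜 := 𝒜) δ ω (upsInvL X ψ))

/-- `d^Ŝ = Υ̃ ∘ Ŝ^ω ∘ Υ̃⁻¹`, where `Ŝ^ω(τ)` is the dual of `S^ω(τ̂)`. -/
def dSR (δ : C.inv →ₗ[ℂ] C.inv ⊗[ℂ] C.inv) (ω : C.inv →ₗ[ℂ] Ω) (ψ : FormsR X) : FormsR X :=
  upsR X (hat X (opS (𝒜 := 𝒜) δ ω (hat X (upsInvR X ψ))))

variable {X} {A : Type*} [CStarAlgebra A] (H : HodgeData X A)

/-- `(-1)ᵏ ((⋆_L⁻¹ ∘ ∗) ⊗ id) ∘ d^∇ ∘ ((∗ ∘ ⋆_L) ⊗ id)` on forms of degree `k`, where `∇` is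
induced by the dual connection `ω̂` (which is `ω` when `ω` is real). -/
def dNablaStarL (ω : C.inv →ₗ[ℂ] Ω) (ψ : FormsL X) : FormsL X :=
  mapFormsL X H.starLInvCj H.starLInvCj_mul (dNablaL X (hat X ω)
    (mapFormsL X H.cjStarL H.cjStarL_mul (mapFormsL X X.sgnM X.sgnM_mul_ιM ψ)))

/-- `(-1)ᵏ (id ⊗ (⋆_R⁻¹ ∘ ∗)) ∘ d^∇̂ ∘ (id ⊗ (∗ ∘ ⋆_R))` on forms of degree `k`, where `∇̂` is
induced by the dual connection `ω̂` (which is `ω` when `ω` is real). -/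
def dNablaStarR (ω : C.inv →ₗ[ℂ] Ω) (ψ : FormsR X) : FormsR X :=
  mapFormsR X H.starRInvCj H.starRInvCj_mul (dNablaR X (hat X ω)
    (mapFormsR X H.cjStarR H.cjStarR_mul (mapFormsR X X.sgnM X.sgnM_ιM_mul ψ)))

end Connections

/-! ### Yang–Mills models -/

/-- A noncommutative geometrical Yang–Mills model on a quantum principal bundle with a
differential calculus. -/
structure YangMillsModel (X : BundleCalculus 𝒜 B C) (A : Type*) [CStarAlgebra A]
    extends HodgeData X A where
  frame : AdFrame B C
  δ : C.inv →ₗ[ℂ] C.inv ⊗[ℂ] C.inv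
  embedded : IsEmbeddedDifferential C δ
  adjointable_left : ∀ ω, IsQPC X ω → ∃ S, IsAdjointL toHodgeData frame (dSL X δ ω) S
  adjointable_right : ∀ ω, IsQPC X ω → ∃ S, IsAdjointR toHodgeData frame (dSR X δ ω) S

namespace YangMillsModel

variable {X : BundleCalculus 𝒜 B C} {A : Type*} [CStarAlgebra A] (Y : YangMillsModel X A)

/-- The Yang–Mills Lagrangian `-1/4 (⟨R, R⟩_L + ⟨R̂, R̂⟩_R)`. -/
def lagrangian (ω : C.inv →ₗ[ℂ] Ω) : B.base :=
  (-(1 / 4) : ℂ) •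
    (formL Y.toHodgeData Y.frame (upsL X (curvature X Y.δ ω)) (upsL X (curvature X Y.δ ω)) +
      formR Y.toHodgeData Y.frame (upsR X (hat X (curvature X Y.δ ω)))
        (upsR X (hat X (curvature X Y.δ ω))))

/-- The Yang–Mills action `∫ L(ω) dvol`. -/
def action (ω : C.inv →ₗ[ℂ] Ω) : ℂ := Y.s (Y.lagrangian ω)

/-- Yang–Mills connections: stationary points of the action, i.e. `∂/∂z` (the Wirtinger
derivative `(∂/∂x - i ∂/∂y) / 2`) of the action at `ω + z lam` exists and vanishes at `z = 0` for
every displacement `lam`. -/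
def IsYangMills (ω : C.inv →ₗ[ℂ] Ω) : Prop :=
  ∀ lam, IsDisplacement X lam →
    DifferentiableAt ℝ (fun z : ℂ => Y.action (ω + z • lam)) 0 ∧
    (1 / 2 : ℂ) * (fderiv ℝ (fun z : ℂ => Y.action (ω + z • lam)) 0 1 -
      Complex.I * fderiv ℝ (fun z : ℂ => Y.action (ω + z • lam)) 0 Complex.I) = 0

end YangMillsModel

end Bundle

end QYM

end

/-!
The first half is integration by parts. For sections `T`, `S` of the associated bundle, unitarity of
`ad` gives `d⟨T, S⟩ = ⟨∇^ω T, S⟩ + ⟨T, ∇^ω̂ S⟩` (`d_hermL`): the connection terms cancel because the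
quantum germs `π(uᵢⱼ)` of the coefficients of a unitary corepresentation form an antihermitian
matrix. Hence `⟨d^∇(μ ⊗ T), ν ⊗ S⟩ dvol` and `⟨μ ⊗ T, d^{∇⋆}(ν ⊗ S)⟩ dvol` differ, up to sign, by
the differential of `μ ⟨T, S⟩ (⋆ν)` (`s_gL_contractL`, `s_gL_eq`), whose integral vanishes. The
right-handed version rests on the conjugate of `ad` being unitary as well. This follows from
the assumption that `⟨-, -⟩_R` takes its values in `M` (`AdFrame.sum_star_mul_adMatrix`).

To make sense of `Υ` and `Υ̃` as inverses one needs that bundle-valued forms are the same as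
horizontal intertwiners (`AdFrame.equivL`, `AdFrame.equivR`), and that all operators
involved preserve horizontal intertwiners. For the curvature (`curvature_mem`) this uses that `Γ^∧`
is the universal envelope: its coproduct is well defined in degree two, which makes the embedded
differential `δ` compatible with the adjoint coaction (`GroupCalculus.adMulRight_add`).

For the second half, `R^{ω + zλ} = R^ω + z (D^ω λ - S^ω(λ)) - z² ⟨λ, λ⟩` by `curvature_add_smul` and
`curvatureVar_eq`. So the action is a polynomial in `z` and its conjugate, and its Wirtinger
derivative at `0` is the coefficient of `z`, which is
`-1/4 (⟨Υ(D^ω λ - S^ω(λ)) | ΥR⟩_L + ⟨Υ̃(D^ω λ - S^ω(λ))^ | Υ̃R̂⟩_R)`; here `z` enters the right-hand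
form linearly since both the duality and the form are antilinear in the first variable. Passing to
adjoints gives the field equation.
-/

set_option linter.unusedSectionVars false

namespace QYM

/-! ### The coactions of the group on its first order calculus -/

section Group

variable {G : Type*} [Ring G] [StarRing G] [HopfAlgebra ℂ G] [StarModule ℂ G]
variable {Γ : Type*} [Ring Γ] [Algebra ℂ Γ] {𝒢 : ℕ → Submodule ℂ Γ} [GradedAlgebra 𝒢]

open Coalgebra

namespace GroupCalculus

variable (C : GroupCalculus G 𝒢)

theorem span_lact_d₁ :
    Submodule.span ℂ (Set.range fun p : G × G => C.lact p.1 (C.d₁ p.2)) = ⊤ := by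
  rw [← Submodule.ker_mkQ (Submodule.span ℂ _), LinearMap.ker_eq_top]
  apply C.lact_ext
  intro a b
  rw [LinearMap.zero_apply, Submodule.mkQ_apply, Submodule.Quotient.mk_eq_zero]
  exact Submodule.subset_span ⟨(a, b), rfl⟩

/-- The variant of `lact_ext` for maps into an additive monoid. -/
theorem lact_hom_ext {Y : Type*} [AddCommMonoid Y] [Module ℂ Y] {f f' : 𝒢 1 →ₗ[ℂ] Y}
    (h : ∀ a b, f (C.lact a (C.d₁ b)) = f' (C.lact a (C.d₁ b))) : f = f' :=
  LinearMap.ext_on_range C.span_lact_d₁ fun p => h p.1 p.2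

theorem actR_one (x : 𝒢 1 ⊗[ℂ] G) : C.actR 1 x = x := by
  induction x with
  | zero => simp
  | tmul a b => rw [Algebra.TensorProduct.one_def, actR_tmul, one_mul, lact_one]
  | add x y hx hy => rw [map_add, hx, hy]

theorem actR_mul (s t : G ⊗[ℂ] G) (x : 𝒢 1 ⊗[ℂ] G) :
    C.actR (s * t) x = C.actR s (C.actR t x) := by
  induction s with
  | zero => simp
  | add s s' h h' => simp only [add_mul, map_add, LinearMap.add_apply, h, h']
  | tmul a b =>
    induction t with
    | zero => simp
    | add s s' h h' => simp only [mul_add, map_add, LinearMap.add_apply, h, h']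
    | tmul c e =>
      induction x with
      | zero => simp
      | add s s' h h' => simp only [map_add, h, h']
      | tmul f γ => simp [mul_assoc, lact_mul]

theorem coactR_lact (a : G) (γ : 𝒢 1) :
    C.coactR (C.lact a γ) = C.actR (comul a) (C.coactR γ) := by
  have : C.coactR ∘ₗ C.lact a = C.actR (comul a) ∘ₗ C.coactR := by
    apply C.lact_hom_ext
    intro b c
    simp only [LinearMap.comp_apply]
    rw [← lact_mul, coactR_lact_d₁, coactR_lact_d₁, ← actR_mul, Bialgebra.comul_mul]
  exact LinearMap.congr_fun this γ

theorem coactR_d₁ (h : G) :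
    C.coactR (C.d₁ h) = TensorProduct.map C.d₁ LinearMap.id (comul h) := by
  have := C.coactR_lact_d₁ 1 h
  rwa [lact_one, Bialgebra.comul_one, actR_one] at this

theorem coactR_coassoc (γ : 𝒢 1) :
    TensorProduct.assoc ℂ (𝒢 1) G G (LinearMap.rTensor G C.coactR (C.coactR γ)) =
      LinearMap.lTensor (𝒢 1) comul (C.coactR γ) := by
  have : (TensorProduct.assoc ℂ (𝒢 1) G G).toLinearMap ∘ₗ LinearMap.rTensor G C.coactR ∘ₗ
      C.coactR = LinearMap.lTensor (𝒢 1) comul ∘ₗ C.coactR := by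
    apply C.lact_hom_ext
    intro g h
    simp only [LinearMap.comp_apply, LinearEquiv.coe_coe, coactR_lact_d₁]
    let B' : G ⊗[ℂ] (G ⊗[ℂ] G) →ₗ[ℂ] G ⊗[ℂ] (G ⊗[ℂ] G) →ₗ[ℂ] 𝒢 1 ⊗[ℂ] (G ⊗[ℂ] G) :=
      (TensorProduct.map₂ C.lact (LinearMap.mul ℂ (G ⊗[ℂ] G))).compl₂
        (LinearMap.rTensor (G ⊗[ℂ] G) C.d₁)
    have hR : ∀ x y : G ⊗[ℂ] G,
        LinearMap.lTensor (𝒢 1) comul (C.actR x (TensorProduct.map C.d₁ LinearMap.id y)) =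
        B' (LinearMap.lTensor G comul x) (LinearMap.lTensor G comul y) := by
      intro x y
      induction x with
      | zero => simp
      | add x y hx hy => simp only [map_add, LinearMap.add_apply, hx, hy]
      | tmul a b =>
        induction y with
        | zero => simp
        | add x y hx hy => simp only [map_add, hx, hy]
        | tmul c e => simp [B', Bialgebra.comul_mul]
    have hL : ∀ x y : G ⊗[ℂ] G,
        TensorProduct.assoc ℂ (𝒢 1) G G (LinearMap.rTensor G C.coactR
          (C.actR x (TensorProduct.map C.d₁ LinearMap.id y))) =
        B' (TensorProduct.assoc ℂ G G G (LinearMap.rTensor G comul x))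
          (TensorProduct.assoc ℂ G G G (LinearMap.rTensor G comul y)) := by
      intro x y
      induction x with
      | zero => simp
      | add x y hx hy => simp only [map_add, LinearMap.add_apply, hx, hy]
      | tmul a b =>
        induction y with
        | zero => simp
        | add x y hx hy => simp only [map_add, hx, hy]
        | tmul c e =>
          simp only [TensorProduct.map_tmul, LinearMap.id_apply, actR_tmul,
            LinearMap.rTensor_tmul, coactR_lact_d₁]
          generalize (comul a : G ⊗[ℂ] G) = s
          generalize (comul c : G ⊗[ℂ] G) = t
          induction s with
          | zero => simp
          | add x y hx hy =>
            simp only [map_add, LinearMap.add_apply, TensorProduct.add_tmul, hx, hy]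
          | tmul p q =>
            induction t with
            | zero => simp
            | add x y hx hy => simp only [map_add, TensorProduct.add_tmul, hx, hy]
            | tmul r w => simp [B']
    rw [hL, hR, Coalgebra.coassoc_apply, Coalgebra.coassoc_apply]
  exact LinearMap.congr_fun this γ

theorem coactR_counit (γ : 𝒢 1) :
    TensorProduct.rid ℂ (𝒢 1) (LinearMap.lTensor (𝒢 1) counit (C.coactR γ)) = γ := by
  have : (TensorProduct.rid ℂ (𝒢 1)).toLinearMap ∘ₗ LinearMap.lTensor (𝒢 1) counit ∘ₗ
      C.coactR = LinearMap.id := by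
    apply C.lact_hom_ext
    intro g h
    simp only [LinearMap.comp_apply, LinearEquiv.coe_coe, coactR_lact_d₁, LinearMap.id_apply]
    have key : ∀ x y : G ⊗[ℂ] G,
        TensorProduct.rid ℂ (𝒢 1) (LinearMap.lTensor (𝒢 1) counit
          (C.actR x (TensorProduct.map C.d₁ LinearMap.id y))) =
        C.lact (TensorProduct.rid ℂ G (LinearMap.lTensor G counit x))
          (C.d₁ (TensorProduct.rid ℂ G (LinearMap.lTensor G counit y))) := by
      intro x y
      induction x with
      | zero => simp
      | add x y hx hy => simp only [map_add, LinearMap.add_apply, hx, hy]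
      | tmul a b =>
        induction y with
        | zero => simp
        | add x y hx hy => simp only [map_add, hx, hy]
        | tmul c e => simp [smul_smul, mul_comm]
    rw [key, Coalgebra.lTensor_counit_comul, Coalgebra.lTensor_counit_comul]
    simp
  exact LinearMap.congr_fun this γ

theorem coactR_cj₁ (γ : 𝒢 1) : C.coactR (C.cj₁ γ) =
    TensorProduct.map C.cj₁ (starLinearEquiv ℂ (A := G)).toLinearMap (C.coactR γ) := by
  let F : 𝒢 1 →ₗ[ℂ] 𝒢 1 ⊗[ℂ] G :=
    (TensorProduct.map C.cj₁ (starLinearEquiv ℂ (A := G)).toLinearMap) ∘ₛₗ (C.coactR ∘ₛₗ C.cj₁)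
  have hcc : ∀ γ, C.cj₁ (C.cj₁ γ) = γ := fun γ => by
    ext; exact C.cj_cj _
  have hF : F = C.coactR := by
    apply C.lact_hom_ext
    intro g h
    simp only [F, LinearMap.comp_apply, cj₁_lact_d₁, map_sub, coactR_d₁, coactR_lact_d₁,
      Bialgebra.comul_mul, C.cmqg.comul_star]
    generalize (comul g : G ⊗[ℂ] G) = s
    generalize (comul h : G ⊗[ℂ] G) = t
    induction s with
    | zero => simp
    | add x y hx hy =>
      simp only [map_add, LinearMap.add_apply, mul_add, star_add, ← hx, ← hy]
      abel
    | tmul a b =>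
      induction t with
      | zero => simp
      | add x y hx hy =>
        simp only [map_add, LinearMap.add_apply, add_mul, star_add, ← hx, ← hy]
        abel
      | tmul c e =>
        have : C.cj₁ (C.d₁ (star c * star a)) - C.cj₁ (C.lact (star c) (C.d₁ (star a))) =
            C.lact a (C.d₁ c) := by
          rw [← map_sub, ← cj₁_lact_d₁, hcc]
        simp only [TensorProduct.star_tmul, Algebra.TensorProduct.tmul_mul_tmul,
          TensorProduct.map_tmul, LinearMap.id_apply, actR_tmul, LinearEquiv.coe_coe,
          starLinearEquiv_apply, star_mul, star_star, ← TensorProduct.sub_tmul, this]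
  have h2 := LinearMap.congr_fun hF (C.cj₁ γ)
  simp only [F, LinearMap.comp_apply, hcc] at h2
  exact h2.symm

theorem rTensor_inv_subtype_injective (V : Type*) [AddCommGroup V] [Module ℂ V] :
    Function.Injective (LinearMap.rTensor V C.inv.subtype) :=
  Module.Flat.rTensor_preserves_injective_linearMap _ C.inv.injective_subtype

theorem ad_coassoc (θ : C.inv) :
    TensorProduct.assoc ℂ C.inv G G (LinearMap.rTensor G C.ad (C.ad θ)) =
      LinearMap.lTensor C.inv comul (C.ad θ) := by
  apply C.rTensor_inv_subtype_injective (G ⊗[ℂ] G)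
  have h1 : ∀ x : C.inv ⊗[ℂ] G, LinearMap.rTensor (G ⊗[ℂ] G) C.inv.subtype
      (TensorProduct.assoc ℂ C.inv G G (LinearMap.rTensor G C.ad x)) =
      TensorProduct.assoc ℂ (𝒢 1) G G (LinearMap.rTensor G C.coactR
        (LinearMap.rTensor G C.inv.subtype x)) := by
    intro x
    induction x with
    | zero => simp
    | add x y hx hy => simp only [map_add, hx, hy]
    | tmul a b =>
      simp only [LinearMap.rTensor_tmul, Submodule.subtype_apply, ← ad_spec]
      generalize C.ad a = t
      induction t with
      | zero => simp
      | add x y hx hy => simp only [map_add, TensorProduct.add_tmul, hx, hy]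
      | tmul c e => simp
  have h2 : ∀ x : C.inv ⊗[ℂ] G, LinearMap.rTensor (G ⊗[ℂ] G) C.inv.subtype
      (LinearMap.lTensor C.inv comul x) =
      LinearMap.lTensor (𝒢 1) comul (LinearMap.rTensor G C.inv.subtype x) := by
    intro x
    induction x with
    | zero => simp
    | add x y hx hy => simp only [map_add, hx, hy]
    | tmul a b => simp
  rw [h1, h2, ad_spec, coactR_coassoc]

theorem ad_counit (θ : C.inv) :
    TensorProduct.rid ℂ C.inv (LinearMap.lTensor C.inv counit (C.ad θ)) = θ := by
  apply C.inv.injective_subtype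
  have h1 : ∀ x : C.inv ⊗[ℂ] G, C.inv.subtype
      (TensorProduct.rid ℂ C.inv (LinearMap.lTensor C.inv counit x)) =
      TensorProduct.rid ℂ (𝒢 1) (LinearMap.lTensor (𝒢 1) counit
        (LinearMap.rTensor G C.inv.subtype x)) := by
    intro x
    induction x with
    | zero => simp
    | add x y hx hy => simp only [map_add, hx, hy]
    | tmul a b => simp
  rw [h1, ad_spec, coactR_counit, Submodule.subtype_apply]

theorem ad_invCj (θ : C.inv) : C.ad (C.invCj θ) =
    TensorProduct.map C.invCj (starLinearEquiv ℂ (A := G)).toLinearMap (C.ad θ) := by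
  apply C.rTensor_inv_subtype_injective G
  have h1 : ∀ x : C.inv ⊗[ℂ] G, LinearMap.rTensor G C.inv.subtype
      (TensorProduct.map C.invCj (starLinearEquiv ℂ (A := G)).toLinearMap x) =
      TensorProduct.map C.cj₁ (starLinearEquiv ℂ (A := G)).toLinearMap
        (LinearMap.rTensor G C.inv.subtype x) := by
    intro x
    induction x with
    | zero => simp
    | add x y hx hy => simp only [map_add, hx, hy]
    | tmul a b => simp; rfl
  rw [h1, ad_spec, ad_spec, ← coactR_cj₁]
  rfl

end GroupCalculus

end Group

/-! ### Unitary corepresentations and the quantum germs of their coefficients -/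

section Corep

variable {G : Type*} [Ring G] [StarRing G] [HopfAlgebra ℂ G] [StarModule ℂ G]

open Coalgebra

/-- A unitary finite-dimensional corepresentation of `G`, given by its matrix. -/
structure IsUnitaryCorep {m : ℕ} (u : Matrix (Fin m) (Fin m) G) : Prop where
  comul : ∀ i j, comul (R := ℂ) (u i j) = ∑ k, u i k ⊗ₜ[ℂ] u k j
  counit : ∀ i j, counit (R := ℂ) (u i j) = if i = j then 1 else 0
  left : ∀ i j, ∑ k, star (u k i) * u k j = if i = j then 1 else 0
  right : ∀ i j, ∑ k, u i k * star (u j k) = if i = j then 1 else 0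

theorem antipode_eq_star_of_mul_star {m : ℕ} {u : Matrix (Fin m) (Fin m) G}
    (hc : ∀ i j, comul (R := ℂ) (u i j) = ∑ k, u i k ⊗ₜ[ℂ] u k j)
    (he : ∀ i j, counit (R := ℂ) (u i j) = if i = j then 1 else 0)
    (hr : ∀ i j, ∑ k, u i k * star (u j k) = if i = j then 1 else 0) (i j : Fin m) :
    HopfAlgebra.antipode ℂ (u i j) = star (u j i) := by
  have h1 : ∀ i j, ∑ k, HopfAlgebra.antipode ℂ (u i k) * u k j = if i = j then 1 else 0 := by
    intro i j
    have := HopfAlgebra.mul_antipode_rTensor_comul_apply (R := ℂ) (u i j)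
    rw [hc, he] at this
    simp only [map_sum, LinearMap.rTensor_tmul, LinearMap.mul'_apply] at this
    rw [this]
    split_ifs <;> simp
  have h2 : (Matrix.of fun i j => HopfAlgebra.antipode ℂ (u i j)) * u = 1 := by
    ext i j
    rw [Matrix.mul_apply, Matrix.one_apply, ← h1 i j]
    rfl
  have h3 : u * u.conjTranspose = 1 := by
    ext i j
    rw [Matrix.mul_apply, Matrix.one_apply, ← hr i j]
    rfl
  have := left_inv_eq_right_inv h2 h3
  exact congrFun (congrFun this i) j

/-- For the matrix of a corepresentation, one of the two unitarity relations implies the other: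
both the adjoint matrix and the matrix of antipodes are inverse to it. -/
theorem IsUnitaryCorep.of_mul_star {m : ℕ} {u : Matrix (Fin m) (Fin m) G}
    (hc : ∀ i j, Coalgebra.comul (R := ℂ) (u i j) = ∑ k, u i k ⊗ₜ[ℂ] u k j)
    (he : ∀ i j, Coalgebra.counit (R := ℂ) (u i j) = if i = j then 1 else 0)
    (hr : ∀ i j, ∑ k, u i k * star (u j k) = if i = j then 1 else 0) : IsUnitaryCorep u where
  comul := hc
  counit := he
  right := hr
  left i j := by
    have := HopfAlgebra.mul_antipode_rTensor_comul_apply (R := ℂ) (u i j)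
    rw [hc, he] at this
    simp only [map_sum, LinearMap.rTensor_tmul, LinearMap.mul'_apply,
      antipode_eq_star_of_mul_star hc he hr] at this
    rw [this]
    split_ifs <;> simp

namespace IsUnitaryCorep

variable {m : ℕ} {u : Matrix (Fin m) (Fin m) G}

theorem antipode (hu : IsUnitaryCorep u) (i j : Fin m) :
    HopfAlgebra.antipode ℂ (u i j) = star (u j i) :=
  antipode_eq_star_of_mul_star hu.comul hu.counit hu.right i j

variable {Γ : Type*} [Ring Γ] [Algebra ℂ Γ] {𝒢 : ℕ → Submodule ℂ Γ} [GradedAlgebra 𝒢]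
  (C : GroupCalculus G 𝒢)

theorem germ₁_eq (hu : IsUnitaryCorep u) (i j : Fin m) :
    C.germ₁ (u i j) = ∑ k, C.lact (star (u k i)) (C.d₁ (u k j)) := by
  simp [GroupCalculus.germ₁, hu.comul, hu.antipode]

theorem d₁_eq (hu : IsUnitaryCorep u) (i j : Fin m) :
    C.d₁ (u i j) = ∑ k, C.lact (u i k) (C.germ₁ (u k j)) := by
  rw [← C.lact_germ₁, hu.comul]
  simp

/-- The quantum germs of the coefficients form an antihermitian matrix; this is `dδᵢⱼ = 0` for
`δᵢⱼ = ∑ₖ uₖᵢ* uₖⱼ`. -/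
theorem invCj_germ (hu : IsUnitaryCorep u) (i j : Fin m) :
    C.invCj (C.germ (u i j)) = -C.germ (u j i) := by
  have h1 : C.d 1 = 0 := by
    have := C.leibniz (SetLike.GradedOne.one_mem (A := 𝒢)) 1
    simpa using this
  ext
  change C.cj (C.germ₁ (u i j) : Γ) = -(C.germ₁ (u j i) : Γ)
  rw [hu.germ₁_eq C, hu.germ₁_eq C, eq_neg_iff_add_eq_zero]
  simp only [AddSubmonoidClass.coe_finsetSum, GroupCalculus.lact_coe, GroupCalculus.d₁_coe,
    map_sum]
  rw [← Finset.sum_add_distrib]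
  have h2 : ∀ k, C.cj (C.ι (star (u k i)) * C.d (C.ι (u k j))) +
      C.ι (star (u k j)) * C.d (C.ι (u k i)) = C.d (C.ι (star (u k j) * u k i)) := by
    intro k
    rw [C.cj_mul (C.ι_mem _) (C.d_mem (C.ι_mem _)), ← C.d_cj, ← C.ι_star, ← C.ι_star, map_mul,
      C.leibniz (C.ι_mem _)]
    simp
  rw [Finset.sum_congr rfl fun k _ => h2 k, ← map_sum, ← map_sum, hu.left]
  split_ifs <;> simp [h1]

/-- The action on the right leg of a tensor product of the matrix of a unitary corepresentation
is cancellable. -/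
theorem cancel (hu : IsUnitaryCorep u) {V : Type*} [AddCommMonoid V] [Module ℂ V]
    (x y : Fin m → V ⊗[ℂ] G)
    (f : G →ₗ[ℂ] Module.End ℂ (V ⊗[ℂ] G)) (hf1 : ∀ x, f 1 x = x)
    (hf : ∀ a b x, f (a * b) x = f a (f b x))
    (h : ∀ k, ∑ l, f (u k l) (x l) = ∑ l, f (u k l) (y l)) : x = y := by
  have key : ∀ (x : Fin m → V ⊗[ℂ] G) l,
      x l = ∑ k, f (star (u k l)) (∑ j, f (u k j) (x j)) := by
    intro x l
    simp only [map_sum, ← hf]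
    rw [Finset.sum_comm]
    simp only [← LinearMap.sum_apply, ← map_sum, hu.left]
    rw [Finset.sum_eq_single l]
    · simp [hf1]
    · intro j _ hj
      rw [if_neg (Ne.symm hj)]
      simp
    · simp
  ext1 l
  rw [key x l, key y l]
  simp only [h]

/-- `(1 ⊗ u) ad(π(u)) = π(u) ⊗ u`, the formula `ad(π(g)) = π(g⁽²⁾) ⊗ κ(g⁽¹⁾) g⁽³⁾` on the
coefficients of a unitary corepresentation. -/
theorem mul_ad_germ (hu : IsUnitaryCorep u) (l i : Fin m) :
    ∑ j, LinearMap.lTensor C.inv (LinearMap.mulLeft ℂ (u l j)) (C.ad (C.germ (u j i))) =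
      ∑ j, C.germ (u l j) ⊗ₜ[ℂ] u j i := by
  apply C.rTensor_inv_subtype_injective G
  have h1 : ∀ (g : G) (x : C.inv ⊗[ℂ] G), LinearMap.rTensor G C.inv.subtype
      (LinearMap.lTensor C.inv (LinearMap.mulLeft ℂ g) x) =
      LinearMap.lTensor (𝒢 1) (LinearMap.mulLeft ℂ g) (LinearMap.rTensor G C.inv.subtype x) := by
    intro g x
    induction x with
    | zero => simp
    | add x y hx hy => simp only [map_add, hx, hy]
    | tmul a b => simp
  simp only [map_sum, h1, GroupCalculus.ad_spec, LinearMap.rTensor_tmul]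
  change ∑ j, LinearMap.lTensor (𝒢 1) (LinearMap.mulLeft ℂ (u l j))
    (C.coactR (C.germ₁ (u j i))) = ∑ j, C.germ₁ (u l j) ⊗ₜ[ℂ] u j i
  let f : G →ₗ[ℂ] Module.End ℂ (𝒢 1 ⊗[ℂ] G) :=
    C.actR ∘ₗ (TensorProduct.mk ℂ G G).flip 1
  have hact : ∀ a b x, C.actR (a ⊗ₜ b) x =
      f a (LinearMap.lTensor (𝒢 1) (LinearMap.mulLeft ℂ b) x) := by
    intro a b x
    induction x with
    | zero => simp
    | add x y hx hy => simp only [map_add, hx, hy]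
    | tmul c e => simp [f]
  refine congrFun (hu.cancel (x := fun l => ∑ j, LinearMap.lTensor (𝒢 1)
    (LinearMap.mulLeft ℂ (u l j)) (C.coactR (C.germ₁ (u j i))))
    (y := fun l => ∑ j, C.germ₁ (u l j) ⊗ₜ[ℂ] u j i) f ?_ ?_ ?_) l
  · intro x
    exact C.actR_one x
  · intro a b x
    change C.actR ((a * b) ⊗ₜ 1) x = C.actR (a ⊗ₜ 1) (C.actR (b ⊗ₜ 1) x)
    rw [← C.actR_mul]
    simp
  · intro k
    have h2 := C.coactR_d₁ (u k i)
    rw [hu.d₁_eq C, hu.comul] at h2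
    simp only [map_sum, C.coactR_lact, hu.comul, LinearMap.sum_apply, hact, TensorProduct.map_tmul,
      LinearMap.id_apply, hu.d₁_eq C k, TensorProduct.sum_tmul] at h2
    rw [Finset.sum_comm] at h2
    simp only [map_sum]
    rw [h2, Finset.sum_comm]
    refine Finset.sum_congr rfl fun a _ => Finset.sum_congr rfl fun b _ => ?_
    simp [f]

end IsUnitaryCorep

end Corep

/-! ### The coproduct of the universal envelope in low degrees -/

section GradedMul

variable {A : Type*} [Ring A] [Algebra ℂ A] (𝒜 : ℕ → Submodule ℂ A) [GradedAlgebra 𝒜]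
variable {B : Type*} [Ring B] [Algebra ℂ B] (ℬ : ℕ → Submodule ℂ B) [GradedAlgebra ℬ]

/-- The multiplication of the graded tensor product, transported to the plain tensor product. -/
noncomputable def gmul : A ⊗[ℂ] B →ₗ[ℂ] A ⊗[ℂ] B →ₗ[ℂ] A ⊗[ℂ] B :=
  ((LinearMap.mul ℂ (𝒜 ᵍ⊗[ℂ] ℬ)).compl₁₂ (GradedTensorProduct.of ℂ 𝒜 ℬ).toLinearMap
    (GradedTensorProduct.of ℂ 𝒜 ℬ).toLinearMap).compr₂
      (GradedTensorProduct.of ℂ 𝒜 ℬ).symm.toLinearMap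

theorem gmul_apply (x y : A ⊗[ℂ] B) : gmul 𝒜 ℬ x y = (GradedTensorProduct.of ℂ 𝒜 ℬ).symm
    (GradedTensorProduct.of ℂ 𝒜 ℬ x * GradedTensorProduct.of ℂ 𝒜 ℬ y) := rfl

theorem gmul_tmul_of_mem {i j : ℕ} (a : A) {b : B} (hb : b ∈ ℬ j) {c : A} (hc : c ∈ 𝒜 i) (e : B) :
    gmul 𝒜 ℬ (a ⊗ₜ b) (c ⊗ₜ e) = ((-1 : ℂ) ^ (j * i)) • ((a * c) ⊗ₜ (b * e)) := by
  have := GradedTensorProduct.tmul_coe_mul_coe_tmul (R := ℂ) 𝒜 ℬ a ⟨b, hb⟩ ⟨c, hc⟩ e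
  rw [gmul_apply]
  refine (congrArg (GradedTensorProduct.of ℂ 𝒜 ℬ).symm this).trans ?_
  rcases Nat.even_or_odd (j * i) with h | h
  · rw [h.neg_one_pow, h.neg_one_pow, one_smul, one_smul]
    rfl
  · rw [h.neg_one_pow, h.neg_one_pow, Units.neg_smul, one_smul, neg_smul, one_smul, map_neg]
    rfl

theorem gmul_tmul_of_mem_zero (a : A) {b : B} (hb : b ∈ ℬ 0) (c : A) (e : B) :
    gmul 𝒜 ℬ (a ⊗ₜ b) (c ⊗ₜ e) = (a * c) ⊗ₜ (b * e) := by
  induction c using DirectSum.Decomposition.inductionOn 𝒜 with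
  | zero => simp
  | homogeneous c => rw [gmul_tmul_of_mem 𝒜 ℬ a hb c.2]; simp
  | add c c' h h' => simp only [TensorProduct.add_tmul, map_add, mul_add, h, h']

theorem gmul_tmul_of_mem_zero' (a : A) (b : B) {c : A} (hc : c ∈ 𝒜 0) (e : B) :
    gmul 𝒜 ℬ (a ⊗ₜ b) (c ⊗ₜ e) = (a * c) ⊗ₜ (b * e) := by
  induction b using DirectSum.Decomposition.inductionOn ℬ with
  | zero => simp
  | homogeneous b => rw [gmul_tmul_of_mem 𝒜 ℬ a b.2 hc]; simp
  | add c c' h h' =>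
    simp only [TensorProduct.tmul_add, map_add, add_mul, LinearMap.add_apply, h, h']

theorem gmul_tmul_of_mem_one (a : A) {b : B} (hb : b ∈ ℬ 1) {c : A} (hc : c ∈ 𝒜 1) (e : B) :
    gmul 𝒜 ℬ (a ⊗ₜ b) (c ⊗ₜ e) = -((a * c) ⊗ₜ (b * e)) := by
  rw [gmul_tmul_of_mem 𝒜 ℬ a hb hc]; simp

theorem gmul_assoc (x y z : A ⊗[ℂ] B) :
    gmul 𝒜 ℬ (gmul 𝒜 ℬ x y) z = gmul 𝒜 ℬ x (gmul 𝒜 ℬ y z) := by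
  simp only [gmul_apply, GradedTensorProduct.symm_of_of, mul_assoc]

theorem d_one {A : Type*} [Ring A] [Algebra ℂ A] {𝒜 : ℕ → Submodule ℂ A} [GradedAlgebra 𝒜]
    (D : DiffStar 𝒜) : D.d 1 = 0 := by
  have := D.leibniz (SetLike.GradedOne.one_mem (A := 𝒜)) 1
  simpa using this

end GradedMul

namespace GroupCalculus

variable {G : Type*} [Ring G] [StarRing G] [HopfAlgebra ℂ G] [StarModule ℂ G]
variable {Γ : Type*} [Ring Γ] [Algebra ℂ Γ] {𝒢 : ℕ → Submodule ℂ Γ} [GradedAlgebra 𝒢]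
variable (C : GroupCalculus G 𝒢)

open Coalgebra

/-- The inclusion of `inv Γ` in the universal envelope. -/
noncomputable def invIncl : C.inv →ₗ[ℂ] Γ := (𝒢 1).subtype ∘ₗ C.inv.subtype

theorem invIncl_mem (θ : C.inv) : C.invIncl θ ∈ 𝒢 1 := (θ : 𝒢 1).2

/-- The coproduct of `G`, with values in `Γ^∧ ⊗ Γ^∧`. -/
noncomputable def coprod₀ : G →ₗ[ℂ] Γ ⊗[ℂ] Γ :=
  TensorProduct.map C.ι.toLinearMap C.ι.toLinearMap ∘ₗ comul

/-- The coproduct of `Γ^∧` on elements of degree `1`: the sum of the two coactions. -/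
noncomputable def coprod₁ : 𝒢 1 →ₗ[ℂ] Γ ⊗[ℂ] Γ :=
  TensorProduct.map C.ι.toLinearMap (𝒢 1).subtype ∘ₗ C.coactL +
    TensorProduct.map (𝒢 1).subtype C.ι.toLinearMap ∘ₗ C.coactR

/-- The differential of the graded tensor product `Γ^∧ ⊗ Γ^∧`. -/
noncomputable def totalD : Γ ⊗[ℂ] Γ →ₗ[ℂ] Γ ⊗[ℂ] Γ :=
  TensorProduct.map C.d LinearMap.id + TensorProduct.map (degSign 𝒢) C.d

theorem coprod₀_mul (g h : G) :
    C.coprod₀ (g * h) = gmul 𝒢 𝒢 (C.coprod₀ g) (C.coprod₀ h) := by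
  simp only [coprod₀, LinearMap.comp_apply, Bialgebra.comul_mul]
  generalize (comul g : G ⊗[ℂ] G) = s
  generalize (comul h : G ⊗[ℂ] G) = t
  induction s with
  | zero => simp
  | add x y hx hy => simp only [map_add, add_mul, LinearMap.add_apply, hx, hy]
  | tmul a b =>
    induction t with
    | zero => simp
    | add x y hx hy => simp only [map_add, mul_add, hx, hy]
    | tmul c e =>
      simp [gmul_tmul_of_mem_zero 𝒢 𝒢 _ (C.ι_mem b)]

theorem coprod₁_lact (g : G) (γ : 𝒢 1) :
    C.coprod₁ (C.lact g γ) = gmul 𝒢 𝒢 (C.coprod₀ g) (C.coprod₁ γ) := by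
  simp only [coprod₀, coprod₁, LinearMap.comp_apply, LinearMap.add_apply, coactL_lact,
    coactR_lact, map_add]
  generalize (comul g : G ⊗[ℂ] G) = s
  congr 1
  · generalize C.coactL γ = t
    induction s with
    | zero => simp
    | add x y hx hy => simp only [map_add, LinearMap.add_apply, hx, hy]
    | tmul a b =>
      induction t with
      | zero => simp
      | add x y hx hy => simp only [map_add, hx, hy]
      | tmul c e => simp [gmul_tmul_of_mem_zero 𝒢 𝒢 _ (C.ι_mem b)]
  · generalize C.coactR γ = t
    induction s with
    | zero => simp
    | add x y hx hy => simp only [map_add, LinearMap.add_apply, hx, hy]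
    | tmul a b =>
      induction t with
      | zero => simp
      | add x y hx hy => simp only [map_add, hx, hy]
      | tmul c e => simp [gmul_tmul_of_mem_zero 𝒢 𝒢 _ (C.ι_mem b)]

theorem coprod₁_d₁ (g : G) : C.coprod₁ (C.d₁ g) = C.totalD (C.coprod₀ g) := by
  simp only [coprod₀, coprod₁, totalD, LinearMap.comp_apply, LinearMap.add_apply, coactL_d₁,
    coactR_d₁]
  generalize (comul g : G ⊗[ℂ] G) = s
  induction s with
  | zero => simp
  | add x y hx hy =>
    simp only [map_add] at hx hy ⊢
    rw [add_add_add_comm, hx, hy]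
    abel
  | tmul a b =>
    simp [degSign_of_mem 𝒢 (C.ι_mem a), add_comm]

theorem totalD_tmul_of_mem {k : ℕ} {a : Γ} (ha : a ∈ 𝒢 k) (b : Γ) :
    C.totalD (a ⊗ₜ b) = C.d a ⊗ₜ b + ((-1 : ℂ) ^ k) • (a ⊗ₜ C.d b) := by
  simp [totalD, degSign_of_mem 𝒢 ha, TensorProduct.smul_tmul']

theorem totalD_gmul (g h : G) :
    C.totalD (gmul 𝒢 𝒢 (C.coprod₀ g) (C.totalD (C.coprod₀ h))) =
      gmul 𝒢 𝒢 (C.totalD (C.coprod₀ g)) (C.totalD (C.coprod₀ h)) := by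
  simp only [coprod₀, LinearMap.comp_apply]
  generalize (comul g : G ⊗[ℂ] G) = s
  generalize (comul h : G ⊗[ℂ] G) = t
  induction s with
  | zero => simp
  | add x y hx hy => simp only [map_add, LinearMap.add_apply, hx, hy]
  | tmul a b =>
    induction t with
    | zero => simp
    | add x y hx hy => simp only [map_add, hx, hy]
    | tmul c e =>
      have ha := C.ι_mem a
      have hb := C.ι_mem b
      have hc := C.ι_mem c
      have hac : C.ι a * C.ι c ∈ 𝒢 0 := by
        rw [← map_mul]; exact C.ι_mem _
      have hadc : C.ι a * C.d (C.ι c) ∈ 𝒢 1 := (C.lact a (C.d₁ c)).2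
      simp only [TensorProduct.map_tmul, AlgHom.toLinearMap_apply, C.totalD_tmul_of_mem ha,
        C.totalD_tmul_of_mem hc, map_add, pow_zero, one_smul, LinearMap.add_apply,
        gmul_tmul_of_mem_zero 𝒢 𝒢 _ hb, gmul_tmul_of_mem_zero' 𝒢 𝒢 _ _ hc,
        gmul_tmul_of_mem_one 𝒢 𝒢 _ (C.d_mem hb) (C.d_mem hc), C.totalD_tmul_of_mem hac,
        C.totalD_tmul_of_mem hadc, C.leibniz ha, C.leibniz hb, C.d_d, TensorProduct.tmul_add,
        TensorProduct.add_tmul, pow_one, neg_smul, smul_add, mul_zero, add_zero]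
      abel

theorem coprod₁_d₁_mul (g h : G) (γ : 𝒢 1) (hγ : (γ : Γ) = C.d (C.ι g) * C.ι h) :
    C.coprod₁ γ = gmul 𝒢 𝒢 (C.coprod₁ (C.d₁ g)) (C.coprod₀ h) := by
  have h1 : γ = C.d₁ (g * h) - C.lact g (C.d₁ h) := by
    ext
    simp [hγ, C.leibniz (C.ι_mem g)]
  rw [h1, map_sub, coprod₁_lact, coprod₁_d₁, coprod₁_d₁, coprod₁_d₁, coprod₀_mul, sub_eq_iff_eq_add]
  simp only [coprod₀, LinearMap.comp_apply]
  generalize (comul g : G ⊗[ℂ] G) = s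
  generalize (comul h : G ⊗[ℂ] G) = t
  induction s with
  | zero => simp
  | add x y hx hy =>
    simp only [map_add, LinearMap.add_apply, hx, hy]
    abel
  | tmul a b =>
    induction t with
    | zero => simp
    | add x y hx hy =>
      simp only [map_add, hx, hy]
      abel
    | tmul c e =>
      have ha := C.ι_mem a
      have hb := C.ι_mem b
      have hc := C.ι_mem c
      have hac : C.ι a * C.ι c ∈ 𝒢 0 := by
        rw [← map_mul]; exact C.ι_mem _
      simp only [TensorProduct.map_tmul, AlgHom.toLinearMap_apply, C.totalD_tmul_of_mem ha,
        C.totalD_tmul_of_mem hc, map_add, pow_zero, one_smul, LinearMap.add_apply,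
        gmul_tmul_of_mem_zero 𝒢 𝒢 _ hb, gmul_tmul_of_mem_zero' 𝒢 𝒢 _ _ hc,
        C.totalD_tmul_of_mem hac, C.leibniz ha, C.leibniz hb, TensorProduct.tmul_add,
        TensorProduct.add_tmul]
      abel

theorem coprod₁_mul (g : G) (γ γ' : 𝒢 1) (hγ : (γ' : Γ) = γ * C.ι g) :
    C.coprod₁ γ' = gmul 𝒢 𝒢 (C.coprod₁ γ) (C.coprod₀ g) := by
  let R : 𝒢 1 →ₗ[ℂ] 𝒢 1 := (LinearMap.mulRight ℂ (C.ι g) ∘ₗ (𝒢 1).subtype).codRestrict (𝒢 1)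
    fun γ => by simpa using SetLike.mul_mem_graded γ.2 (C.ι_mem g)
  have hR : C.coprod₁ ∘ₗ R = (gmul 𝒢 𝒢).flip (C.coprod₀ g) ∘ₗ C.coprod₁ := by
    apply C.lact_hom_ext
    intro a b
    have hmem : C.d (C.ι b) * C.ι g ∈ 𝒢 1 := by
      simpa using SetLike.mul_mem_graded (C.d_mem (C.ι_mem b)) (C.ι_mem g)
    have : R (C.lact a (C.d₁ b)) = C.lact a ⟨_, hmem⟩ := by
      ext; simp [R, mul_assoc]
    rw [LinearMap.comp_apply, this, coprod₁_lact, C.coprod₁_d₁_mul b g _ rfl, ← gmul_assoc,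
      ← coprod₁_lact]
    rfl
  have : γ' = R γ := by ext; exact hγ
  rw [this]
  exact LinearMap.congr_fun hR γ

/-- The coproduct of `Γ^∧`, defined on the free algebra on `G ⊕ Γ¹`. -/
noncomputable def freeCoprod : TensorAlgebra ℂ (G × 𝒢 1) →ₐ[ℂ] 𝒢 ᵍ⊗[ℂ] 𝒢 :=
  TensorAlgebra.lift ℂ
    ((GradedTensorProduct.of ℂ 𝒢 𝒢).toLinearMap ∘ₗ C.coprod₀.coprod C.coprod₁)

theorem freeCoprod_ι (g : G) (γ : 𝒢 1) : C.freeCoprod (TensorAlgebra.ι ℂ (g, γ)) =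
    GradedTensorProduct.of ℂ 𝒢 𝒢 (C.coprod₀ g + C.coprod₁ γ) := by
  simp [freeCoprod]

/-- The relations of the universal envelope respect the coproduct. -/
theorem freeCoprod_rel {x y : TensorAlgebra ℂ (G × 𝒢 1)} (h : EnvelopeRel C.ι C.d x y) :
    C.freeCoprod x = C.freeCoprod y := by
  cases h with
  | one =>
    rw [freeCoprod_ι, map_zero, add_zero, map_one C.freeCoprod]
    simp only [coprod₀, LinearMap.comp_apply, Bialgebra.comul_one]
    rw [Algebra.TensorProduct.one_def, TensorProduct.map_tmul]
    simp only [AlgHom.toLinearMap_apply, map_one]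
    rfl
  | mul g h =>
    rw [map_mul, freeCoprod_ι, freeCoprod_ι, freeCoprod_ι, map_zero, add_zero, add_zero, add_zero,
      coprod₀_mul]
    rfl
  | left g γ γ' h =>
    have : γ' = C.lact g γ := by ext; exact h
    rw [map_mul, freeCoprod_ι, freeCoprod_ι, freeCoprod_ι, map_zero, map_zero, add_zero, zero_add,
      zero_add, this, coprod₁_lact]
    rfl
  | right g γ γ' h =>
    rw [map_mul, freeCoprod_ι, freeCoprod_ι, freeCoprod_ι, map_zero, map_zero, add_zero, zero_add,
      zero_add, C.coprod₁_mul g γ γ' h]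
    rfl
  | quad n g h γ η hγ hη hs =>
    have hγ' : ∀ i, γ i = C.d₁ (g i) := fun i => by ext; exact hγ i
    have hη' : ∀ i, η i = C.d₁ (h i) := fun i => by ext; exact hη i
    have h0 : ∑ i, C.lact (g i) (C.d₁ (h i)) = 0 := by
      ext; simpa using hs
    have h1 := congrArg C.totalD (congrArg C.coprod₁ h0)
    simp only [map_sum, coprod₁_lact, coprod₁_d₁, totalD_gmul, map_zero] at h1
    simp only [map_sum, map_mul, freeCoprod_ι, map_zero, zero_add, hγ', hη', coprod₁_d₁]
    exact h1

/-- This is where universality of `Γ^∧` enters: an element of the free algebra that vanishes in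
`Γ^∧` is in the ideal of the relations, which the coproduct respects. -/
theorem freeCoprod_eq_zero {x : TensorAlgebra ℂ (G × 𝒢 1)}
    (hx : TensorAlgebra.lift ℂ (C.ι.toLinearMap.coprod (𝒢 1).subtype) x = 0) :
    C.freeCoprod x = 0 := by
  have h := RingQuot.liftAlgHom_mkAlgHom_apply ℂ C.freeCoprod
    (fun x y hxy => C.freeCoprod_rel hxy) x
  rw [← h, C.universal x hx, map_zero]

/-- A lift of `dγ` to the free algebra, namely `∑ dgᵢ · dhᵢ` for `γ = ∑ gᵢ dhᵢ`, whose coproduct is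
the total differential of the coproduct of `γ`. -/
theorem exists_free_d (γ : 𝒢 1) : ∃ t : TensorAlgebra ℂ (G × 𝒢 1),
    TensorAlgebra.lift ℂ (C.ι.toLinearMap.coprod (𝒢 1).subtype) t = C.d γ ∧
      C.freeCoprod t = GradedTensorProduct.of ℂ 𝒢 𝒢 (C.totalD (C.coprod₁ γ)) := by
  have hγ : γ ∈ Submodule.span ℂ (Set.range fun p : G × G => C.lact p.1 (C.d₁ p.2)) := by
    rw [C.span_lact_d₁]; trivial
  induction hγ using Submodule.span_induction with
  | mem x hx =>
    obtain ⟨⟨g, h⟩, rfl⟩ := hx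
    refine ⟨TensorAlgebra.ι ℂ (0, C.d₁ g) * TensorAlgebra.ι ℂ (0, C.d₁ h), ?_, ?_⟩
    · simp [C.leibniz (C.ι_mem g), C.d_d]
    · simp only [map_mul, freeCoprod_ι, map_zero, zero_add, coprod₁_lact, coprod₁_d₁, totalD_gmul]
      rfl
  | zero => exact ⟨0, by simp, by simp⟩
  | add x y _ _ hx hy =>
    obtain ⟨t, h1, h2⟩ := hx
    obtain ⟨t', h1', h2'⟩ := hy
    exact ⟨t + t', by simp [h1, h1'], by simp only [map_add, h2, h2']⟩
  | smul c x _ hx =>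
    obtain ⟨t, h1, h2⟩ := hx
    exact ⟨c • t, by simp [h1], by simp only [map_smul, h2]⟩

/-- The coproduct of `Γ^∧` is well defined in degree `2`: a lift `x` of `dγ` to products of
left-invariant elements has the same coproduct as `dγ`. -/
theorem gmul_coprod₁_of_lift (γ : 𝒢 1) (x : C.inv ⊗[ℂ] C.inv)
    (hx : LinearMap.mul' ℂ Γ (TensorProduct.map C.invIncl C.invIncl x) = C.d γ) :
    TensorProduct.lift (gmul 𝒢 𝒢) (TensorProduct.map (C.coprod₁ ∘ₗ C.inv.subtype)
      (C.coprod₁ ∘ₗ C.inv.subtype) x) = C.totalD (C.coprod₁ γ) := by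
  obtain ⟨t, h1, h2⟩ := C.exists_free_d γ
  let j : C.inv →ₗ[ℂ] TensorAlgebra ℂ (G × 𝒢 1) :=
    TensorAlgebra.ι ℂ ∘ₗ LinearMap.inr ℂ G (𝒢 1) ∘ₗ C.inv.subtype
  have h3 : TensorAlgebra.lift ℂ (C.ι.toLinearMap.coprod (𝒢 1).subtype)
      (LinearMap.mul' ℂ _ (TensorProduct.map j j x)) =
      LinearMap.mul' ℂ Γ (TensorProduct.map C.invIncl C.invIncl x) := by
    clear hx
    induction x with
    | zero => simp
    | add x y hx hy => simp only [map_add, hx, hy]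
    | tmul a b => simp [j, invIncl]
  have h4 : C.freeCoprod (LinearMap.mul' ℂ _ (TensorProduct.map j j x)) =
      GradedTensorProduct.of ℂ 𝒢 𝒢 (TensorProduct.lift (gmul 𝒢 𝒢) (TensorProduct.map
        (C.coprod₁ ∘ₗ C.inv.subtype) (C.coprod₁ ∘ₗ C.inv.subtype) x)) := by
    clear hx h3
    induction x with
    | zero => simp
    | add x y hx hy => simp only [map_add, hx, hy]
    | tmul a b =>
      simp only [TensorProduct.map_tmul, LinearMap.mul'_apply, map_mul, j, LinearMap.comp_apply,
        LinearMap.inr_apply, freeCoprod_ι, map_zero, zero_add]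
      rfl
  have h5 := C.freeCoprod_eq_zero (x := LinearMap.mul' ℂ _ (TensorProduct.map j j x) - t)
    (by rw [map_sub, h3, hx, h1, sub_self])
  rw [map_sub, h2, h4, sub_eq_zero] at h5
  exact (GradedTensorProduct.of ℂ 𝒢 𝒢).injective h5

end GroupCalculus

/-! ### The coproduct of the differential of a left-invariant element -/

namespace GroupCalculus

variable {G : Type*} [Ring G] [StarRing G] [HopfAlgebra ℂ G] [StarModule ℂ G]
variable {Γ : Type*} [Ring Γ] [Algebra ℂ Γ] {𝒢 : ℕ → Submodule ℂ Γ} [GradedAlgebra 𝒢]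
variable (C : GroupCalculus G 𝒢)

open Coalgebra

/-- The adjoint coaction `ad`, with values in `inv Γ ⊗ Γ^∧`. -/
noncomputable def adΓ : C.inv →ₗ[ℂ] C.inv ⊗[ℂ] Γ := LinearMap.lTensor C.inv C.ι.toLinearMap ∘ₗ C.ad

/-- The map `a ⊗ b ↦ a⁽⁰⁾ ⊗ a⁽¹⁾ b`. -/
noncomputable def adMulRight : C.inv ⊗[ℂ] C.inv →ₗ[ℂ] C.inv ⊗[ℂ] Γ :=
  LinearMap.lTensor C.inv (LinearMap.mul' ℂ Γ) ∘ₗ (TensorProduct.assoc ℂ C.inv Γ Γ).toLinearMap ∘ₗ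
    TensorProduct.map C.adΓ C.invIncl

/-- The map `a ⊗ b ↦ b⁽⁰⁾ ⊗ a b⁽¹⁾`. -/
noncomputable def adMulLeft : C.inv ⊗[ℂ] C.inv →ₗ[ℂ] C.inv ⊗[ℂ] Γ :=
  LinearMap.lTensor C.inv (LinearMap.mul' ℂ Γ) ∘ₗ
    (TensorProduct.leftComm ℂ Γ C.inv Γ).toLinearMap ∘ₗ TensorProduct.map C.invIncl C.adΓ

theorem adMulRight_tmul (a b : C.inv) : C.adMulRight (a ⊗ₜ b) =
    LinearMap.lTensor C.inv (LinearMap.mulRight ℂ (C.invIncl b)) (C.adΓ a) := by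
  simp only [adMulRight, LinearMap.comp_apply, TensorProduct.map_tmul]
  generalize C.adΓ a = t
  induction t with
  | zero => simp
  | add x y hx hy => simp only [map_add, TensorProduct.add_tmul, hx, hy]
  | tmul c e => simp

theorem adMulLeft_tmul (a b : C.inv) : C.adMulLeft (a ⊗ₜ b) =
    LinearMap.lTensor C.inv (LinearMap.mulLeft ℂ (C.invIncl a)) (C.adΓ b) := by
  simp only [adMulLeft, LinearMap.comp_apply, TensorProduct.map_tmul]
  generalize C.adΓ b = t
  induction t with
  | zero => simp
  | add x y hx hy => simp only [map_add, TensorProduct.tmul_add, hx, hy]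
  | tmul c e => simp

theorem coprod₁_inv (θ : C.inv) : C.coprod₁ (θ : 𝒢 1) =
    1 ⊗ₜ C.invIncl θ + TensorProduct.map C.invIncl C.ι.toLinearMap (C.ad θ) := by
  have hθ : C.coactL θ = 1 ⊗ₜ (θ : 𝒢 1) := θ.2
  simp only [coprod₁, LinearMap.add_apply, LinearMap.comp_apply, hθ, TensorProduct.map_tmul,
    ← ad_spec]
  congr 1
  · simp [invIncl]
  · generalize C.ad θ = t
    induction t with
    | zero => simp
    | add x y hx hy => simp only [map_add, hx, hy]
    | tmul c e => simp [invIncl]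

/-- The component of bidegree `(1, 1)`. -/
noncomputable def projOneOne (𝒢 : ℕ → Submodule ℂ Γ) [GradedAlgebra 𝒢] :
    Γ ⊗[ℂ] Γ →ₗ[ℂ] Γ ⊗[ℂ] Γ :=
  TensorProduct.map (GradedAlgebra.proj 𝒢 1) (GradedAlgebra.proj 𝒢 1)

theorem projOneOne_of_mem {a b : Γ} (ha : a ∈ 𝒢 1) (hb : b ∈ 𝒢 1) :
    projOneOne 𝒢 (a ⊗ₜ b) = a ⊗ₜ b := by
  rw [projOneOne, TensorProduct.map_tmul]
  congr 1
  · exact DirectSum.decompose_of_mem_same 𝒢 ha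
  · exact DirectSum.decompose_of_mem_same 𝒢 hb

theorem projOneOne_of_mem_ne {k : ℕ} (hk : k ≠ 1) {a : Γ} (ha : a ∈ 𝒢 k) (b : Γ) :
    projOneOne 𝒢 (a ⊗ₜ b) = 0 := by
  rw [projOneOne, TensorProduct.map_tmul]
  have : GradedAlgebra.proj 𝒢 1 a = 0 := DirectSum.decompose_of_mem_ne 𝒢 ha hk
  rw [this, TensorProduct.zero_tmul]

theorem rTensor_invIncl_injective (V : Type*) [AddCommGroup V] [Module ℂ V] :
    Function.Injective (LinearMap.rTensor V C.invIncl) :=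
  Module.Flat.rTensor_preserves_injective_linearMap _
    ((𝒢 1).injective_subtype.comp C.inv.injective_subtype)

theorem one_mem_zero : (1 : Γ) ∈ 𝒢 0 := SetLike.GradedOne.one_mem (A := 𝒢)

theorem projOneOne_gmul (x : C.inv ⊗[ℂ] C.inv) :
    projOneOne 𝒢 (TensorProduct.lift (gmul 𝒢 𝒢) (TensorProduct.map (C.coprod₁ ∘ₗ C.inv.subtype)
      (C.coprod₁ ∘ₗ C.inv.subtype) x)) =
      LinearMap.rTensor Γ C.invIncl (C.adMulRight x) -
        LinearMap.rTensor Γ C.invIncl (C.adMulLeft x) := by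
  induction x with
  | zero => simp
  | add x y hx hy =>
    simp only [map_add] at hx hy ⊢
    rw [hx, hy]
    abel
  | tmul a b =>
    simp only [TensorProduct.map_tmul, LinearMap.comp_apply, Submodule.subtype_apply,
      coprod₁_inv, TensorProduct.lift.tmul, adMulRight_tmul, adMulLeft_tmul, adΓ, map_add,
      LinearMap.add_apply]
    have h1 : projOneOne 𝒢 (gmul 𝒢 𝒢 (1 ⊗ₜ C.invIncl a) (1 ⊗ₜ C.invIncl b)) = 0 := by
      rw [gmul_tmul_of_mem_zero' 𝒢 𝒢 _ _ one_mem_zero, one_mul]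
      exact projOneOne_of_mem_ne zero_ne_one one_mem_zero _
    have h2 : ∀ t : C.inv ⊗[ℂ] G, projOneOne 𝒢 (gmul 𝒢 𝒢 (1 ⊗ₜ C.invIncl a)
        (TensorProduct.map C.invIncl C.ι.toLinearMap t)) =
        -LinearMap.rTensor Γ C.invIncl (LinearMap.lTensor C.inv
          (LinearMap.mulLeft ℂ (C.invIncl a)) (LinearMap.lTensor C.inv C.ι.toLinearMap t)) := by
      intro t
      induction t with
      | zero => simp
      | add x y hx hy => simp only [map_add, hx, hy, neg_add]
      | tmul c e =>
        have hm : C.invIncl a * C.ι e ∈ 𝒢 1 := by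
          simpa using SetLike.mul_mem_graded (C.invIncl_mem a) (C.ι_mem e)
        simp [gmul_tmul_of_mem_one 𝒢 𝒢 _ (C.invIncl_mem a) (C.invIncl_mem c),
          projOneOne_of_mem (C.invIncl_mem c) hm]
    have h3 : ∀ t : C.inv ⊗[ℂ] G, projOneOne 𝒢 (gmul 𝒢 𝒢
        (TensorProduct.map C.invIncl C.ι.toLinearMap t) (1 ⊗ₜ C.invIncl b)) =
        LinearMap.rTensor Γ C.invIncl (LinearMap.lTensor C.inv
          (LinearMap.mulRight ℂ (C.invIncl b)) (LinearMap.lTensor C.inv C.ι.toLinearMap t)) := by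
      intro t
      induction t with
      | zero => simp
      | add x y hx hy => simp only [map_add, LinearMap.add_apply, hx, hy]
      | tmul c e =>
        have hm : C.ι e * C.invIncl b ∈ 𝒢 1 := by
          simpa using SetLike.mul_mem_graded (C.ι_mem e) (C.invIncl_mem b)
        simp [gmul_tmul_of_mem_zero 𝒢 𝒢 _ (C.ι_mem e), projOneOne_of_mem (C.invIncl_mem c) hm]
    have h4 : ∀ s t : C.inv ⊗[ℂ] G, projOneOne 𝒢 (gmul 𝒢 𝒢
        (TensorProduct.map C.invIncl C.ι.toLinearMap s)
        (TensorProduct.map C.invIncl C.ι.toLinearMap t)) = 0 := by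
      intro s t
      induction s with
      | zero => simp
      | add x y hx hy => simp only [map_add, LinearMap.add_apply, hx, hy, add_zero]
      | tmul c e =>
        induction t with
        | zero => simp
        | add x y hx hy => simp only [map_add, hx, hy, add_zero]
        | tmul c' e' =>
          rw [TensorProduct.map_tmul, TensorProduct.map_tmul, AlgHom.toLinearMap_apply,
            gmul_tmul_of_mem_zero 𝒢 𝒢 _ (C.ι_mem e)]
          exact projOneOne_of_mem_ne (by decide)
            (SetLike.mul_mem_graded (C.invIncl_mem c) (C.invIncl_mem c')) _
    rw [h1, h2, h3, h4]
    abel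

theorem projOneOne_totalD (θ : C.inv) :
    projOneOne 𝒢 (C.totalD (C.coprod₁ (θ : 𝒢 1))) =
      -LinearMap.rTensor Γ C.invIncl (LinearMap.lTensor C.inv (C.d ∘ₗ C.ι.toLinearMap)
        (C.ad θ)) := by
  rw [coprod₁_inv, map_add, map_add, C.totalD_tmul_of_mem one_mem_zero, d_one C.toDiffStar,
    TensorProduct.zero_tmul, zero_add, pow_zero, one_smul,
    projOneOne_of_mem_ne zero_ne_one one_mem_zero, zero_add]
  generalize C.ad θ = t
  induction t with
  | zero => simp
  | add x y hx hy => simp only [map_add, hx, hy, neg_add]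
  | tmul c e =>
    rw [TensorProduct.map_tmul, C.totalD_tmul_of_mem (C.invIncl_mem c), map_add, map_smul,
      projOneOne_of_mem_ne (by decide) (C.d_mem (C.invIncl_mem c)), AlgHom.toLinearMap_apply,
      projOneOne_of_mem (C.invIncl_mem c) (C.d_mem (C.ι_mem e))]
    simp

/-- If `x = ∑ a ⊗ b` is a lift of `dθ` to `inv Γ ⊗ inv Γ`, then
`∑ a⁽⁰⁾ ⊗ a⁽¹⁾ b - ∑ b⁽⁰⁾ ⊗ a b⁽¹⁾ = -∑ θ⁽⁰⁾ ⊗ dθ⁽¹⁾`. Both sides are the component of bidegree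
`(1, 1)` of the coproduct of `dθ`. -/
theorem adMulRight_add (θ : C.inv) (x : C.inv ⊗[ℂ] C.inv)
    (hx : LinearMap.mul' ℂ Γ (TensorProduct.map C.invIncl C.invIncl x) = C.d (C.invIncl θ)) :
    C.adMulRight x + LinearMap.lTensor C.inv (C.d ∘ₗ C.ι.toLinearMap) (C.ad θ) =
      C.adMulLeft x := by
  apply C.rTensor_invIncl_injective Γ
  have h := C.projOneOne_gmul x
  rw [C.gmul_coprod₁_of_lift θ x hx, projOneOne_totalD, neg_eq_iff_add_eq_zero,
    add_sub_assoc', sub_eq_zero, add_comm] at h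
  rw [map_add, h]

end GroupCalculus

section Hor

variable {G : Type*} [Ring G] [StarRing G] [HopfAlgebra ℂ G] [StarModule ℂ G]
variable {P : Type*} [Ring P] [StarRing P] [Algebra ℂ P] [StarModule ℂ P]
variable {Γ : Type*} [Ring Γ] [Algebra ℂ Γ] {𝒢 : ℕ → Submodule ℂ Γ} [GradedAlgebra 𝒢]
variable {Ω : Type*} [Ring Ω] [Algebra ℂ Ω] {𝒜 : ℕ → Submodule ℂ Ω} [GradedAlgebra 𝒜]
variable {B : QuantumBundle G P} {C : GroupCalculus G 𝒢}

open Coalgebra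

/-! ### Intertwiners with values in horizontal forms -/

theorem isUnitaryCorep_adMatrix {m : ℕ} (e : Module.Basis (Fin m) ℂ C.inv)
    (hl : (adMatrix C e).conjTranspose * adMatrix C e = 1)
    (hr : adMatrix C e * (adMatrix C e).conjTranspose = 1) : IsUnitaryCorep (adMatrix C e) where
  comul i j := by
    have h := C.ad_coassoc (e j)
    rw [ad_basis] at h
    simp only [map_sum, LinearMap.rTensor_tmul, ad_basis, TensorProduct.sum_tmul,
      TensorProduct.assoc_tmul, LinearMap.lTensor_tmul] at h
    have h2 := congrArg (fun x => TensorProduct.lid ℂ (G ⊗[ℂ] G)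
      (LinearMap.rTensor (G ⊗[ℂ] G) (e.coord i) x)) h
    simp only [map_sum, LinearMap.rTensor_tmul, TensorProduct.lid_tmul, Module.Basis.coord_apply,
      Module.Basis.repr_self, Finsupp.single_apply, ite_smul, one_smul, zero_smul,
      Finset.sum_ite_eq', Finset.mem_univ, if_true] at h2
    exact h2.symm
  counit i j := by
    have h := C.ad_counit (e j)
    rw [ad_basis] at h
    simp only [map_sum, LinearMap.lTensor_tmul, TensorProduct.rid_tmul] at h
    have h2 := congrArg (e.coord i) h
    simpa [Finsupp.single_apply, eq_comm] using h2
  left i j := by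
    have := congrFun (congrFun hl i) j
    rw [Matrix.mul_apply, Matrix.one_apply] at this
    simpa only [Matrix.conjTranspose_apply] using this
  right i j := by
    have := congrFun (congrFun hr i) j
    rw [Matrix.mul_apply, Matrix.one_apply] at this
    simpa only [Matrix.conjTranspose_apply] using this

namespace BundleCalculus

variable (X : BundleCalculus 𝒜 B C)

theorem psi_mul (a b : Ω) : X.psi (a * b) = gmul 𝒜 𝒢 (X.psi a) (X.psi b) := by
  rw [gmul_apply]
  change (GradedTensorProduct.of ℂ 𝒜 𝒢).symm (X.Ψ (a * b)) = _
  rw [map_mul]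
  rfl

theorem psi_ιP (x : P) :
    X.psi (X.ιP x) = TensorProduct.map X.ιP.toLinearMap C.ι.toLinearMap (B.Φ x) :=
  congrArg (GradedTensorProduct.of ℂ 𝒜 𝒢).symm (X.Ψ_ιP x)

theorem psi_d (φ : Ω) : X.psi (X.d φ) = TensorProduct.map X.d LinearMap.id (X.psi φ) +
    TensorProduct.map (degSign 𝒜) C.d (X.psi φ) := X.Ψ_d φ

theorem psi_cj (φ : Ω) : X.psi (X.cj φ) = TensorProduct.map X.cj C.cj (X.psi φ) := X.Ψ_cj φ

theorem ιP_mem (x : P) : X.ιP x ∈ 𝒜 0 := by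
  rw [← X.ιP_range]; exact ⟨x, rfl⟩

theorem projG_ι (g : G) : projG C (C.ι g) = g := by
  have h : GradedAlgebra.proj 𝒢 0 (C.ι g) = C.ι g :=
    DirectSum.decompose_of_mem_same 𝒢 (C.ι_mem g)
  simp only [projG, LinearMap.comp_apply, LinearEquiv.coe_coe]
  rw [LinearEquiv.symm_apply_eq]
  ext
  exact h

theorem psi_mul_left {μ : Ω} (hμ : μ ∈ X.baseForms) (a : Ω) :
    X.psi (μ * a) = LinearMap.rTensor Γ (LinearMap.mulLeft ℂ μ) (X.psi a) := by
  have h : X.psi μ = μ ⊗ₜ 1 := hμ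
  rw [psi_mul, h]
  generalize X.psi a = t
  induction t with
  | zero => simp
  | add x y hx hy => simp only [map_add, hx, hy]
  | tmul c e => simp [gmul_tmul_of_mem_zero 𝒜 𝒢 _ (GroupCalculus.one_mem_zero (𝒢 := 𝒢))]

theorem coactΩ_mul_left {μ : Ω} (hμ : μ ∈ X.baseForms) (a : Ω) :
    X.coactΩ (μ * a) = LinearMap.rTensor G (LinearMap.mulLeft ℂ μ) (X.coactΩ a) := by
  simp only [coactΩ, LinearMap.comp_apply, X.psi_mul_left hμ]
  generalize X.psi a = t
  induction t with
  | zero => simp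
  | add x y hx hy => simp only [map_add, hx, hy]
  | tmul c e => simp

/-- The space `Mor(ad, Hor)` of intertwiners from `ad` to the horizontal forms. -/
def MorHor : Submodule ℂ (C.inv →ₗ[ℂ] Ω) where
  carrier := {τ | ∀ θ, X.psi (τ θ) = TensorProduct.map τ C.ι.toLinearMap (C.ad θ)}
  zero_mem' θ := by simp
  add_mem' {S T} hS hT θ := by
    rw [LinearMap.add_apply, map_add, hS, hT, TensorProduct.map_add_left, LinearMap.add_apply]
  smul_mem' c T hT θ := by
    rw [LinearMap.smul_apply, map_smul, hT, TensorProduct.map_smul_left, LinearMap.smul_apply]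

variable {X}

theorem mem_MorHor_iff_basis {m : ℕ} (e : Module.Basis (Fin m) ℂ C.inv)
    {τ : C.inv →ₗ[ℂ] Ω} : τ ∈ X.MorHor ↔
      ∀ i, X.psi (τ (e i)) = ∑ j, τ (e j) ⊗ₜ C.ι (adMatrix C e j i) := by
  have h : ∀ i, TensorProduct.map τ C.ι.toLinearMap (C.ad (e i)) =
      ∑ j, τ (e j) ⊗ₜ C.ι (adMatrix C e j i) := by
    intro i
    rw [ad_basis]
    simp
  constructor
  · intro hτ i
    rw [hτ, h]
  · intro hτ θ
    have : X.psi ∘ₗ τ = TensorProduct.map τ C.ι.toLinearMap ∘ₗ C.ad := by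
      refine e.ext fun i => ?_
      rw [LinearMap.comp_apply, LinearMap.comp_apply, hτ, h]
    exact LinearMap.congr_fun this θ

variable (X)

theorem ιP_comp_mem (T : MorP B C) : X.ιP.toLinearMap ∘ₗ T.1 ∈ X.MorHor := by
  intro θ
  rw [LinearMap.comp_apply, AlgHom.toLinearMap_apply, psi_ιP, T.2 θ]
  generalize C.ad θ = t
  induction t with
  | zero => simp
  | add x y hx hy => simp only [map_add, hx, hy]
  | tmul c e => simp

variable {X}

theorem mulLeft_comp_mem {τ : C.inv →ₗ[ℂ] Ω} (hτ : τ ∈ X.MorHor) {μ : Ω} (hμ : μ ∈ X.baseForms) :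
    LinearMap.mulLeft ℂ μ ∘ₗ τ ∈ X.MorHor := by
  intro θ
  rw [LinearMap.comp_apply, LinearMap.mulLeft_apply, X.psi_mul_left hμ, hτ θ]
  generalize C.ad θ = t
  induction t with
  | zero => simp
  | add x y hx hy => simp only [map_add, hx, hy]
  | tmul c e => simp

theorem mulRight_comp_mem {τ : C.inv →ₗ[ℂ] Ω} (hτ : τ ∈ X.MorHor) {μ : Ω} (hμ : μ ∈ X.baseForms) :
    LinearMap.mulRight ℂ μ ∘ₗ τ ∈ X.MorHor := by
  intro θ
  have h : X.psi μ = μ ⊗ₜ 1 := hμ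
  rw [LinearMap.comp_apply, LinearMap.mulRight_apply, psi_mul, h, hτ θ]
  generalize C.ad θ = t
  induction t with
  | zero => simp
  | add x y hx hy => simp only [map_add, LinearMap.add_apply, hx, hy]
  | tmul c e => simp [gmul_tmul_of_mem_zero 𝒜 𝒢 _ (C.ι_mem e)]

theorem hat_apply (τ : C.inv →ₗ[ℂ] Ω) (θ : C.inv) : hat X τ θ = X.cj (τ (C.invCj θ)) := rfl

theorem invCj_invCj (θ : C.inv) : C.invCj (C.invCj θ) = θ := by
  ext; exact C.cj_cj _

theorem hat_hat (τ : C.inv →ₗ[ℂ] Ω) : hat X (hat X τ) = τ := by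
  ext θ
  rw [hat_apply, hat_apply, X.cj_cj, invCj_invCj]

theorem hat_add (τ σ : C.inv →ₗ[ℂ] Ω) : hat X (τ + σ) = hat X τ + hat X σ := by
  ext θ; simp [hat_apply]

theorem hat_smul (c : ℂ) (τ : C.inv →ₗ[ℂ] Ω) :
    hat X (c • τ) = starRingEnd ℂ c • hat X τ := by
  ext θ; simp [hat_apply]

theorem map_hat (τ : C.inv →ₗ[ℂ] Ω) (θ : C.inv) :
    TensorProduct.map X.cj C.cj (TensorProduct.map τ C.ι.toLinearMap (C.ad (C.invCj θ))) =
      TensorProduct.map (hat X τ) C.ι.toLinearMap (C.ad θ) := by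
  rw [C.ad_invCj]
  generalize C.ad θ = t
  induction t with
  | zero => simp
  | add x y hx hy => simp only [map_add, hx, hy]
  | tmul c e => simp [hat_apply, C.ι_star, C.cj_cj]

theorem hat_mem {τ : C.inv →ₗ[ℂ] Ω} (hτ : τ ∈ X.MorHor) : hat X τ ∈ X.MorHor := by
  intro θ
  rw [hat_apply, psi_cj, hτ, map_hat]

theorem isQPC_hat {ω : C.inv →ₗ[ℂ] Ω} (hω : IsQPC X ω) : IsQPC X (hat X ω) := by
  refine ⟨fun θ => X.cj_mem (hω.1 _), fun θ => ?_⟩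
  have h1 : X.cj 1 = 1 := by
    have := X.ιP_star 1
    simpa using this.symm
  rw [hat_apply, psi_cj, hω.2, map_add, map_hat, TensorProduct.map_tmul, h1]
  congr 2
  exact C.cj_cj _

theorem coactΩ_apply {τ : C.inv →ₗ[ℂ] Ω} (hτ : τ ∈ X.MorHor) (θ : C.inv) :
    X.coactΩ (τ θ) = LinearMap.rTensor G τ (C.ad θ) := by
  simp only [coactΩ, LinearMap.comp_apply, hτ θ]
  generalize C.ad θ = t
  induction t with
  | zero => simp
  | add x y hx hy => simp only [map_add, hx, hy]
  | tmul c e => simp [projG_ι]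

/-! ### Covariant derivatives -/

theorem covD_apply_basis {m : ℕ} (e : Module.Basis (Fin m) ℂ C.inv) (ω : C.inv →ₗ[ℂ] Ω)
    {τ : C.inv →ₗ[ℂ] Ω} (hτ : τ ∈ X.MorHor) (i : Fin m) :
    covD X ω (τ (e i)) = X.d (τ (e i)) -
      ∑ j, degSign 𝒜 (τ (e j)) * ω (C.germ (adMatrix C e j i)) := by
  simp only [covD, LinearMap.sub_apply, LinearMap.comp_apply, coactΩ_apply hτ, ad_basis]
  simp

theorem degSign_mul {k : ℕ} {μ : Ω} (hμ : μ ∈ 𝒜 k) (a : Ω) :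
    degSign 𝒜 (μ * a) = ((-1 : ℂ) ^ k) • (μ * degSign 𝒜 a) := by
  induction a using DirectSum.Decomposition.inductionOn 𝒜 with
  | zero => simp
  | homogeneous a =>
    rw [degSign_of_mem 𝒜 (SetLike.mul_mem_graded hμ a.2), degSign_of_mem 𝒜 a.2, pow_add,
      mul_smul_comm, smul_smul]
  | add a b ha hb => rw [mul_add, map_add, map_add, mul_add, ha, hb, smul_add]

theorem covD_mul {k : ℕ} (ω : C.inv →ₗ[ℂ] Ω) {μ : Ω} (hμ : μ ∈ 𝒜 k) (hb : μ ∈ X.baseForms)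
    (a : Ω) : covD X ω (μ * a) = X.d μ * a + ((-1 : ℂ) ^ k) • (μ * covD X ω a) := by
  have h : ∀ t : Ω ⊗[ℂ] G, LinearMap.mul' ℂ Ω (TensorProduct.map (degSign 𝒜) (ω ∘ₗ C.germ)
      (LinearMap.rTensor G (LinearMap.mulLeft ℂ μ) t)) = ((-1 : ℂ) ^ k) •
        (μ * LinearMap.mul' ℂ Ω (TensorProduct.map (degSign 𝒜) (ω ∘ₗ C.germ) t)) := by
    intro t
    induction t with
    | zero => simp
    | add x y hx hy => simp only [map_add, hx, hy, mul_add, smul_add]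
    | tmul c g => simp [degSign_mul hμ, mul_assoc]
  simp only [covD, LinearMap.sub_apply, LinearMap.comp_apply, X.coactΩ_mul_left hb, h,
    X.leibniz hμ, mul_sub, smul_sub]
  abel

/-- The covariant derivative of a section is horizontal and covariant: in `Ψ(D^ω T)`, the terms
`T(eⱼ) ⊗ duⱼᵢ` that come from `dT` cancel those that come from the inhomogeneous part of `Ψ ∘ ω`,
as `du = u π(u)`. -/
theorem covD_ιP_mem {m : ℕ} (e : Module.Basis (Fin m) ℂ C.inv)
    (hu : IsUnitaryCorep (adMatrix C e)) {ω : C.inv →ₗ[ℂ] Ω} (hω : IsQPC X ω) (T : MorP B C) :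
    covD X ω ∘ₗ X.ιP.toLinearMap ∘ₗ T.1 ∈ X.MorHor := by
  set τ := X.ιP.toLinearMap ∘ₗ T.1 with hτdef
  have hτ : τ ∈ X.MorHor := X.ιP_comp_mem T
  have hτ0 : ∀ θ, τ θ ∈ 𝒜 0 := fun θ => X.ιP_mem _
  have hsgn : ∀ θ, degSign 𝒜 (τ θ) = τ θ := fun θ => by
    rw [degSign_of_mem 𝒜 (hτ0 θ)]; simp
  have hψ := (mem_MorHor_iff_basis e).1 hτ
  rw [mem_MorHor_iff_basis e]
  intro i
  simp only [LinearMap.comp_apply, covD_apply_basis e ω hτ, hsgn]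
  have h1 : X.psi (X.d (τ (e i))) = ∑ j, X.d (τ (e j)) ⊗ₜ C.ι (adMatrix C e j i) +
      ∑ j, τ (e j) ⊗ₜ C.d (C.ι (adMatrix C e j i)) := by
    rw [psi_d, hψ]
    simp [hsgn]
  have h2 : ∀ (a : Ω) (g : G) (t : C.inv ⊗[ℂ] G), gmul 𝒜 𝒢 (a ⊗ₜ C.ι g)
      (TensorProduct.map ω C.ι.toLinearMap t) =
      TensorProduct.map (LinearMap.mulLeft ℂ a ∘ₗ ω) C.ι.toLinearMap
        (LinearMap.lTensor C.inv (LinearMap.mulLeft ℂ g) t) := by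
    intro a g t
    induction t with
    | zero => simp
    | add x y hx hy => simp only [map_add, hx, hy]
    | tmul c e => simp [gmul_tmul_of_mem_zero 𝒜 𝒢 _ (C.ι_mem g)]
  have h3 : ∀ (a : Ω) (g : G) (θ : C.inv), gmul 𝒜 𝒢 (a ⊗ₜ C.ι g) (1 ⊗ₜ ((θ : 𝒢 1) : Γ)) =
      a ⊗ₜ (C.ι g * θ) := by
    intro a g θ
    rw [gmul_tmul_of_mem_zero 𝒜 𝒢 _ (C.ι_mem g), mul_one]
  have h4 : X.psi (∑ j, τ (e j) * ω (C.germ (adMatrix C e j i))) =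
      ∑ l, (∑ j, (τ (e l) * ω (C.germ (adMatrix C e l j))) ⊗ₜ C.ι (adMatrix C e j i)) +
        ∑ l, τ (e l) ⊗ₜ C.d (C.ι (adMatrix C e l i)) := by
    simp only [map_sum, psi_mul, hψ, hω.2, map_add, LinearMap.sum_apply, h2, h3]
    rw [Finset.sum_add_distrib]
    congr 1
    · rw [Finset.sum_comm]
      refine Finset.sum_congr rfl fun l _ => ?_
      rw [← map_sum, hu.mul_ad_germ C]
      simp
    · rw [Finset.sum_comm]
      refine Finset.sum_congr rfl fun l _ => ?_
      rw [← TensorProduct.tmul_sum]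
      congr 1
      have := congrArg Subtype.val (hu.d₁_eq C l i)
      rw [AddSubmonoidClass.coe_finsetSum] at this
      exact this.symm
  rw [map_sub, h1, h4, Finset.sum_comm]
  simp only [TensorProduct.sub_tmul, TensorProduct.sum_tmul, Finset.sum_sub_distrib]
  abel

/-! ### Brackets and the curvature -/

/-- Linear maps `τ : inv Γ → Ω¹(GM)` with `Ψ(τ(θ)) = (τ ⊗ id) ad(θ) + c 1 ⊗ θ`: the quantum
principal connections for `c = 1`, the displacements for `c = 0`. -/
def HasCharge (X : BundleCalculus 𝒜 B C) (c : ℂ) (τ : C.inv →ₗ[ℂ] Ω) : Prop :=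
  (∀ θ, τ θ ∈ 𝒜 1) ∧ ∀ θ, X.psi (τ θ) = TensorProduct.map τ C.ι.toLinearMap (C.ad θ) +
    c • (1 ⊗ₜ C.invIncl θ)

theorem _root_.QYM.IsQPC.hasCharge {ω : C.inv →ₗ[ℂ] Ω} (hω : IsQPC X ω) : HasCharge X 1 ω :=
  ⟨hω.1, fun θ => by rw [one_smul]; exact hω.2 θ⟩

theorem _root_.QYM.IsDisplacement.hasCharge {lam : C.inv →ₗ[ℂ] Ω} (hl : IsDisplacement X lam) :
    HasCharge X 0 lam :=
  ⟨hl.1, fun θ => by rw [zero_smul, add_zero]; exact hl.2 θ⟩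

/-- The corepresentation `ad ⊗ ad`. -/
noncomputable def adTwo (C : GroupCalculus G 𝒢) :
    C.inv ⊗[ℂ] C.inv →ₗ[ℂ] (C.inv ⊗[ℂ] C.inv) ⊗[ℂ] G :=
  LinearMap.lTensor (C.inv ⊗[ℂ] C.inv) (LinearMap.mul' ℂ G) ∘ₗ
    (TensorProduct.tensorTensorTensorComm ℂ C.inv G C.inv G).toLinearMap ∘ₗ
      TensorProduct.map C.ad C.ad

/-- The terms of `Ψ(m(τ ⊗ σ)(x))` of bidegrees `(2, 0)`, `(1, 1)` and `(0, 2)`. -/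
theorem psi_mul_of_hasCharge {c c' : ℂ} {τ σ : C.inv →ₗ[ℂ] Ω} (hτ : HasCharge X c τ)
    (hσ : HasCharge X c' σ) (x : C.inv ⊗[ℂ] C.inv) :
    X.psi (LinearMap.mul' ℂ Ω (TensorProduct.map τ σ x)) =
      TensorProduct.map (LinearMap.mul' ℂ Ω ∘ₗ TensorProduct.map τ σ) C.ι.toLinearMap (adTwo C x) +
      c' • LinearMap.rTensor Γ τ (C.adMulRight x) - c • LinearMap.rTensor Γ σ (C.adMulLeft x) +
      (c * c') • (1 ⊗ₜ LinearMap.mul' ℂ Γ (TensorProduct.map C.invIncl C.invIncl x)) := by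
  induction x with
  | zero => simp
  | add x y hx hy =>
    simp only [map_add, hx, hy, TensorProduct.tmul_add, smul_add]
    abel
  | tmul a b =>
    have h1 : ∀ s t : C.inv ⊗[ℂ] G, gmul 𝒜 𝒢 (TensorProduct.map τ C.ι.toLinearMap s)
        (TensorProduct.map σ C.ι.toLinearMap t) =
        TensorProduct.map (LinearMap.mul' ℂ Ω ∘ₗ TensorProduct.map τ σ) C.ι.toLinearMap
          (LinearMap.lTensor (C.inv ⊗[ℂ] C.inv) (LinearMap.mul' ℂ G)
            (TensorProduct.tensorTensorTensorComm ℂ C.inv G C.inv G (s ⊗ₜ t))) := by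
      intro s t
      induction s with
      | zero => simp
      | add x y hx hy => simp only [map_add, TensorProduct.add_tmul, LinearMap.add_apply, hx, hy]
      | tmul c e =>
        induction t with
        | zero => simp
        | add x y hx hy => simp only [map_add, TensorProduct.tmul_add, hx, hy]
        | tmul c' e' => simp [gmul_tmul_of_mem_zero 𝒜 𝒢 _ (C.ι_mem e)]
    have h2 : ∀ s : C.inv ⊗[ℂ] G, gmul 𝒜 𝒢 (TensorProduct.map τ C.ι.toLinearMap s)
        (1 ⊗ₜ C.invIncl b) = LinearMap.rTensor Γ τ (LinearMap.lTensor C.inv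
          (LinearMap.mulRight ℂ (C.invIncl b)) (LinearMap.lTensor C.inv C.ι.toLinearMap s)) := by
      intro s
      induction s with
      | zero => simp
      | add x y hx hy => simp only [map_add, LinearMap.add_apply, hx, hy]
      | tmul c e => simp [gmul_tmul_of_mem_zero 𝒜 𝒢 _ (C.ι_mem e)]
    have h3 : ∀ t : C.inv ⊗[ℂ] G, gmul 𝒜 𝒢 (1 ⊗ₜ C.invIncl a)
        (TensorProduct.map σ C.ι.toLinearMap t) = -LinearMap.rTensor Γ σ (LinearMap.lTensor C.inv
          (LinearMap.mulLeft ℂ (C.invIncl a)) (LinearMap.lTensor C.inv C.ι.toLinearMap t)) := by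
      intro t
      induction t with
      | zero => simp
      | add x y hx hy => simp only [map_add, hx, hy, neg_add]
      | tmul c e => simp [gmul_tmul_of_mem_one 𝒜 𝒢 _ (C.invIncl_mem a) (hσ.1 c)]
    have h4 : gmul 𝒜 𝒢 (1 ⊗ₜ C.invIncl a) (1 ⊗ₜ C.invIncl b) =
        1 ⊗ₜ (C.invIncl a * C.invIncl b) := by
      rw [gmul_tmul_of_mem_zero' 𝒜 𝒢 _ _ (SetLike.GradedOne.one_mem (A := 𝒜)), one_mul]
    simp only [TensorProduct.map_tmul, LinearMap.mul'_apply, psi_mul, hτ.2, hσ.2, map_add,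
      LinearMap.add_apply, map_smul, LinearMap.smul_apply, h1, h2, h3, h4,
      GroupCalculus.adMulRight_tmul, GroupCalculus.adMulLeft_tmul, GroupCalculus.adΓ,
      LinearMap.comp_apply, adTwo, LinearEquiv.coe_coe, smul_neg, smul_add, mul_comm c c', mul_smul]
    abel

theorem adTwo_δ {δ : C.inv →ₗ[ℂ] C.inv ⊗[ℂ] C.inv} (hδ : IsEmbeddedDifferential C δ)
    (f : C.inv ⊗[ℂ] C.inv →ₗ[ℂ] Ω) (θ : C.inv) :
    TensorProduct.map f C.ι.toLinearMap (adTwo C (δ θ)) =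
      TensorProduct.map (f ∘ₗ δ) C.ι.toLinearMap (C.ad θ) := by
  have := hδ.covariant θ
  change _ = adTwo C (δ θ) at this
  rw [← this]
  generalize C.ad θ = t
  induction t with
  | zero => simp
  | add x y hx hy => simp only [map_add, hx, hy]
  | tmul c e => simp

theorem bracket_mem {δ : C.inv →ₗ[ℂ] C.inv ⊗[ℂ] C.inv} (hδ : IsEmbeddedDifferential C δ)
    {τ σ : C.inv →ₗ[ℂ] Ω} (hτ : IsDisplacement X τ) (hσ : IsDisplacement X σ) :
    bracket δ τ σ ∈ X.MorHor := by
  intro θ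
  refine (psi_mul_of_hasCharge hτ.hasCharge hσ.hasCharge (δ θ)).trans ?_
  simp only [zero_smul, add_zero, sub_zero, mul_zero, adTwo_δ hδ]
  rfl

/-- The curvature of a quantum principal connection is horizontal and covariant. The terms of
`Ψ(dω(θ))` and `Ψ(⟨ω, ω⟩(θ))` that are not horizontal cancel by the compatibility of `δ` with the
coproduct of `Γ^∧`. -/
theorem curvature_mem {δ : C.inv →ₗ[ℂ] C.inv ⊗[ℂ] C.inv} (hδ : IsEmbeddedDifferential C δ)
    {ω : C.inv →ₗ[ℂ] Ω} (hω : IsQPC X ω) : curvature X δ ω ∈ X.MorHor := by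
  intro θ
  have h1 : X.psi (bracket δ ω ω θ) = _ :=
    psi_mul_of_hasCharge hω.hasCharge hω.hasCharge (δ θ)
  have hl : LinearMap.mul' ℂ Γ (TensorProduct.map C.invIncl C.invIncl (δ θ)) =
      C.d (C.invIncl θ) := hδ.lift θ
  have h2 := congrArg (LinearMap.rTensor Γ ω) (C.adMulRight_add θ (δ θ) hl)
  rw [map_add] at h2
  have h3 : ∀ t : C.inv ⊗[ℂ] G, TensorProduct.map (degSign 𝒜) C.d
      (TensorProduct.map ω C.ι.toLinearMap t) =
      -LinearMap.rTensor Γ ω (LinearMap.lTensor C.inv (C.d ∘ₗ C.ι.toLinearMap) t) := by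
    intro t
    induction t with
    | zero => simp
    | add x y hx hy => simp only [map_add, hx, hy, neg_add]
    | tmul c e => simp [degSign_of_mem 𝒜 (hω.1 c), TensorProduct.neg_tmul]
  have h4 : ∀ t : C.inv ⊗[ℂ] G, TensorProduct.map X.d LinearMap.id
      (TensorProduct.map ω C.ι.toLinearMap t) =
      TensorProduct.map (X.d ∘ₗ ω) C.ι.toLinearMap t := by
    intro t
    induction t with
    | zero => simp
    | add x y hx hy => simp only [map_add, hx, hy]
    | tmul c e => simp
  have h5 : degSign 𝒜 (1 : Ω) = 1 := by
    rw [degSign_of_mem 𝒜 (SetLike.GradedOne.one_mem (A := 𝒜))]; simp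
  rw [hl, adTwo_δ hδ, ← h2, one_smul, one_smul, one_mul, one_smul] at h1
  have h6 : X.psi (X.d (ω θ)) = TensorProduct.map (X.d ∘ₗ ω) C.ι.toLinearMap (C.ad θ) -
      LinearMap.rTensor Γ ω (LinearMap.lTensor C.inv (C.d ∘ₗ C.ι.toLinearMap) (C.ad θ)) +
      1 ⊗ₜ C.d (C.invIncl θ) := by
    rw [psi_d, hω.2, map_add, map_add, h3, h4, TensorProduct.map_tmul, TensorProduct.map_tmul,
      d_one X.toDiffStar, h5, TensorProduct.zero_tmul]
    change _ + (_ + 1 ⊗ₜ C.d (C.invIncl θ)) = _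
    abel
  rw [curvature, LinearMap.sub_apply, LinearMap.comp_apply, map_sub, h1, h6,
    sub_eq_add_neg (X.d ∘ₗ ω), TensorProduct.map_add_left, LinearMap.add_apply]
  have h7 : TensorProduct.map (-bracket δ ω ω) C.ι.toLinearMap (C.ad θ) =
      -TensorProduct.map (bracket δ ω ω) C.ι.toLinearMap (C.ad θ) := by
    rw [← neg_one_smul ℂ (bracket δ ω ω), TensorProduct.map_smul_left, LinearMap.smul_apply,
      neg_one_smul]
  rw [h7]
  change _ - (TensorProduct.map (bracket δ ω ω) C.ι.toLinearMap (C.ad θ) + _ - _ + _) = _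
  abel

end BundleCalculus

end Hor

section Components

variable {G : Type*} [Ring G] [StarRing G] [HopfAlgebra ℂ G] [StarModule ℂ G]
variable {P : Type*} [Ring P] [StarRing P] [Algebra ℂ P] [StarModule ℂ P]
variable {Γ : Type*} [Ring Γ] [Algebra ℂ Γ] {𝒢 : ℕ → Submodule ℂ Γ} [GradedAlgebra 𝒢]
variable {Ω : Type*} [Ring Ω] [Algebra ℂ Ω] {𝒜 : ℕ → Submodule ℂ Ω} [GradedAlgebra 𝒜]
variable {B : QuantumBundle G P} {C : GroupCalculus G 𝒢}

open Coalgebra BundleCalculus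
open scoped ComplexOrder

/-! ### The conjugate of the adjoint corepresentation -/

namespace AdFrame

variable (F : AdFrame B C)

theorem isUnitaryCorep : IsUnitaryCorep (adMatrix C F.e) :=
  isUnitaryCorep_adMatrix F.e F.unitary_left F.unitary_right

theorem Φ_apply (T : MorP B C) (k : Fin F.m) :
    B.Φ (T.1 (F.e k)) = ∑ j, T.1 (F.e j) ⊗ₜ adMatrix C F.e j k := by
  rw [T.2, ad_basis, map_sum]
  simp

theorem sum_star_T_mul_T (i j : Fin F.m) :
    ∑ k, star ((F.T k).1 (F.e i)) * (F.T k).1 (F.e j) = if i = j then 1 else 0 := by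
  have := congrFun (congrFun F.left_frame i) j
  rw [Matrix.mul_apply, Matrix.one_apply] at this
  exact this

/-- The matrix `W = Z X (K⁻¹)*`, which is the right frame dual to `X`. -/
noncomputable def W : Matrix (Fin F.r) (Fin F.m) P :=
  F.Z.map (algebraMap ℂ P) * (Matrix.of fun k i => (F.T k).1 (F.e i)) *
    (F.K⁻¹.conjTranspose).map (algebraMap ℂ P)

theorem sum_W_mul_star_T (i j : Fin F.m) :
    ∑ k, F.W k i * star ((F.T k).1 (F.e j)) = if i = j then 1 else 0 := by
  have := congrFun (congrFun F.right_frame i) j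
  rw [Matrix.mul_apply, Matrix.one_apply] at this
  exact this

theorem sum_T_mul_star_W (i j : Fin F.m) :
    ∑ k, (F.T k).1 (F.e i) * star (F.W k j) = if i = j then 1 else 0 := by
  have := congrArg star (F.sum_W_mul_star_T j i)
  rw [star_sum] at this
  simp only [star_mul, star_star] at this
  rw [this, apply_ite star, star_one, star_zero]
  simp only [eq_comm]

/-- A left-invertible matrix `R` over `P` is left cancellable over `P ⊗ G`. -/
theorem eq_of_sum_mul_eq {m r : ℕ} (L R : Fin r → Fin m → P)
    (h : ∀ i j, ∑ k, L k i * R k j = if i = j then 1 else 0) {x y : Fin m → P ⊗[ℂ] G}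
    (hxy : ∀ k, ∑ a, (R k a ⊗ₜ[ℂ] (1 : G)) * x a = ∑ a, (R k a ⊗ₜ[ℂ] (1 : G)) * y a) : x = y := by
  have key : ∀ (x : Fin m → P ⊗[ℂ] G) i,
      ∑ k, (L k i ⊗ₜ[ℂ] (1 : G)) * ∑ a, (R k a ⊗ₜ[ℂ] (1 : G)) * x a = x i := by
    intro x i
    simp only [Finset.mul_sum, ← mul_assoc, Algebra.TensorProduct.tmul_mul_tmul, mul_one]
    rw [Finset.sum_comm]
    simp only [← Finset.sum_mul, ← TensorProduct.sum_tmul, h]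
    rw [Finset.sum_eq_single i (by intro a _ ha; simp [Ne.symm ha]) (by simp), if_pos rfl,
      ← Algebra.TensorProduct.one_def, one_mul]
  ext1 i
  rw [← key x, ← key y]
  simp only [hxy]

/-- Since the right hermitian structure takes its values in `M`, the conjugate of the adjoint
corepresentation is unitary: covariance of `∑ₖ T(eₖ)* T'(eₖ)` for all `T`, `T'` in the two frames
gives `∑ₖ uᵢₖ* uⱼₖ = δᵢⱼ`. -/
theorem sum_star_mul_adMatrix [Nontrivial P] (i j : Fin F.m) :
    ∑ k, star (adMatrix C F.e i k) * adMatrix C F.e j k = if i = j then 1 else 0 := by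
  let N : Fin F.m → Fin F.m → G := fun i j => ∑ k, star (adMatrix C F.e i k) * adMatrix C F.e j k
  have h1 : ∀ k l, ∑ a, (star ((F.T k).1 (F.e a)) ⊗ₜ[ℂ] (1 : G)) *
      (∑ j, (F.T l).1 (F.e j) ⊗ₜ[ℂ] N a j) =
      ∑ a, (star ((F.T k).1 (F.e a)) ⊗ₜ[ℂ] (1 : G)) * ((F.T l).1 (F.e a) ⊗ₜ 1) := by
    intro k l
    have h := F.right_mem (F.T k) (F.T l)
    change B.Φ _ = _ ⊗ₜ 1 at h
    rw [map_sum, TensorProduct.sum_tmul] at h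
    simp only [Algebra.TensorProduct.tmul_mul_tmul, mul_one]
    rw [← h]
    simp only [N, map_mul, map_star, F.Φ_apply, star_sum, TensorProduct.star_tmul,
      Finset.sum_mul, Finset.mul_sum, Algebra.TensorProduct.tmul_mul_tmul,
      TensorProduct.tmul_sum, one_mul]
    rw [Finset.sum_comm]
    conv_rhs => rw [Finset.sum_comm]
    refine Finset.sum_congr rfl fun b _ => ?_
    rw [Finset.sum_comm]
  have h2 : ∀ l, (fun a => ∑ j, (F.T l).1 (F.e j) ⊗ₜ[ℂ] N a j) =
      fun a => (F.T l).1 (F.e a) ⊗ₜ 1 :=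
    fun l => eq_of_sum_mul_eq F.W (fun k a => star ((F.T k).1 (F.e a))) F.sum_W_mul_star_T
      fun k => h1 k l
  have h3 : (fun j => (1 : P) ⊗ₜ[ℂ] N i j) = fun j => 1 ⊗ₜ (if i = j then 1 else 0) := by
    refine eq_of_sum_mul_eq (fun l a => star ((F.T l).1 (F.e a))) (fun l a => (F.T l).1 (F.e a))
      F.sum_star_T_mul_T fun l => ?_
    have := congrFun (h2 l) i
    simp only [Algebra.TensorProduct.tmul_mul_tmul, mul_one, one_mul]
    rw [this, Finset.sum_eq_single i (by intro a _ ha; simp [Ne.symm ha]) (by simp), if_pos rfl]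
  have h5 := congrFun h3 j
  have hinj : Function.Injective (TensorProduct.mk ℂ P G 1) := by
    have h6 : Function.Injective (LinearMap.rTensor G (LinearMap.toSpanSingleton ℂ P 1)) :=
      Module.Flat.rTensor_preserves_injective_linearMap _ (by
        intro a b hab
        simpa using hab)
    intro a b hab
    have := @h6 (1 ⊗ₜ a) (1 ⊗ₜ b) (by simpa using hab)
    simpa using congrArg (TensorProduct.lid ℂ G) this
  exact hinj h5

theorem isUnitaryCorep_conj [Nontrivial P] : IsUnitaryCorep ((adMatrix C F.e).map star) :=
  IsUnitaryCorep.of_mul_star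
    (fun i j => by
      rw [Matrix.map_apply, C.cmqg.comul_star, F.isUnitaryCorep.comul, star_sum]
      simp)
    (fun i j => by
      rw [Matrix.map_apply, C.cmqg.counit_star, F.isUnitaryCorep.counit]
      split_ifs <;> simp)
    (fun i j => by
      simp only [Matrix.map_apply, star_star]
      exact F.sum_star_mul_adMatrix i j)

/-- The square of the antipode is trivial on the coefficients of `ad`. -/
theorem antipode_antipode_adMatrix [Nontrivial P] (i j : Fin F.m) :
    HopfAlgebra.antipode ℂ (HopfAlgebra.antipode ℂ (adMatrix C F.e i j)) = adMatrix C F.e i j := by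
  rw [F.isUnitaryCorep.antipode]
  have := F.isUnitaryCorep_conj.antipode j i
  simpa using this

theorem K_inv_mul_K : F.K⁻¹ * F.K = 1 :=
  Matrix.nonsing_inv_mul _ ((Matrix.isUnit_iff_isUnit_det _).1 F.K_pos.isUnit)

theorem K_mul_K_inv : F.K * F.K⁻¹ = 1 :=
  Matrix.mul_nonsing_inv _ ((Matrix.isUnit_iff_isUnit_det _).1 F.K_pos.isUnit)

/-- The endomorphism of `inv Γ` with matrix `K⁻¹`. -/
noncomputable def kInv : C.inv →ₗ[ℂ] C.inv := Matrix.toLin F.e F.e F.K⁻¹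

theorem kInv_e (i : Fin F.m) : F.kInv (F.e i) = ∑ j, F.K⁻¹ j i • F.e j :=
  Matrix.toLin_self _ _ _ _

/-- As the square of the antipode is trivial on the coefficients of `ad`, the matrix `K`, and so
`K⁻¹`, intertwines `ad` with itself. -/
theorem ad_kInv [Nontrivial P] (θ : C.inv) :
    C.ad (F.kInv θ) = LinearMap.rTensor G F.kInv (C.ad θ) := by
  set u := adMatrix C F.e with hu
  have h1 : F.K.map (algebraMap ℂ G) * u = u * F.K.map (algebraMap ℂ G) := by
    have := F.K_intertwines
    rwa [show (adMatrix C F.e).map (fun g => HopfAlgebra.antipode ℂ (HopfAlgebra.antipode ℂ g)) =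
      adMatrix C F.e from by ext i j; exact F.antipode_antipode_adMatrix i j] at this
  have h2 : F.K⁻¹.map (algebraMap ℂ G) * F.K.map (algebraMap ℂ G) = 1 := by
    rw [← Matrix.map_mul, F.K_inv_mul_K]; simp
  have h3 : F.K.map (algebraMap ℂ G) * F.K⁻¹.map (algebraMap ℂ G) = 1 := by
    rw [← Matrix.map_mul, F.K_mul_K_inv]; simp
  have h4 : u * F.K⁻¹.map (algebraMap ℂ G) = F.K⁻¹.map (algebraMap ℂ G) * u := by
    calc u * F.K⁻¹.map (algebraMap ℂ G)
        = F.K⁻¹.map (algebraMap ℂ G) * (F.K.map (algebraMap ℂ G) * u) *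
          F.K⁻¹.map (algebraMap ℂ G) := by rw [← mul_assoc, h2, one_mul]
      _ = F.K⁻¹.map (algebraMap ℂ G) * u := by rw [h1, mul_assoc, mul_assoc, h3, mul_one]
  have : C.ad ∘ₗ F.kInv = LinearMap.rTensor G F.kInv ∘ₗ C.ad := by
    refine F.e.ext fun i => ?_
    simp only [LinearMap.comp_apply, F.kInv_e, map_sum, map_smul, ad_basis,
      LinearMap.rTensor_tmul, TensorProduct.sum_tmul, Finset.smul_sum, TensorProduct.smul_tmul]
    rw [Finset.sum_comm]
    conv_rhs => rw [Finset.sum_comm]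
    refine Finset.sum_congr rfl fun l _ => ?_
    rw [← TensorProduct.tmul_sum]
    simp only [← TensorProduct.tmul_smul, ← TensorProduct.tmul_sum]
    congr 1
    have := congrFun (congrFun h4 l) i
    simp only [Matrix.mul_apply, Matrix.map_apply] at this
    rw [← Finset.sum_congr rfl fun j _ => (Algebra.smul_def (F.K⁻¹ l j) (u j i))] at this
    rw [← this]
    refine Finset.sum_congr rfl fun j _ => ?_
    rw [Algebra.smul_def, Algebra.commutes]
  exact LinearMap.congr_fun this θ

end AdFrame

end Components

section Components

variable {G : Type*} [Ring G] [StarRing G] [HopfAlgebra ℂ G] [StarModule ℂ G]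
variable {P : Type*} [Ring P] [StarRing P] [Algebra ℂ P] [StarModule ℂ P]
variable {Γ : Type*} [Ring Γ] [Algebra ℂ Γ] {𝒢 : ℕ → Submodule ℂ Γ} [GradedAlgebra 𝒢]
variable {Ω : Type*} [Ring Ω] [Algebra ℂ Ω] {𝒜 : ℕ → Submodule ℂ Ω} [GradedAlgebra 𝒜]
variable {B : QuantumBundle G P} {C : GroupCalculus G 𝒢} {X : BundleCalculus 𝒜 B C}

open Coalgebra BundleCalculus

/-! ### The isomorphisms of bundle-valued forms with intertwiners -/

namespace AdFrame

variable (F : AdFrame B C)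

theorem psi_ιP_star (T : MorP B C) (i : Fin F.m) : X.psi (X.ιP (star (T.1 (F.e i)))) =
    ∑ l, X.ιP (star (T.1 (F.e l))) ⊗ₜ C.ι (star (adMatrix C F.e l i)) := by
  rw [psi_ιP, map_star, F.Φ_apply, star_sum, map_sum]
  simp

theorem sum_mul_star_mem {τ : C.inv →ₗ[ℂ] Ω} (hτ : τ ∈ X.MorHor) (T : MorP B C) :
    ∑ i, τ (F.e i) * X.ιP (star (T.1 (F.e i))) ∈ X.baseForms := by
  rw [mem_baseForms]
  have h : ∀ (a b : Ω) (g g' : G), gmul 𝒜 𝒢 (a ⊗ₜ C.ι g) (b ⊗ₜ C.ι g') =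
      (a * b) ⊗ₜ C.ι (g * g') := by
    intro a b g g'
    rw [gmul_tmul_of_mem_zero 𝒜 𝒢 _ (C.ι_mem g), map_mul]
  simp only [map_sum, psi_mul, (mem_MorHor_iff_basis F.e).1 hτ, F.psi_ιP_star,
    LinearMap.sum_apply, h]
  rw [Finset.sum_comm, TensorProduct.sum_tmul]
  rw [Finset.sum_congr rfl fun l _ => Finset.sum_comm, Finset.sum_comm]
  refine Finset.sum_congr rfl fun j _ => ?_
  simp only [← TensorProduct.tmul_sum, ← map_sum, F.isUnitaryCorep.right]
  rw [Finset.sum_eq_single j (by intro a _ ha; simp [Ne.symm ha]) (by simp), if_pos rfl, map_one]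

theorem sum_star_mul_mem [Nontrivial P] {τ : C.inv →ₗ[ℂ] Ω} (hτ : τ ∈ X.MorHor) (T : MorP B C) :
    ∑ i, X.ιP (star (T.1 (F.e i))) * τ (F.e i) ∈ X.baseForms := by
  rw [mem_baseForms]
  have h : ∀ (a b : Ω) (g g' : G), gmul 𝒜 𝒢 (a ⊗ₜ C.ι g) (b ⊗ₜ C.ι g') =
      (a * b) ⊗ₜ C.ι (g * g') := by
    intro a b g g'
    rw [gmul_tmul_of_mem_zero 𝒜 𝒢 _ (C.ι_mem g), map_mul]
  simp only [map_sum, psi_mul, (mem_MorHor_iff_basis F.e).1 hτ, F.psi_ιP_star,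
    LinearMap.sum_apply, h]
  rw [Finset.sum_comm, TensorProduct.sum_tmul]
  rw [Finset.sum_congr rfl fun l _ => Finset.sum_comm, Finset.sum_comm]
  refine Finset.sum_congr rfl fun j _ => ?_
  simp only [← TensorProduct.tmul_sum, ← map_sum, F.sum_star_mul_adMatrix]
  rw [Finset.sum_eq_single j (by intro a _ ha; simp [Ne.symm ha]) (by simp), if_pos rfl, map_one]

/-- The contraction `τ ↦ ∑ᵢ τ(eᵢ) T(eᵢ)*` of a horizontal intertwiner with a section. -/
noncomputable def contractL (X : BundleCalculus 𝒜 B C) (T : MorP B C) :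
    X.MorHor →ₗ[ℂ] X.baseForms where
  toFun τ := ⟨∑ i, τ.1 (F.e i) * X.ιP (star (T.1 (F.e i))), F.sum_mul_star_mem τ.2 T⟩
  map_add' τ σ := by ext; simp [add_mul, Finset.sum_add_distrib]
  map_smul' c τ := by ext; simp [Finset.smul_sum]

/-- The contraction `τ ↦ ∑ᵢ T(eᵢ)* τ(eᵢ)` of a horizontal intertwiner with a section. -/
noncomputable def contractR [Nontrivial P] (X : BundleCalculus 𝒜 B C) (T : MorP B C) :
    X.MorHor →ₗ[ℂ] X.baseForms where
  toFun τ := ⟨∑ i, X.ιP (star (T.1 (F.e i))) * τ.1 (F.e i), F.sum_star_mul_mem τ.2 T⟩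
  map_add' τ σ := by ext; simp [mul_add, Finset.sum_add_distrib]
  map_smul' c τ := by ext; simp [Finset.smul_sum]

theorem contractL_coe (T : MorP B C) (τ : X.MorHor) : (F.contractL X T τ : Ω) =
    ∑ i, τ.1 (F.e i) * X.ιP (star (T.1 (F.e i))) := rfl

theorem contractR_coe [Nontrivial P] (T : MorP B C) (τ : X.MorHor) : (F.contractR X T τ : Ω) =
    ∑ i, X.ιP (star (T.1 (F.e i))) * τ.1 (F.e i) := rfl

theorem hermL_coe (S T : MorP B C) : (F.hermL S T : P) =
    ∑ i, S.1 (F.e i) * star (T.1 (F.e i)) := rfl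

theorem hermR_coe (S T : MorP B C) : (F.hermR S T : P) =
    ∑ i, star (S.1 (F.e i)) * T.1 (F.e i) := rfl

theorem star_hermL (S T : MorP B C) : star (F.hermL S T) = F.hermL T S := by
  ext
  simp [hermL_coe]

theorem star_hermR (S T : MorP B C) : star (F.hermR S T) = F.hermR T S := by
  ext
  simp [hermR_coe]

end AdFrame

theorem upsInvL_mk (μ : X.baseForms) (T : MorP B C) :
    upsInvL X (Submodule.Quotient.mk (μ ⊗ₜ T)) =
      LinearMap.mulLeft ℂ (μ : Ω) ∘ₗ X.ιP.toLinearMap ∘ₗ T.1 := rfl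

theorem upsInvR_mk (T : MorP B C) (μ : X.baseForms) :
    upsInvR X (Submodule.Quotient.mk (T ⊗ₜ μ)) =
      LinearMap.mulRight ℂ (μ : Ω) ∘ₗ X.ιP.toLinearMap ∘ₗ T.1 := rfl

theorem formsL_induction {p : FormsL X → Prop} (h0 : p 0)
    (hadd : ∀ ψ φ, p ψ → p φ → p (ψ + φ))
    (hmk : ∀ k (μ : X.baseForms) (T : MorP B C), (μ : Ω) ∈ 𝒜 k →
      p (Submodule.Quotient.mk (μ ⊗ₜ T))) (ψ : FormsL X) : p ψ := by
  induction ψ using Submodule.Quotient.induction_on with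
  | H z =>
    induction z with
    | zero => exact h0
    | add x y hx hy => exact hadd _ _ hx hy
    | tmul μ T =>
      refine X.baseForms_induction (p := fun μ => p (Submodule.Quotient.mk (μ ⊗ₜ T))) ?_ ?_ ?_ μ
      · rw [TensorProduct.zero_tmul]; exact h0
      · intro μ ν hμ hν
        rw [TensorProduct.add_tmul]
        exact hadd _ _ hμ hν
      · intro k μ hμ
        exact hmk k μ T hμ

theorem formsR_induction {p : FormsR X → Prop} (h0 : p 0)
    (hadd : ∀ ψ φ, p ψ → p φ → p (ψ + φ))
    (hmk : ∀ k (T : MorP B C) (μ : X.baseForms), (μ : Ω) ∈ 𝒜 k →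
      p (Submodule.Quotient.mk (T ⊗ₜ μ))) (ψ : FormsR X) : p ψ := by
  induction ψ using Submodule.Quotient.induction_on with
  | H z =>
    induction z with
    | zero => exact h0
    | add x y hx hy => exact hadd _ _ hx hy
    | tmul T μ =>
      refine X.baseForms_induction (p := fun μ => p (Submodule.Quotient.mk (T ⊗ₜ μ))) ?_ ?_ ?_ μ
      · rw [TensorProduct.tmul_zero]; exact h0
      · intro μ ν hμ hν
        rw [TensorProduct.tmul_add]
        exact hadd _ _ hμ hν
      · intro k μ hμ
        exact hmk k T μ hμ

theorem upsInvL_mem (ψ : FormsL X) : upsInvL X ψ ∈ X.MorHor := by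
  induction ψ using formsL_induction with
  | h0 => rw [map_zero]; exact zero_mem _
  | hadd ψ φ hψ hφ => rw [map_add]; exact add_mem hψ hφ
  | hmk k μ T hμ => exact mulLeft_comp_mem (X.ιP_comp_mem T) μ.2

theorem upsInvR_mem (ψ : FormsR X) : upsInvR X ψ ∈ X.MorHor := by
  induction ψ using formsR_induction with
  | h0 => rw [map_zero]; exact zero_mem _
  | hadd ψ φ hψ hφ => rw [map_add]; exact add_mem hψ hφ
  | hmk k T μ hμ => exact mulRight_comp_mem (X.ιP_comp_mem T) μ.2

namespace AdFrame

variable (F : AdFrame B C)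

theorem contractL_mulLeft (μ : X.baseForms) (S T : MorP B C)
    (h : LinearMap.mulLeft ℂ (μ : Ω) ∘ₗ X.ιP.toLinearMap ∘ₗ S.1 ∈ X.MorHor) :
    F.contractL X T ⟨_, h⟩ = μ * X.ιM (F.hermL S T) := by
  ext
  simp [contractL_coe, hermL_coe, Finset.mul_sum, mul_assoc]

theorem contractR_mulRight [Nontrivial P] (μ : X.baseForms) (S T : MorP B C)
    (h : LinearMap.mulRight ℂ (μ : Ω) ∘ₗ X.ιP.toLinearMap ∘ₗ S.1 ∈ X.MorHor) :
    F.contractR X T ⟨_, h⟩ = X.ιM (F.hermR T S) * μ := by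
  ext
  simp [contractR_coe, hermR_coe, Finset.sum_mul, mul_assoc]

theorem sum_hermL_lsmul (S : MorP B C) : ∑ k, lsmul (F.hermL S (F.T k)) (F.T k) = S := by
  ext θ
  have : (∑ k, lsmul (F.hermL S (F.T k)) (F.T k)).1 = S.1 := by
    refine F.e.ext fun j => ?_
    rw [AddSubmonoidClass.coe_finsetSum, LinearMap.sum_apply]
    simp only [lsmul, LinearMap.comp_apply, LinearMap.mulLeft_apply, hermL_coe, Finset.sum_mul,
      mul_assoc]
    rw [Finset.sum_comm]
    simp only [← Finset.mul_sum, F.sum_star_T_mul_T]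
    simp
  rw [this]

/-- `Υ` in components: `τ ↦ ∑ₖ (∑ᵢ τ(eᵢ) Tₖ(eᵢ)*) ⊗ Tₖ`. -/
noncomputable def equivL (X : BundleCalculus 𝒜 B C) : FormsL X ≃ₗ[ℂ] X.MorHor where
  toLinearMap := (upsInvL X).codRestrict X.MorHor upsInvL_mem
  invFun τ := ∑ k, Submodule.Quotient.mk (F.contractL X (F.T k) τ ⊗ₜ F.T k)
  left_inv ψ := by
    change ∑ k, Submodule.Quotient.mk (F.contractL X (F.T k) ⟨upsInvL X ψ, _⟩ ⊗ₜ F.T k) = ψ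
    induction ψ using formsL_induction with
    | h0 =>
      refine Finset.sum_eq_zero fun k _ => ?_
      have : (⟨upsInvL X 0, upsInvL_mem _⟩ : X.MorHor) = 0 := by ext; simp
      rw [this, map_zero, TensorProduct.zero_tmul]
      rfl
    | hadd ψ φ hψ hφ =>
      conv_rhs => rw [← hψ, ← hφ]
      rw [← Finset.sum_add_distrib]
      refine Finset.sum_congr rfl fun k _ => ?_
      have : (⟨upsInvL X (ψ + φ), upsInvL_mem _⟩ : X.MorHor) =
        ⟨upsInvL X ψ, upsInvL_mem _⟩ + ⟨upsInvL X φ, upsInvL_mem _⟩ := by ext; simp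
      rw [this, map_add, TensorProduct.add_tmul]
      rfl
    | hmk n μ S hμ =>
      have h1 : ∀ k, (Submodule.Quotient.mk (F.contractL X (F.T k)
          ⟨upsInvL X (Submodule.Quotient.mk (μ ⊗ₜ S)), upsInvL_mem _⟩ ⊗ₜ F.T k) : FormsL X) =
          Submodule.Quotient.mk (μ ⊗ₜ lsmul (F.hermL S (F.T k)) (F.T k)) := by
        intro k
        refine Eq.trans ?_ ((Submodule.Quotient.eq (relL X)).2
          (Submodule.subset_span ⟨μ, F.hermL S (F.T k), F.T k, rfl⟩))
        rw [← F.contractL_mulLeft μ S (F.T k) (upsInvL_mem (Submodule.Quotient.mk (μ ⊗ₜ S)))]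
        rfl
      rw [Finset.sum_congr rfl fun k _ => h1 k]
      conv_rhs => rw [← F.sum_hermL_lsmul S, TensorProduct.tmul_sum]
      exact (map_sum (relL X).mkQ _ _).symm
  right_inv τ := by
    refine Subtype.ext ?_
    change upsInvL X (∑ k, Submodule.Quotient.mk (F.contractL X (F.T k) τ ⊗ₜ F.T k)) = τ.1
    rw [map_sum]
    refine F.e.ext fun j => ?_
    simp only [upsInvL_mk, LinearMap.sum_apply, LinearMap.comp_apply, LinearMap.mulLeft_apply,
      AlgHom.toLinearMap_apply, contractL_coe, Finset.sum_mul, mul_assoc, ← map_mul]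
    rw [Finset.sum_comm]
    simp only [← Finset.mul_sum, ← map_sum, F.sum_star_T_mul_T]
    rw [Finset.sum_eq_single j (by intro a _ ha; simp [ha]) (by simp)]
    simp

/-- The composition of a section with the endomorphism `K⁻¹` of `inv Γ`, which commutes with
`ad`. -/
noncomputable def compKInv [Nontrivial P] (T : MorP B C) : MorP B C :=
  ⟨T.1 ∘ₗ F.kInv, fun θ => by
    rw [LinearMap.comp_apply, T.2, F.ad_kInv]
    generalize C.ad θ = t
    induction t with
    | zero => simp
    | add x y hx hy => simp only [map_add, hx, hy]
    | tmul c e => simp⟩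

theorem comp_kInv_mem [Nontrivial P] {τ : C.inv →ₗ[ℂ] Ω} (hτ : τ ∈ X.MorHor) :
    τ ∘ₗ F.kInv ∈ X.MorHor := fun θ => by
  rw [LinearMap.comp_apply, hτ, F.ad_kInv]
  generalize C.ad θ = t
  induction t with
  | zero => simp
  | add x y hx hy => simp only [map_add, hx, hy]
  | tmul c e => simp

/-- The coefficients `μₖ = ∑ⱼ Wₖⱼ* τ(eⱼ)` of a horizontal intertwiner `τ = ∑ₖ Tₖ μₖ`. -/
noncomputable def coeffR [Nontrivial P] (X : BundleCalculus 𝒜 B C) (k : Fin F.r) :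
    X.MorHor →ₗ[ℂ] X.baseForms where
  toFun τ := ∑ l, star (F.Z k l) • F.contractR X (F.T l) ⟨τ.1 ∘ₗ F.kInv, F.comp_kInv_mem τ.2⟩
  map_add' τ σ := by
    rw [← Finset.sum_add_distrib]
    refine Finset.sum_congr rfl fun l _ => ?_
    rw [← smul_add, ← map_add]
    rfl
  map_smul' c τ := by
    rw [RingHom.id_apply, Finset.smul_sum]
    refine Finset.sum_congr rfl fun l _ => ?_
    rw [smul_comm c, ← map_smul (F.contractR X (F.T l)) c]
    rfl

theorem coeffR_coe [Nontrivial P] (k : Fin F.r) (τ : X.MorHor) :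
    (F.coeffR X k τ : Ω) = ∑ j, X.ιP (star (F.W k j)) * τ.1 (F.e j) := by
  change ((∑ l, star (F.Z k l) • F.contractR X (F.T l) ⟨τ.1 ∘ₗ F.kInv, _⟩ : X.baseForms) : Ω) = _
  rw [AddSubmonoidClass.coe_finsetSum]
  simp only [W, Matrix.mul_apply, Matrix.map_apply, Matrix.of_apply, Matrix.conjTranspose_apply,
    Subalgebra.coe_smul, contractR_coe, LinearMap.comp_apply, F.kInv_e, map_sum, map_smul,
    star_sum, star_mul, Finset.sum_mul, Finset.mul_sum, Finset.smul_sum, map_mul]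
  rw [Finset.sum_comm]
  conv_rhs => rw [Finset.sum_comm]
  refine Finset.sum_congr rfl fun a _ => ?_
  rw [Finset.sum_comm]
  refine Finset.sum_congr rfl fun j _ => Finset.sum_congr rfl fun l _ => ?_
  rw [← algebraMap_star_comm, ← algebraMap_star_comm, star_star, AlgHom.commutes, AlgHom.commutes,
    Algebra.algebraMap_eq_smul_one, Algebra.algebraMap_eq_smul_one]
  simp [smul_smul, mul_comm]

theorem sum_rsmul_eq [Nontrivial P] (S : MorP B C) (q : Fin F.r → B.base)
    (hq : ∀ k, (q k : P) = ∑ j, star (F.W k j) * S.1 (F.e j)) :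
    ∑ k, rsmul (F.T k) (q k) = S := by
  ext θ
  have : (∑ k, rsmul (F.T k) (q k)).1 = S.1 := by
    refine F.e.ext fun i => ?_
    rw [AddSubmonoidClass.coe_finsetSum, LinearMap.sum_apply]
    simp only [rsmul, LinearMap.comp_apply, LinearMap.mulRight_apply, hq, Finset.mul_sum,
      ← mul_assoc]
    rw [Finset.sum_comm]
    simp only [← Finset.sum_mul, F.sum_T_mul_star_W]
    simp
  rw [this]

/-- The coefficients of `S μ` are those of the section `S`, which are in `M`, times `μ`. The
elements `∑ⱼ Wₖⱼ* S(eⱼ)` are in `M` because they are combinations of the `⟨Tₗ, S ∘ K⁻¹⟩_R`. -/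
theorem exists_coeffR_mulRight [Nontrivial P] (X : BundleCalculus 𝒜 B C) (S : MorP B C)
    (k : Fin F.r) : ∃ q : B.base, (q : P) = ∑ j, star (F.W k j) * S.1 (F.e j) ∧
      ∀ (μ : X.baseForms) (h : LinearMap.mulRight ℂ (μ : Ω) ∘ₗ X.ιP.toLinearMap ∘ₗ S.1 ∈ X.MorHor),
        F.coeffR X k ⟨_, h⟩ = X.ιM q * μ := by
  let q : B.base := ∑ l, star (F.Z k l) • F.hermR (F.T l) (F.compKInv S)
  have hq : ∀ (μ : X.baseForms)
      (h : LinearMap.mulRight ℂ (μ : Ω) ∘ₗ X.ιP.toLinearMap ∘ₗ S.1 ∈ X.MorHor),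
      F.coeffR X k ⟨_, h⟩ = X.ιM q * μ := by
    intro μ h
    have h1 : ∀ l, F.contractR X (F.T l) ⟨_, F.comp_kInv_mem h⟩ =
        X.ιM (F.hermR (F.T l) (F.compKInv S)) * μ := fun l =>
      F.contractR_mulRight μ (F.compKInv S) (F.T l)
        (mulRight_comp_mem (X.ιP_comp_mem (F.compKInv S)) μ.2)
    change ∑ l, star (F.Z k l) • F.contractR X (F.T l) ⟨_, F.comp_kInv_mem h⟩ = _
    simp only [h1, q, map_sum, Finset.sum_mul, map_smul, smul_mul_assoc]
  refine ⟨q, ?_, hq⟩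
  have h2 : LinearMap.mulRight ℂ ((1 : X.baseForms) : Ω) ∘ₗ X.ιP.toLinearMap ∘ₗ S.1 ∈ X.MorHor :=
    mulRight_comp_mem (X.ιP_comp_mem S) (1 : X.baseForms).2
  have h3 := congrArg Subtype.val (hq 1 h2)
  rw [mul_one, coeffR_coe] at h3
  apply X.ιP_injective
  refine Eq.trans h3.symm ?_
  simp

/-- `Υ̃` in components: `τ ↦ ∑ₖ Tₖ ⊗ (∑ⱼ Wₖⱼ* τ(eⱼ))`. -/
noncomputable def equivR [Nontrivial P] (X : BundleCalculus 𝒜 B C) : FormsR X ≃ₗ[ℂ] X.MorHor where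
  toLinearMap := (upsInvR X).codRestrict X.MorHor upsInvR_mem
  invFun τ := ∑ k, Submodule.Quotient.mk (F.T k ⊗ₜ F.coeffR X k τ)
  left_inv ψ := by
    change ∑ k, Submodule.Quotient.mk (F.T k ⊗ₜ F.coeffR X k ⟨upsInvR X ψ, _⟩) = ψ
    induction ψ using formsR_induction with
    | h0 =>
      refine Finset.sum_eq_zero fun k _ => ?_
      have : (⟨upsInvR X 0, upsInvR_mem _⟩ : X.MorHor) = 0 := by ext; simp
      rw [this, map_zero, TensorProduct.tmul_zero]
      rfl
    | hadd ψ φ hψ hφ =>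
      conv_rhs => rw [← hψ, ← hφ]
      rw [← Finset.sum_add_distrib]
      refine Finset.sum_congr rfl fun k _ => ?_
      have : (⟨upsInvR X (ψ + φ), upsInvR_mem _⟩ : X.MorHor) =
        ⟨upsInvR X ψ, upsInvR_mem _⟩ + ⟨upsInvR X φ, upsInvR_mem _⟩ := by ext; simp
      rw [this, map_add, TensorProduct.tmul_add]
      rfl
    | hmk n S μ hμ =>
      choose q hq1 hq2 using F.exists_coeffR_mulRight X S
      have h1 : ∀ k, (Submodule.Quotient.mk (F.T k ⊗ₜ F.coeffR X k
          ⟨upsInvR X (Submodule.Quotient.mk (S ⊗ₜ μ)), upsInvR_mem _⟩) : FormsR X) =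
          Submodule.Quotient.mk (rsmul (F.T k) (q k) ⊗ₜ μ) := by
        intro k
        refine Eq.trans ?_ ((Submodule.Quotient.eq (relR X)).2
          (Submodule.subset_span ⟨F.T k, q k, μ, rfl⟩)).symm
        rw [← hq2 k μ (upsInvR_mem (Submodule.Quotient.mk (S ⊗ₜ μ)))]
        rfl
      rw [Finset.sum_congr rfl fun k _ => h1 k]
      conv_rhs => rw [← F.sum_rsmul_eq S q hq1, TensorProduct.sum_tmul]
      exact (map_sum (relR X).mkQ _ _).symm
  right_inv τ := by
    refine Subtype.ext ?_
    change upsInvR X (∑ k, Submodule.Quotient.mk (F.T k ⊗ₜ F.coeffR X k τ)) = τ.1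
    rw [map_sum]
    refine F.e.ext fun i => ?_
    simp only [upsInvR_mk, LinearMap.sum_apply, LinearMap.comp_apply, LinearMap.mulRight_apply,
      AlgHom.toLinearMap_apply, coeffR_coe, Finset.mul_sum, ← mul_assoc, ← map_mul]
    rw [Finset.sum_comm]
    simp only [← Finset.sum_mul, ← map_sum, F.sum_T_mul_star_W]
    rw [Finset.sum_eq_single i (by intro a _ ha; simp [Ne.symm ha]) (by simp)]
    simp

theorem equivL_coe (ψ : FormsL X) : (F.equivL X ψ : C.inv →ₗ[ℂ] Ω) = upsInvL X ψ := rfl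

theorem equivR_coe [Nontrivial P] (ψ : FormsR X) :
    (F.equivR X ψ : C.inv →ₗ[ℂ] Ω) = upsInvR X ψ := rfl

theorem upsL_eq {τ : C.inv →ₗ[ℂ] Ω} (hτ : τ ∈ X.MorHor) :
    upsL X τ = (F.equivL X).symm ⟨τ, hτ⟩ := by
  have hinj : Function.Injective (upsInvL X) := fun a b hab =>
    (F.equivL X).injective (Subtype.ext hab)
  have h := Function.leftInverse_invFun hinj ((F.equivL X).symm ⟨τ, hτ⟩)
  rwa [← equivL_coe F, LinearEquiv.apply_symm_apply] at h

theorem upsR_eq [Nontrivial P] {τ : C.inv →ₗ[ℂ] Ω} (hτ : τ ∈ X.MorHor) :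
    upsR X τ = (F.equivR X).symm ⟨τ, hτ⟩ := by
  have hinj : Function.Injective (upsInvR X) := fun a b hab =>
    (F.equivR X).injective (Subtype.ext hab)
  have h := Function.leftInverse_invFun hinj ((F.equivR X).symm ⟨τ, hτ⟩)
  rwa [← equivR_coe F, LinearEquiv.apply_symm_apply] at h

end AdFrame

end Components

section Adjoint

variable {G : Type*} [Ring G] [StarRing G] [HopfAlgebra ℂ G] [StarModule ℂ G]
variable {P : Type*} [Ring P] [StarRing P] [Algebra ℂ P] [StarModule ℂ P]
variable {Γ : Type*} [Ring Γ] [Algebra ℂ Γ] {𝒢 : ℕ → Submodule ℂ Γ} [GradedAlgebra 𝒢]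
variable {Ω : Type*} [Ring Ω] [Algebra ℂ Ω] {𝒜 : ℕ → Submodule ℂ Ω} [GradedAlgebra 𝒜]
variable {B : QuantumBundle G P} {C : GroupCalculus G 𝒢} {X : BundleCalculus 𝒜 B C}

open Coalgebra BundleCalculus

/-! ### Integration by parts for covariant derivatives of sections -/

theorem covD_ιP (ω : C.inv →ₗ[ℂ] Ω) (x : P) : covD X ω (X.ιP x) = X.d (X.ιP x) -
    LinearMap.mul' ℂ Ω (TensorProduct.map X.ιP.toLinearMap (ω ∘ₗ C.germ) (B.Φ x)) := by
  simp only [covD, LinearMap.sub_apply, LinearMap.comp_apply, coactΩ, psi_ιP]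
  congr 2
  generalize B.Φ x = t
  induction t with
  | zero => simp
  | add x y hx hy => simp only [map_add, hx, hy]
  | tmul c e => simp [projG_ι, degSign_of_mem 𝒜 (X.ιP_mem c)]

theorem covD_ιP_mem_one {ω : C.inv →ₗ[ℂ] Ω} (hω : ∀ θ, ω θ ∈ 𝒜 1) (x : P) :
    covD X ω (X.ιP x) ∈ 𝒜 1 := by
  rw [covD_ιP]
  refine sub_mem (X.d_mem (X.ιP_mem x)) ?_
  generalize B.Φ x = t
  induction t with
  | zero => simp
  | add x y hx hy => rw [map_add, map_add]; exact add_mem hx hy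
  | tmul c e => simpa using SetLike.mul_mem_graded (X.ιP_mem c) (hω (C.germ e))

/-- The product rule for `∑ᵢ tᵢ sᵢ*`, where `t` and `s` transform by a unitary corepresentation:
the connection terms cancel because the germs of the coefficients are antihermitian. -/
theorem d_sum_mul_star {m : ℕ} {v : Matrix (Fin m) (Fin m) G} (hv : IsUnitaryCorep v)
    {ω : C.inv →ₗ[ℂ] Ω} (hω : ∀ θ, ω θ ∈ 𝒜 1) {t s : Fin m → P}
    (ht : ∀ i, B.Φ (t i) = ∑ j, t j ⊗ₜ v j i) (hs : ∀ i, B.Φ (s i) = ∑ j, s j ⊗ₜ v j i) :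
    X.d (∑ i, X.ιP (t i) * X.cj (X.ιP (s i))) =
      ∑ i, covD X ω (X.ιP (t i)) * X.cj (X.ιP (s i)) +
        ∑ i, X.ιP (t i) * X.cj (covD X (hat X ω) (X.ιP (s i))) := by
  have h1 : ∀ i, covD X ω (X.ιP (t i)) =
      X.d (X.ιP (t i)) - ∑ j, X.ιP (t j) * ω (C.germ (v j i)) := by
    intro i
    rw [covD_ιP, ht]
    simp
  have h2 : ∀ i, X.cj (covD X (hat X ω) (X.ιP (s i))) =
      X.d (X.cj (X.ιP (s i))) + ∑ j, ω (C.germ (v i j)) * X.cj (X.ιP (s j)) := by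
    intro i
    have h : ∀ j, X.cj (X.ιP (s j) * hat X ω (C.germ (v j i))) =
        -(ω (C.germ (v i j)) * X.cj (X.ιP (s j))) := by
      intro j
      have hneg : ω (C.invCj (C.germ (v j i))) = -ω (C.germ (v i j)) := by
        rw [hv.invCj_germ C]
        exact map_neg ω _
      rw [hat_apply, X.cj_mul (X.ιP_mem _) (X.cj_mem (hω _)), X.cj_cj, hneg]
      simp
    rw [covD_ιP, hs]
    simp only [map_sum, map_sub, TensorProduct.map_tmul, LinearMap.mul'_apply,
      AlgHom.toLinearMap_apply, LinearMap.comp_apply, h, Finset.sum_neg_distrib, sub_neg_eq_add,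
      X.d_cj]
  have h3 : ∀ i, X.d (X.ιP (t i) * X.cj (X.ιP (s i))) = X.d (X.ιP (t i)) * X.cj (X.ιP (s i)) +
      X.ιP (t i) * X.d (X.cj (X.ιP (s i))) := by
    intro i
    rw [X.leibniz (X.ιP_mem _)]
    simp
  simp only [map_sum, h1, h2, h3, sub_mul, mul_add, Finset.sum_mul, Finset.mul_sum,
    Finset.sum_add_distrib, Finset.sum_sub_distrib, mul_assoc]
  rw [Finset.sum_comm (f := fun i j => X.ιP (t j) * (ω (C.germ (v j i)) * X.cj (X.ιP (s i))))]
  abel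

theorem covDHat_ιP_mul {k : ℕ} {ω : C.inv →ₗ[ℂ] Ω} (hω : ∀ θ, ω θ ∈ 𝒜 1) {μ : X.baseForms}
    (hμ : (μ : Ω) ∈ 𝒜 k) (x : P) : covDHat X ω (X.ιP x * μ) =
      X.ιP x * X.d μ + covDHat X ω (X.ιP x) * μ := by
  have h1 : X.cj (X.ιP x * μ) = X.cj μ * X.ιP (star x) := by
    rw [X.cj_mul (X.ιP_mem x) hμ, X.ιP_star]; simp
  have h2 : X.cj (X.d (X.cj (μ : Ω)) * X.ιP (star x)) = X.ιP x * X.d μ := by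
    rw [X.cj_mul (X.d_mem (X.cj_mem hμ)) (X.ιP_mem _), X.ιP_star, X.cj_cj, X.d_cj, X.cj_cj]
    simp
  have h3 : X.cj (X.cj (μ : Ω) * covD X ω (X.ιP (star x))) =
      ((-1 : ℂ) ^ k) • (X.cj (covD X ω (X.ιP (star x))) * μ) := by
    rw [X.cj_mul (X.cj_mem hμ) (covD_ιP_mem_one hω _), X.cj_cj, mul_one]
  change X.cj (covD X ω (X.cj _)) = _ + X.cj (covD X ω (X.cj _)) * _
  rw [h1, covD_mul ω (X.cj_mem hμ) (X.cjM μ).2, map_add, h2, map_smulₛₗ, h3, ← X.ιP_star, smul_smul,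
    map_pow, ← mul_pow]
  simp

/-! ### The hermitian structures and the exterior derivatives in terms of intertwiners -/

variable {A : Type*} [CStarAlgebra A] (H : HodgeData X A) (F : AdFrame B C)

theorem formL_mk_right (ψ : FormsL X) (ν : X.baseForms) (S : MorP B C) :
    formL H F ψ (Submodule.Quotient.mk (ν ⊗ₜ S)) = H.gL (F.contractL X S (F.equivL X ψ)) ν := by
  induction ψ using formsL_induction with
  | h0 => simp
  | hadd ψ φ hψ hφ => simp only [map_add, LinearMap.add_apply, hψ, hφ]
  | hmk k μ T hμ =>
    refine (formL₁_mk H F μ ν T S).trans ?_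
    rw [← F.contractL_mulLeft μ T S (upsInvL_mem (Submodule.Quotient.mk (μ ⊗ₜ T)))]
    rfl

theorem formL_mk_left (μ : X.baseForms) (T : MorP B C) (φ : FormsL X) :
    formL H F (Submodule.Quotient.mk (μ ⊗ₜ T)) φ = H.gL μ (F.contractL X T (F.equivL X φ)) := by
  induction φ using formsL_induction with
  | h0 => simp
  | hadd ψ φ hψ hφ => simp only [map_add, hψ, hφ]
  | hmk k ν S hν =>
    refine (formL₁_mk H F μ ν T S).trans ?_
    rw [H.gL_right, F.star_hermL,
      ← F.contractL_mulLeft ν S T (upsInvL_mem (Submodule.Quotient.mk (ν ⊗ₜ S)))]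
    rfl

theorem formR_mk_left [Nontrivial P] (T : MorP B C) (μ : X.baseForms) (φ : FormsR X) :
    formR H F (Submodule.Quotient.mk (T ⊗ₜ μ)) φ = H.gR μ (F.contractR X T (F.equivR X φ)) := by
  unfold HodgeData.gR
  induction φ using formsR_induction with
  | h0 => simp
  | hadd ψ φ hψ hφ => simp only [map_add, hψ, hφ]
  | hmk k S ν hν =>
    refine (formR₁_mk H F μ ν T S).trans ?_
    rw [← F.contractR_mulRight ν S T (upsInvR_mem (Submodule.Quotient.mk (S ⊗ₜ ν)))]
    rfl

theorem formR_mk_right [Nontrivial P] (ψ : FormsR X) (S : MorP B C) (ν : X.baseForms) :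
    formR H F ψ (Submodule.Quotient.mk (S ⊗ₜ ν)) = H.gR (F.contractR X S (F.equivR X ψ)) ν := by
  unfold HodgeData.gR
  induction ψ using formsR_induction with
  | h0 => simp
  | hadd ψ φ hψ hφ => simp only [map_add, LinearMap.add_apply, hψ, hφ]
  | hmk k T μ hμ =>
    refine (formR₁_mk H F μ ν T S).trans ?_
    have h : F.contractR X S (F.equivR X (Submodule.Quotient.mk (T ⊗ₜ μ))) =
        X.ιM (F.hermR S T) * μ :=
      F.contractR_mulRight μ T S (upsInvR_mem (Submodule.Quotient.mk (T ⊗ₜ μ)))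
    rw [h, HodgeData.gR, X.cjM_ιM_mul, X.cjM_ιM_mul, H.gL_right, F.star_hermR, star_star]

theorem contractL_mapFormsL (f : X.baseForms →ₗ[ℂ] X.baseForms)
    (hf : ∀ μ p, f (μ * X.ιM p) = f μ * X.ιM p) (T : MorP B C) (φ : FormsL X) :
    F.contractL X T (F.equivL X (mapFormsL X f hf φ)) =
      f (F.contractL X T (F.equivL X φ)) := by
  induction φ using formsL_induction with
  | h0 => simp
  | hadd ψ φ hψ hφ => simp only [map_add, hψ, hφ]
  | hmk k ν S hν =>
    refine (F.contractL_mulLeft (f ν) S T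
      (upsInvL_mem (Submodule.Quotient.mk (f ν ⊗ₜ S)))).trans ?_
    rw [← hf, ← F.contractL_mulLeft ν S T (upsInvL_mem (Submodule.Quotient.mk (ν ⊗ₜ S)))]
    rfl

theorem contractR_mapFormsR [Nontrivial P] (f : X.baseForms →ₗ[ℂ] X.baseForms)
    (hf : ∀ μ p, f (X.ιM p * μ) = X.ιM p * f μ) (T : MorP B C) (φ : FormsR X) :
    F.contractR X T (F.equivR X (mapFormsR X f hf φ)) =
      f (F.contractR X T (F.equivR X φ)) := by
  induction φ using formsR_induction with
  | h0 => simp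
  | hadd ψ φ hψ hφ => simp only [map_add, hψ, hφ]
  | hmk k S ν hν =>
    refine (F.contractR_mulRight (f ν) S T
      (upsInvR_mem (Submodule.Quotient.mk (S ⊗ₜ f ν)))).trans ?_
    rw [← hf, ← F.contractR_mulRight ν S T (upsInvR_mem (Submodule.Quotient.mk (S ⊗ₜ ν)))]
    rfl

theorem covD_comp_upsInvL_mem (F : AdFrame B C) {ω : C.inv →ₗ[ℂ] Ω} (hω : IsQPC X ω)
    (ψ : FormsL X) : covD X ω ∘ₗ upsInvL X ψ ∈ X.MorHor := by
  induction ψ using formsL_induction with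
  | h0 => rw [map_zero, LinearMap.comp_zero]; exact zero_mem _
  | hadd ψ φ hψ hφ => rw [map_add, LinearMap.comp_add]; exact add_mem hψ hφ
  | hmk k μ T hμ =>
    have h : covD X ω ∘ₗ upsInvL X (Submodule.Quotient.mk (μ ⊗ₜ T)) =
        LinearMap.mulLeft ℂ (X.d μ) ∘ₗ X.ιP.toLinearMap ∘ₗ T.1 +
          ((-1 : ℂ) ^ k) • (LinearMap.mulLeft ℂ (μ : Ω) ∘ₗ
            (covD X ω ∘ₗ X.ιP.toLinearMap ∘ₗ T.1)) := by
      ext θ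
      exact covD_mul ω hμ μ.2 _
    rw [h]
    exact add_mem (mulLeft_comp_mem (X.ιP_comp_mem T) (X.dM μ).2)
      (X.MorHor.smul_mem _ (mulLeft_comp_mem (covD_ιP_mem F.e F.isUnitaryCorep hω T) μ.2))

theorem covD_comp_mem (F : AdFrame B C) {ω τ : C.inv →ₗ[ℂ] Ω} (hω : IsQPC X ω) (hτ : τ ∈ X.MorHor) :
    covD X ω ∘ₗ τ ∈ X.MorHor := by
  have := covD_comp_upsInvL_mem F hω ((F.equivL X).symm ⟨τ, hτ⟩)
  rwa [← F.equivL_coe, LinearEquiv.apply_symm_apply] at this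

theorem covDHat_comp (ω τ : C.inv →ₗ[ℂ] Ω) :
    covDHat X ω ∘ₗ τ = hat X (covD X ω ∘ₗ hat X τ) := by
  ext θ
  change X.cj (covD X ω (X.cj (τ θ))) = X.cj (covD X ω (X.cj (τ (C.invCj (C.invCj θ)))))
  rw [invCj_invCj]

theorem covDHat_comp_mem (F : AdFrame B C) {ω τ : C.inv →ₗ[ℂ] Ω} (hω : IsQPC X ω)
    (hτ : τ ∈ X.MorHor) : covDHat X ω ∘ₗ τ ∈ X.MorHor := by
  rw [covDHat_comp]
  exact hat_mem (covD_comp_mem F hω (hat_mem hτ))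

theorem dNablaL_eq (F : AdFrame B C) {ω : C.inv →ₗ[ℂ] Ω} (hω : IsQPC X ω) (ψ : FormsL X) :
    dNablaL X ω ψ = (F.equivL X).symm
      ⟨covD X ω ∘ₗ upsInvL X ψ, covD_comp_mem F hω (upsInvL_mem ψ)⟩ := F.upsL_eq _

theorem dNablaR_eq [Nontrivial P] (F : AdFrame B C) {ω : C.inv →ₗ[ℂ] Ω} (hω : IsQPC X ω)
    (ψ : FormsR X) :
    dNablaR X ω ψ = (F.equivR X).symm
      ⟨covDHat X ω ∘ₗ upsInvR X ψ, covDHat_comp_mem F hω (upsInvR_mem ψ)⟩ := F.upsR_eq _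

/-- `d^∇` as a linear map. -/
noncomputable def dNablaLinL (F : AdFrame B C) {ω : C.inv →ₗ[ℂ] Ω} (hω : IsQPC X ω) :
    FormsL X →ₗ[ℂ] FormsL X where
  toFun := dNablaL X ω
  map_add' ψ φ := by
    simp only [dNablaL_eq F hω, ← map_add]
    congr 1
    ext θ
    simp
  map_smul' c ψ := by
    simp only [dNablaL_eq F hω, ← map_smul]
    congr 1
    ext θ
    simp

/-- `d^∇̂` as a linear map. -/
noncomputable def dNablaLinR [Nontrivial P] (F : AdFrame B C) {ω : C.inv →ₗ[ℂ] Ω}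
    (hω : IsQPC X ω) : FormsR X →ₗ[ℂ] FormsR X where
  toFun := dNablaR X ω
  map_add' ψ φ := by
    simp only [dNablaR_eq F hω, ← map_add]
    congr 1
    ext θ
    simp
  map_smul' c ψ := by
    simp only [dNablaR_eq F hω, ← map_smul]
    congr 1
    ext θ
    simp

/-- The connection part of `⟨∇T, S⟩_L`. -/
noncomputable def connL (F : AdFrame B C) (X : BundleCalculus 𝒜 B C) (ω : C.inv →ₗ[ℂ] Ω)
    (T S : MorP B C) : Ω :=
  ∑ i, covD X ω (X.ιP (T.1 (F.e i))) * X.cj (X.ιP (S.1 (F.e i)))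

/-- The connection part of `⟨S, ∇̂T⟩_R`. -/
noncomputable def connR (F : AdFrame B C) (X : BundleCalculus 𝒜 B C) (ω : C.inv →ₗ[ℂ] Ω)
    (S T : MorP B C) : Ω :=
  ∑ i, X.cj (X.ιP (S.1 (F.e i))) * covDHat X ω (X.ιP (T.1 (F.e i)))

theorem covDHat_ιP_mem_one {ω : C.inv →ₗ[ℂ] Ω} (hω : ∀ θ, ω θ ∈ 𝒜 1) (x : P) :
    covDHat X ω (X.ιP x) ∈ 𝒜 1 := by
  change X.cj (covD X ω (X.cj (X.ιP x))) ∈ _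
  rw [← X.ιP_star]
  exact X.cj_mem (covD_ιP_mem_one hω _)

theorem connL_mem {ω : C.inv →ₗ[ℂ] Ω} (hω : ∀ θ, ω θ ∈ 𝒜 1) (T S : MorP B C) :
    connL F X ω T S ∈ 𝒜 1 :=
  sum_mem fun i _ => by
    simpa using SetLike.mul_mem_graded (covD_ιP_mem_one hω _) (X.cj_mem (X.ιP_mem (S.1 (F.e i))))

theorem connR_mem {ω : C.inv →ₗ[ℂ] Ω} (hω : ∀ θ, ω θ ∈ 𝒜 1) (S T : MorP B C) :
    connR F X ω S T ∈ 𝒜 1 :=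
  sum_mem fun i _ => by
    simpa using SetLike.mul_mem_graded (X.cj_mem (X.ιP_mem (S.1 (F.e i))))
      (covDHat_ιP_mem_one hω (T.1 (F.e i)))

/-- The connections `∇^ω` and `∇^ω̂` are compatible with `⟨-, -⟩_L`. -/
theorem d_hermL {ω : C.inv →ₗ[ℂ] Ω} (hω : ∀ θ, ω θ ∈ 𝒜 1) (T S : MorP B C) :
    X.d (X.ιP (F.hermL T S)) = connL F X ω T S + X.cj (connL F X (hat X ω) S T) := by
  have h : X.ιP (F.hermL T S) = ∑ i, X.ιP (T.1 (F.e i)) * X.cj (X.ιP (S.1 (F.e i))) := by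
    simp [AdFrame.hermL_coe, X.ιP_star]
  rw [h, d_sum_mul_star F.isUnitaryCorep hω (fun i => F.Φ_apply T i) (fun i => F.Φ_apply S i)]
  congr 1
  rw [connL, map_sum]
  refine Finset.sum_congr rfl fun i _ => ?_
  rw [X.cj_mul (covD_ιP_mem_one (fun θ => X.cj_mem (hω _)) _) (X.cj_mem (X.ιP_mem _)), X.cj_cj]
  simp

/-- The connections `∇̂^ω` and `∇̂^ω̂` are compatible with `⟨-, -⟩_R`; this is the product rule for
the conjugate of the adjoint corepresentation. -/
theorem d_hermR [Nontrivial P] {ω : C.inv →ₗ[ℂ] Ω} (hω : ∀ θ, ω θ ∈ 𝒜 1) (T S : MorP B C) :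
    X.d (X.ιP (F.hermR T S)) = X.cj (connR F X ω S T) + connR F X (hat X ω) T S := by
  have h : X.ιP (F.hermR T S) =
      ∑ i, X.ιP (star (T.1 (F.e i))) * X.cj (X.ιP (star (S.1 (F.e i)))) := by
    simp [AdFrame.hermR_coe, X.ιP_star, X.cj_cj]
  have hs : ∀ (T : MorP B C) (i), B.Φ (star (T.1 (F.e i))) =
      ∑ j, star (T.1 (F.e j)) ⊗ₜ ((adMatrix C F.e).map star) j i := by
    intro T i
    rw [map_star, F.Φ_apply, star_sum]
    simp
  rw [h, d_sum_mul_star F.isUnitaryCorep_conj hω (hs T) (hs S)]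
  congr 1
  · rw [connR, map_sum]
    refine Finset.sum_congr rfl fun i _ => ?_
    rw [X.cj_mul (X.cj_mem (X.ιP_mem _)) (covDHat_ιP_mem_one hω _), X.cj_cj, X.ιP_star,
      X.ιP_star, X.cj_cj]
    change _ = _ • (X.cj (X.cj (covD X ω (X.cj _))) * _)
    rw [X.cj_cj]
    simp
  · refine Finset.sum_congr rfl fun i _ => ?_
    rw [X.ιP_star, X.ιP_star]
    rfl

theorem contractL_dNablaL {k : ℕ} {ω : C.inv →ₗ[ℂ] Ω} (hω : IsQPC X ω) {μ : X.baseForms}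
    (hμ : (μ : Ω) ∈ 𝒜 k) (T S : MorP B C) :
    (F.contractL X S (F.equivL X (dNablaL X ω (Submodule.Quotient.mk (μ ⊗ₜ T)))) : Ω) =
      X.d μ * X.ιP (F.hermL T S) + ((-1 : ℂ) ^ k) • (μ * connL F X ω T S) := by
  rw [dNablaL_eq F hω, LinearEquiv.apply_symm_apply, AdFrame.contractL_coe]
  simp only [upsInvL_mk, LinearMap.comp_apply, LinearMap.mulLeft_apply, AlgHom.toLinearMap_apply,
    covD_mul ω hμ μ.2, X.ιP_star, add_mul, Finset.sum_add_distrib, smul_mul_assoc,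
    ← Finset.smul_sum, mul_assoc, ← Finset.mul_sum, connL]
  simp [AdFrame.hermL_coe, X.ιP_star]

theorem contractR_dNablaR [Nontrivial P] {k : ℕ} {ω : C.inv →ₗ[ℂ] Ω} (hω : IsQPC X ω)
    {μ : X.baseForms} (hμ : (μ : Ω) ∈ 𝒜 k) (T S : MorP B C) :
    (F.contractR X S (F.equivR X (dNablaR X ω (Submodule.Quotient.mk (T ⊗ₜ μ)))) : Ω) =
      X.ιP (F.hermR S T) * X.d μ + connR F X ω S T * μ := by
  rw [dNablaR_eq F hω, LinearEquiv.apply_symm_apply, AdFrame.contractR_coe]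
  simp only [upsInvR_mk, LinearMap.comp_apply, LinearMap.mulRight_apply, AlgHom.toLinearMap_apply,
    covDHat_ιP_mul hω.1 hμ, X.ιP_star, mul_add, Finset.sum_add_distrib,
    ← mul_assoc, ← Finset.sum_mul, connR]
  simp [AdFrame.hermR_coe, X.ιP_star]

/-! ### Integration by parts on the base -/

theorem d_mul_ιP_mul {k : ℕ} {a : Ω} (ha : a ∈ 𝒜 k) (x : P) (b : Ω) :
    X.d (a * (X.ιP x * b)) = X.d a * X.ιP x * b +
      ((-1 : ℂ) ^ k) • (a * (X.d (X.ιP x) * b + X.ιP x * X.d b)) := by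
  rw [X.leibniz ha, X.leibniz (X.ιP_mem x), pow_zero, one_smul, mul_assoc]

/-- Forms whose products with Hodge duals add up to an exact form have, up to a sign, the same
inner products. -/
theorem s_gL_eq {k l : ℕ} {μ α ν β γ : X.baseForms} (hμ : (μ : Ω) ∈ 𝒜 k)
    (hα : (α : Ω) ∈ 𝒜 (k + 1)) (hl : l ≤ H.n) (hν : (ν : Ω) ∈ 𝒜 l)
    (hβ : (β : Ω) ∈ 𝒜 (H.n - l + 1))
    (h : α * H.starL ν + ((-1 : ℂ) ^ k) • (μ * β) = X.dM γ) :
    H.s (H.gL α ν) = (-1) ^ l * H.s (H.gL μ (H.starL.symm β)) := by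
  have hmem : ∀ m, m ≤ H.n → (β : Ω) ∈ 𝒜 (H.n - m) → (H.starL.symm β : Ω) ∈ 𝒜 m := by
    intro m hm hβ
    rw [H.starL_mem hm, LinearEquiv.apply_symm_apply]
    exact hβ
  -- `⟨α, ν⟩` and `⟨μ, ⋆⁻¹β⟩` are both zero, for reasons of degree, unless `l = k + 1`
  by_cases hkl : l = k + 1
  · subst hkl
    have hβ' : (H.starL.symm β : Ω) ∈ 𝒜 k :=
      hmem k (by omega) (by rwa [show H.n - k = H.n - (k + 1) + 1 by omega])
    have h1 : μ * β = X.ιM (H.gL μ (H.starL.symm β)) * H.dvol := by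
      rw [← H.mul_starL hμ hβ', LinearEquiv.apply_symm_apply]
    rw [H.mul_starL hα hν, h1, ← smul_mul_assoc, ← map_smul, ← add_mul, ← map_add] at h
    have h2 := H.no_boundary γ _ h.symm
    rw [map_add, map_smul, smul_eq_mul] at h2
    rw [eq_neg_of_add_eq_zero_left h2]
    ring
  · rw [H.gL_orthogonal (Ne.symm hkl) hα hν]
    rcases Nat.eq_zero_or_pos l with rfl | hl0
    · rw [H.eq_zero_of_lt (by omega) hβ]
      simp
    · have hβ' : (H.starL.symm β : Ω) ∈ 𝒜 (l - 1) :=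
        hmem _ (by omega) (by rwa [show H.n - (l - 1) = H.n - l + 1 by omega])
      rw [H.gL_orthogonal (k := k) (l := l - 1) (by omega) hμ hβ']
      simp

/-- A volume form is nonzero, so `GM ≠ 0`. -/
theorem nontrivial_of_hodgeData (H : HodgeData X A) : Nontrivial P := by
  by_contra hP
  rw [not_nontrivial_iff_subsingleton] at hP
  refine H.dvol_ne_zero (Subtype.ext ?_)
  rw [← one_mul (H.dvol : Ω), ← map_one X.ιP, Subsingleton.elim (1 : P) 0, map_zero, zero_mul]
  rfl

/-! ### Adjoints of the exterior covariant derivatives -/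

/-- Here `α` and `β` stand for `⟨d^∇(μ ⊗ T), S⟩` and `⟨d^∇(∗⋆ν ⊗ S), T⟩`; the form
`μ ⟨T, S⟩ (⋆ν)` has the differential that is integrated by parts. -/
theorem s_gL_contractL {k l : ℕ} {ω : C.inv →ₗ[ℂ] Ω} (hω : IsQPC X ω) {μ α ν β : X.baseForms}
    (hμ : (μ : Ω) ∈ 𝒜 k) (hl : l ≤ H.n) (hν : (ν : Ω) ∈ 𝒜 l) (T S : MorP B C)
    (hα : (α : Ω) = X.d μ * X.ιP (F.hermL T S) + ((-1 : ℂ) ^ k) • (μ * connL F X ω T S))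
    (hβ : (β : Ω) = X.d (X.cj (H.starL ν)) * X.ιP (F.hermL S T) +
      ((-1 : ℂ) ^ (H.n - l)) • (X.cj (H.starL ν) * connL F X (hat X ω) S T)) :
    H.s (H.gL α ν) = (-1) ^ l * H.s (H.gL μ (H.starL.symm (X.cjM β))) := by
  have hρ : (H.starL ν : Ω) ∈ 𝒜 (H.n - l) := (H.starL_mem hl ν).1 hν
  have hE := connL_mem F (X := X) hω.1 T S
  have hE' := connL_mem F (X := X) (isQPC_hat hω).1 S T
  have hβ' : X.cj (β : Ω) = X.ιP (F.hermL T S) * X.d (H.starL ν) +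
      X.cj (connL F X (hat X ω) S T) * H.starL ν := by
    have hstar : star ((F.hermL S T : B.base) : P) = (F.hermL T S : P) :=
      congrArg Subtype.val (F.star_hermL S T)
    rw [hβ, map_add, map_smulₛₗ, X.cj_mul (X.d_mem (X.cj_mem hρ)) (X.ιP_mem _),
      X.cj_mul (X.cj_mem hρ) hE', ← X.ιP_star, ← X.d_cj, X.cj_cj, smul_smul, hstar, map_pow,
      mul_one, ← mul_pow]
    simp
  have hαmem : (α : Ω) ∈ 𝒜 (k + 1) := by
    rw [hα]
    exact add_mem (by simpa using SetLike.mul_mem_graded (X.d_mem hμ) (X.ιP_mem _))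
      ((𝒜 (k + 1)).smul_mem _ (SetLike.mul_mem_graded hμ hE))
  have hβmem : (X.cjM β : Ω) ∈ 𝒜 (H.n - l + 1) := by
    refine X.cj_mem ?_
    change (β : Ω) ∈ _
    rw [hβ]
    exact add_mem
      (by simpa using SetLike.mul_mem_graded (X.d_mem (X.cj_mem hρ)) (X.ιP_mem _))
      ((𝒜 _).smul_mem _ (SetLike.mul_mem_graded (X.cj_mem hρ) hE'))
  refine s_gL_eq H (γ := μ * (X.ιM (F.hermL T S) * H.starL ν)) hμ hαmem hl hν hβmem ?_
  ext
  change (α : Ω) * H.starL ν + ((-1 : ℂ) ^ k) • ((μ : Ω) * X.cj (β : Ω)) =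
    X.d ((μ : Ω) * (X.ιP (F.hermL T S) * H.starL ν))
  rw [hα, hβ', d_mul_ιP_mul hμ, d_hermL F hω.1]
  simp only [add_mul, mul_add, smul_add, mul_assoc, smul_mul_assoc]
  abel

theorem isAdjointL_dNablaL {ω : C.inv →ₗ[ℂ] Ω} (hω : IsQPC X ω) :
    IsAdjointL H F (dNablaL X ω) (dNablaStarL H ω) := by
  have hω' : IsQPC X (hat X ω) := isQPC_hat hω
  intro ψ φ
  change H.s (formL H F (dNablaLinL F hω ψ) φ) = H.s (formL H F ψ (mapFormsL X H.starLInvCj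
    H.starLInvCj_mul (dNablaLinL F hω' (mapFormsL X H.cjStarL H.cjStarL_mul
      (mapFormsL X X.sgnM X.sgnM_mul_ιM φ)))))
  induction φ using formsL_induction with
  | h0 => simp
  | hadd φ φ' h h' => simp only [map_add, h, h']
  | hmk l ν S hν =>
  induction ψ using formsL_induction with
  | h0 => simp
  | hadd φ φ' h h' => simp only [map_add, LinearMap.add_apply, h, h']
  | hmk k μ T hμ =>
  rcases lt_or_ge H.n l with hl | hl
  · rw [H.eq_zero_of_lt hl hν, TensorProduct.zero_tmul, Submodule.Quotient.mk_zero]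
    simp
  have hsgn : mapFormsL X X.sgnM X.sgnM_mul_ιM (Submodule.Quotient.mk (ν ⊗ₜ S)) =
      ((-1 : ℂ) ^ l) • (Submodule.Quotient.mk (ν ⊗ₜ S) : FormsL X) := by
    change Submodule.Quotient.mk (X.sgnM ν ⊗ₜ S) = _
    rw [X.sgnM_of_mem hν, ← TensorProduct.smul_tmul', Submodule.Quotient.mk_smul]
  have hρ : (H.cjStarL ν : Ω) ∈ 𝒜 (H.n - l) := X.cj_mem ((H.starL_mem hl ν).1 hν)
  simp only [hsgn, map_smul, map_smulₛₗ, smul_eq_mul, map_pow, map_neg, map_one]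
  rw [formL_mk_right, formL_mk_left, contractL_mapFormsL]
  exact s_gL_contractL H F hω hμ hl hν T S (contractL_dNablaL F hω hμ T S)
    (contractL_dNablaL F hω' hρ S T)

/-- The right-handed version of `s_gL_contractL`. -/
theorem s_gR_contractR [Nontrivial P] {k l : ℕ} {ω : C.inv →ₗ[ℂ] Ω} (hω : IsQPC X ω)
    {μ α ν β : X.baseForms}
    (hμ : (μ : Ω) ∈ 𝒜 k) (hl : l ≤ H.n) (hν : (ν : Ω) ∈ 𝒜 l) (T S : MorP B C)
    (hα : (α : Ω) = X.ιP (F.hermR S T) * X.d μ + connR F X ω S T * μ)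
    (hβ : (β : Ω) = X.ιP (F.hermR T S) * X.d (H.starL (X.cjM ν)) +
      connR F X (hat X ω) T S * H.starL (X.cjM ν)) :
    H.s (H.gL (X.cjM α) (X.cjM ν)) =
      (-1) ^ l * H.s (H.gL (X.cjM μ) (H.starL.symm β)) := by
  have hν' : (X.cjM ν : Ω) ∈ 𝒜 l := X.cj_mem hν
  have hρ : (H.starL (X.cjM ν) : Ω) ∈ 𝒜 (H.n - l) := (H.starL_mem hl _).1 hν'
  have hE := connR_mem F (X := X) hω.1 S T
  have hE' := connR_mem F (X := X) (isQPC_hat hω).1 T S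
  have hα' : X.cj (α : Ω) = X.d (X.cj μ) * X.ιP (F.hermR T S) +
      ((-1 : ℂ) ^ k) • (X.cj μ * X.cj (connR F X ω S T)) := by
    have hstar : star ((F.hermR S T : B.base) : P) = (F.hermR T S : P) :=
      congrArg Subtype.val (F.star_hermR S T)
    rw [hα, map_add, X.cj_mul (X.ιP_mem _) (X.d_mem hμ), X.cj_mul hE hμ, ← X.ιP_star, ← X.d_cj,
      hstar]
    simp
  have hαmem : (X.cjM α : Ω) ∈ 𝒜 (k + 1) := by
    change X.cj (α : Ω) ∈ _
    rw [hα']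
    exact add_mem (by simpa using SetLike.mul_mem_graded (X.d_mem (X.cj_mem hμ)) (X.ιP_mem _))
      ((𝒜 (k + 1)).smul_mem _ (SetLike.mul_mem_graded (X.cj_mem hμ) (X.cj_mem hE)))
  have hβmem : (β : Ω) ∈ 𝒜 (H.n - l + 1) := by
    rw [hβ]
    refine add_mem ?_ ?_
    · simpa using SetLike.mul_mem_graded (X.ιP_mem (F.hermR T S)) (X.d_mem hρ)
    · rw [add_comm]
      exact SetLike.mul_mem_graded hE' hρ
  refine s_gL_eq H (γ := X.cjM μ * (X.ιM (F.hermR T S) * H.starL (X.cjM ν)))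
    (X.cj_mem hμ) hαmem hl hν' hβmem ?_
  ext
  change X.cj (α : Ω) * H.starL (X.cjM ν) + ((-1 : ℂ) ^ k) • (X.cj μ * (β : Ω)) =
    X.d (X.cj μ * (X.ιP (F.hermR T S) * H.starL (X.cjM ν)))
  have hd := d_hermR (X := X) F hω.1 T S
  rw [hα', hβ, d_mul_ιP_mul (X.cj_mem hμ), hd]
  simp only [add_mul, mul_add, smul_add, mul_assoc, smul_mul_assoc]
  abel

theorem isAdjointR_dNablaR {ω : C.inv →ₗ[ℂ] Ω} (hω : IsQPC X ω) :
    IsAdjointR H F (dNablaR X ω) (dNablaStarR H ω) := by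
  have : Nontrivial P := nontrivial_of_hodgeData H
  have hω' : IsQPC X (hat X ω) := isQPC_hat hω
  intro ψ φ
  change H.s (formR H F (dNablaLinR F hω ψ) φ) = H.s (formR H F ψ (mapFormsR X H.starRInvCj
    H.starRInvCj_mul (dNablaLinR F hω' (mapFormsR X H.cjStarR H.cjStarR_mul
      (mapFormsR X X.sgnM X.sgnM_ιM_mul φ)))))
  induction φ using formsR_induction with
  | h0 => simp
  | hadd φ φ' h h' => simp only [map_add, h, h']
  | hmk l S ν hν =>
  induction ψ using formsR_induction with
  | h0 => simp
  | hadd φ φ' h h' => simp only [map_add, LinearMap.add_apply, h, h']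
  | hmk k T μ hμ =>
  rcases lt_or_ge H.n l with hl | hl
  · rw [H.eq_zero_of_lt hl hν, TensorProduct.tmul_zero, Submodule.Quotient.mk_zero]
    simp
  have hsgn : mapFormsR X X.sgnM X.sgnM_ιM_mul (Submodule.Quotient.mk (S ⊗ₜ ν)) =
      ((-1 : ℂ) ^ l) • (Submodule.Quotient.mk (S ⊗ₜ ν) : FormsR X) := by
    change Submodule.Quotient.mk (S ⊗ₜ X.sgnM ν) = _
    rw [X.sgnM_of_mem hν, TensorProduct.tmul_smul, Submodule.Quotient.mk_smul]
  have hρν : H.cjStarR ν = H.starL (X.cjM ν) := X.cjM_cjM _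
  have hρ : (H.cjStarR ν : Ω) ∈ 𝒜 (H.n - l) := by
    rw [hρν]
    exact (H.starL_mem hl _).1 (X.cj_mem hν)
  have hinv : ∀ β, X.cjM (H.starRInvCj β) = H.starL.symm β := by
    intro β
    change X.cjM (X.cjM (H.starL.symm (X.cjM (X.cjM β)))) = _
    rw [X.cjM_cjM, X.cjM_cjM]
  simp only [hsgn, map_smul, smul_eq_mul]
  rw [formR_mk_right, formR_mk_left, contractR_mapFormsR, HodgeData.gR, HodgeData.gR, hinv]
  have hβ := contractR_dNablaR F hω' hρ S T
  exact s_gR_contractR H F hω hμ hl hν T S (contractR_dNablaR F hω hμ T S)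
    (hβ.trans (by rw [hρν]))

end Adjoint

/-! ### Wirtinger derivatives of polynomials in `z` and `conj z` -/

section Wirtinger

open ComplexConjugate

theorem hasFDerivAt_quartic (c₀ c₁ c₂ d₁ d₂ d₃ d₄ d₅ d₆ : ℂ) :
    HasFDerivAt (𝕜 := ℝ) (fun z : ℂ => c₀ + z * c₁ + conj z * c₂ + z * z * d₁ + z * conj z * d₂ +
      conj z * conj z * d₃ + z * z * conj z * d₄ + z * (conj z * conj z) * d₅ +
      z * z * (conj z * conj z) * d₆)
      (c₁ • ContinuousLinearMap.id ℝ ℂ + c₂ • Complex.conjCLE.toContinuousLinearMap) 0 := by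
  have hz : HasFDerivAt (𝕜 := ℝ) (fun z : ℂ => z) (ContinuousLinearMap.id ℝ ℂ) 0 :=
    hasFDerivAt_id 0
  have hw : HasFDerivAt (𝕜 := ℝ) (fun z : ℂ => conj z)
      Complex.conjCLE.toContinuousLinearMap 0 :=
    Complex.conjCLE.toContinuousLinearMap.hasFDerivAt
  have h := ((((((((hasFDerivAt_const c₀ (0 : ℂ)).add (hz.mul_const c₁)).add
    (hw.mul_const c₂)).add ((hz.mul hz).mul_const d₁)).add ((hz.mul hw).mul_const d₂)).add
    ((hw.mul hw).mul_const d₃)).add (((hz.mul hz).mul hw).mul_const d₄)).add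
    ((hz.mul (hw.mul hw)).mul_const d₅)).add (((hz.mul hz).mul (hw.mul hw)).mul_const d₆)
  exact h.congr_fderiv (ContinuousLinearMap.ext fun z => by simp)

/-- The Wirtinger derivative at `0` of a polynomial in `z` and `conj z` of degree at most two in
each of them is its coefficient at `z`. -/
theorem wirtinger_quartic {f : ℂ → ℂ} {c₀ c₁ c₂ d₁ d₂ d₃ d₄ d₅ d₆ : ℂ}
    (hf : ∀ z, f z = c₀ + z * c₁ + conj z * c₂ + z * z * d₁ + z * conj z * d₂ +
      conj z * conj z * d₃ + z * z * conj z * d₄ + z * (conj z * conj z) * d₅ +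
      z * z * (conj z * conj z) * d₆) :
    DifferentiableAt ℝ f 0 ∧
      (1 / 2 : ℂ) * (fderiv ℝ f 0 1 - Complex.I * fderiv ℝ f 0 Complex.I) = c₁ := by
  have h := hasFDerivAt_quartic c₀ c₁ c₂ d₁ d₂ d₃ d₄ d₅ d₆
  rw [← funext hf] at h
  refine ⟨h.differentiableAt, ?_⟩
  rw [h.fderiv]
  simp
  linear_combination (-(1 / 2) * c₁ + (1 / 2) * c₂) * Complex.I_mul_I

end Wirtinger

section YangMills

variable {G : Type*} [Ring G] [StarRing G] [HopfAlgebra ℂ G] [StarModule ℂ G]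
variable {P : Type*} [Ring P] [StarRing P] [Algebra ℂ P] [StarModule ℂ P]
variable {Γ : Type*} [Ring Γ] [Algebra ℂ Γ] {𝒢 : ℕ → Submodule ℂ Γ} [GradedAlgebra 𝒢]
variable {Ω : Type*} [Ring Ω] [Algebra ℂ Ω] {𝒜 : ℕ → Submodule ℂ Ω} [GradedAlgebra 𝒜]
variable {B : QuantumBundle G P} {C : GroupCalculus G 𝒢} {X : BundleCalculus 𝒜 B C}

open Coalgebra BundleCalculus

/-! ### Variation of the curvature -/

/-- The first variation `dλ - ⟨ω, λ⟩ - ⟨λ, ω⟩` of the curvature at `ω` in the direction `λ`. -/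
noncomputable def curvatureVar (X : BundleCalculus 𝒜 B C) (δ : C.inv →ₗ[ℂ] C.inv ⊗[ℂ] C.inv)
    (ω lam : C.inv →ₗ[ℂ] Ω) : C.inv →ₗ[ℂ] Ω :=
  X.d ∘ₗ lam - bracket δ ω lam - bracket δ lam ω

theorem curvature_add_smul (δ : C.inv →ₗ[ℂ] C.inv ⊗[ℂ] C.inv) (ω lam : C.inv →ₗ[ℂ] Ω) (z : ℂ) :
    curvature X δ (ω + z • lam) =
      curvature X δ ω + z • curvatureVar X δ ω lam + (-(z * z)) • bracket δ lam lam := by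
  ext θ
  simp only [curvature, curvatureVar, bracket, TensorProduct.map_add_left,
    TensorProduct.map_add_right, TensorProduct.map_smul_left, TensorProduct.map_smul_right,
    LinearMap.add_apply, LinearMap.sub_apply, LinearMap.smul_apply, LinearMap.comp_apply, map_add,
    map_smul, smul_sub, smul_add, smul_smul, neg_smul]
  abel

theorem isQPC_add_smul {ω lam : C.inv →ₗ[ℂ] Ω} (hω : IsQPC X ω) (hlam : IsDisplacement X lam)
    (z : ℂ) : IsQPC X (ω + z • lam) := by
  refine ⟨fun θ => add_mem (hω.1 θ) ((𝒜 1).smul_mem z (hlam.1 θ)), fun θ => ?_⟩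
  rw [LinearMap.add_apply, LinearMap.smul_apply, map_add, map_smul, hω.2, hlam.2,
    TensorProduct.map_add_left, TensorProduct.map_smul_left]
  simp only [LinearMap.add_apply, LinearMap.smul_apply]
  abel

theorem curvatureVar_mem {δ : C.inv →ₗ[ℂ] C.inv ⊗[ℂ] C.inv} (hδ : IsEmbeddedDifferential C δ)
    {ω lam : C.inv →ₗ[ℂ] Ω} (hω : IsQPC X ω) (hlam : IsDisplacement X lam) :
    curvatureVar X δ ω lam ∈ X.MorHor := by
  have h := curvature_add_smul (X := X) δ ω lam 1
  have h' : curvatureVar X δ ω lam = curvature X δ (ω + (1 : ℂ) • lam) - curvature X δ ω +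
      bracket δ lam lam := by
    rw [h]
    ext θ
    simp
    abel
  rw [h']
  exact add_mem (sub_mem (curvature_mem hδ (isQPC_add_smul hω hlam 1)) (curvature_mem hδ hω))
    (bracket_mem hδ hlam hlam)

/-- The first variation of the curvature is `D^ω λ - S^ω(λ)`: the commutator in `S^ω` is the
connection term of `D^ω λ`. -/
theorem curvatureVar_eq (δ : C.inv →ₗ[ℂ] C.inv ⊗[ℂ] C.inv) (ω : C.inv →ₗ[ℂ] Ω)
    {lam : C.inv →ₗ[ℂ] Ω} (hlam : IsDisplacement X lam) :
    curvatureVar X δ ω lam = covD X ω ∘ₗ lam - opS (𝒜 := 𝒜) δ ω lam := by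
  have hsgn : degSign 𝒜 ∘ₗ lam = -lam := by
    ext θ
    rw [LinearMap.comp_apply, degSign_of_mem 𝒜 (hlam.1 θ)]
    simp
  have hcov : covD X ω ∘ₗ lam = X.d ∘ₗ lam + bracket (transComm C) lam ω := by
    ext θ
    have h := coactΩ_apply (X := X) (τ := lam) hlam.2 θ
    simp only [covD, LinearMap.comp_apply, LinearMap.sub_apply, LinearMap.add_apply, h, bracket,
      transComm]
    generalize C.ad θ = t
    rw [sub_eq_add_neg]
    congr 1
    rw [← LinearMap.comp_apply, ← LinearMap.comp_apply (TensorProduct.map _ _)]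
    induction t with
    | zero => simp
    | add x y hx hy => simp only [map_add, neg_add, hx, hy]
    | tmul a b => simp [degSign_of_mem 𝒜 (hlam.1 a)]
  have hneg : ∀ (δ : C.inv →ₗ[ℂ] C.inv ⊗[ℂ] C.inv), bracket δ (-lam) ω = -bracket δ lam ω := by
    intro δ
    ext θ
    simp only [bracket, LinearMap.neg_apply, LinearMap.comp_apply]
    generalize δ θ = t
    induction t with
    | zero => simp
    | add x y hx hy => simp only [map_add, neg_add, hx, hy]
    | tmul a b => simp
  rw [opS, hsgn, hcov, curvatureVar, hneg, hneg]
  abel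

/-! ### The inverse isomorphisms onto bundle-valued forms -/

namespace AdFrame

theorem upsInvL_upsL (F : AdFrame B C) {τ : C.inv →ₗ[ℂ] Ω} (hτ : τ ∈ X.MorHor) :
    upsInvL X (upsL X τ) = τ := by
  rw [F.upsL_eq hτ, ← F.equivL_coe, LinearEquiv.apply_symm_apply]

theorem upsInvR_upsR [Nontrivial P] (F : AdFrame B C) {τ : C.inv →ₗ[ℂ] Ω} (hτ : τ ∈ X.MorHor) :
    upsInvR X (upsR X τ) = τ := by
  rw [F.upsR_eq hτ, ← F.equivR_coe, LinearEquiv.apply_symm_apply]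

theorem upsL_add_smul (F : AdFrame B C) {τ σ : C.inv →ₗ[ℂ] Ω} (hτ : τ ∈ X.MorHor)
    (hσ : σ ∈ X.MorHor) (c : ℂ) : upsL X (τ + c • σ) = upsL X τ + c • upsL X σ := by
  rw [F.upsL_eq hτ, F.upsL_eq hσ, F.upsL_eq (add_mem hτ (X.MorHor.smul_mem c hσ)), ← map_smul,
    ← map_add]
  rfl

theorem upsL_sub (F : AdFrame B C) {τ σ : C.inv →ₗ[ℂ] Ω} (hτ : τ ∈ X.MorHor)
    (hσ : σ ∈ X.MorHor) : upsL X (τ - σ) = upsL X τ - upsL X σ := by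
  rw [F.upsL_eq hτ, F.upsL_eq hσ, F.upsL_eq (sub_mem hτ hσ), ← map_sub]
  rfl

theorem upsR_add_smul [Nontrivial P] (F : AdFrame B C) {τ σ : C.inv →ₗ[ℂ] Ω} (hτ : τ ∈ X.MorHor)
    (hσ : σ ∈ X.MorHor) (c : ℂ) : upsR X (τ + c • σ) = upsR X τ + c • upsR X σ := by
  rw [F.upsR_eq hτ, F.upsR_eq hσ, F.upsR_eq (add_mem hτ (X.MorHor.smul_mem c hσ)), ← map_smul,
    ← map_add]
  rfl

theorem upsR_sub [Nontrivial P] (F : AdFrame B C) {τ σ : C.inv →ₗ[ℂ] Ω} (hτ : τ ∈ X.MorHor)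
    (hσ : σ ∈ X.MorHor) : upsR X (τ - σ) = upsR X τ - upsR X σ := by
  rw [F.upsR_eq hτ, F.upsR_eq hσ, F.upsR_eq (sub_mem hτ hσ), ← map_sub]
  rfl

end AdFrame

variable {A : Type*} [CStarAlgebra A] (Y : YangMillsModel X A)

/-! ### The variation of the Yang–Mills action -/

namespace YangMillsModel

/-- The terms of `S^ω(λ)` need not be horizontal one by one, but `S^ω(λ)` is, as the difference of
`D^ω λ` and the variation of the curvature. -/
theorem opS_mem {ω lam : C.inv →ₗ[ℂ] Ω} (hω : IsQPC X ω) (hlam : IsDisplacement X lam) :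
    opS (𝒜 := 𝒜) Y.δ ω lam ∈ X.MorHor := by
  have h := curvatureVar_eq Y.δ ω hlam
  rw [eq_sub_iff_add_eq, ← eq_sub_iff_add_eq'] at h
  rw [h]
  exact sub_mem (covD_comp_mem Y.frame hω hlam.2) (curvatureVar_mem Y.embedded hω hlam)

theorem upsL_curvatureVar {ω lam : C.inv →ₗ[ℂ] Ω} (hω : IsQPC X ω)
    (hlam : IsDisplacement X lam) : upsL X (curvatureVar X Y.δ ω lam) =
      dNablaL X ω (upsL X lam) - dSL X Y.δ ω (upsL X lam) := by
  have hl : lam ∈ X.MorHor := hlam.2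
  rw [dNablaL, dSL, Y.frame.upsInvL_upsL hl, curvatureVar_eq Y.δ ω hlam,
    Y.frame.upsL_sub (covD_comp_mem Y.frame hω hl) (Y.opS_mem hω hlam)]

theorem upsR_hat_curvatureVar {ω lam : C.inv →ₗ[ℂ] Ω} (hω : IsQPC X ω)
    (hlam : IsDisplacement X lam) : upsR X (hat X (curvatureVar X Y.δ ω lam)) =
      dNablaR X ω (upsR X (hat X lam)) - dSR X Y.δ ω (upsR X (hat X lam)) := by
  have : Nontrivial P := nontrivial_of_hodgeData Y.toHodgeData
  have hl : lam ∈ X.MorHor := hlam.2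
  have hsub : hat X (covD X ω ∘ₗ lam - opS (𝒜 := 𝒜) Y.δ ω lam) =
      hat X (covD X ω ∘ₗ lam) - hat X (opS (𝒜 := 𝒜) Y.δ ω lam) := by
    ext θ
    simp [hat_apply]
  rw [dNablaR, dSR, Y.frame.upsInvR_upsR (hat_mem hl), covDHat_comp, hat_hat,
    curvatureVar_eq Y.δ ω hlam, hsub,
    Y.frame.upsR_sub (hat_mem (covD_comp_mem Y.frame hω hl)) (hat_mem (Y.opS_mem hω hlam))]

/-- The Wirtinger derivative of the action: only the terms of the hermitian forms that are linear
in `z` contribute. -/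
theorem wirtinger_action {ω lam : C.inv →ₗ[ℂ] Ω} (hω : IsQPC X ω) (hlam : IsDisplacement X lam) :
    DifferentiableAt ℝ (fun z : ℂ => Y.action (ω + z • lam)) 0 ∧
    (1 / 2 : ℂ) * (fderiv ℝ (fun z : ℂ => Y.action (ω + z • lam)) 0 1 -
      Complex.I * fderiv ℝ (fun z : ℂ => Y.action (ω + z • lam)) 0 Complex.I) =
    -(1 / 4) * (pairL Y.toHodgeData Y.frame (upsL X (curvatureVar X Y.δ ω lam))
        (upsL X (curvature X Y.δ ω)) +
      pairR Y.toHodgeData Y.frame (upsR X (hat X (curvatureVar X Y.δ ω lam)))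
        (upsR X (hat X (curvature X Y.δ ω)))) := by
  have : Nontrivial P := nontrivial_of_hodgeData Y.toHodgeData
  have hR := curvature_mem Y.embedded hω
  have hA := curvatureVar_mem Y.embedded hω hlam
  have hB := bracket_mem Y.embedded hlam hlam
  have hL : ∀ z : ℂ, upsL X (curvature X Y.δ (ω + z • lam)) = upsL X (curvature X Y.δ ω) +
      z • upsL X (curvatureVar X Y.δ ω lam) + (-(z * z)) • upsL X (bracket Y.δ lam lam) := by
    intro z
    rw [curvature_add_smul, Y.frame.upsL_add_smul (add_mem hR (X.MorHor.smul_mem z hA)) hB,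
      Y.frame.upsL_add_smul hR hA]
  have hRt : ∀ z : ℂ, upsR X (hat X (curvature X Y.δ (ω + z • lam))) =
      upsR X (hat X (curvature X Y.δ ω)) +
      (starRingEnd ℂ z) • upsR X (hat X (curvatureVar X Y.δ ω lam)) +
      (starRingEnd ℂ (-(z * z))) • upsR X (hat X (bracket Y.δ lam lam)) := by
    intro z
    rw [curvature_add_smul, hat_add, hat_add, hat_smul, hat_smul,
      Y.frame.upsR_add_smul (add_mem (hat_mem hR) (X.MorHor.smul_mem _ (hat_mem hA)))
        (hat_mem hB), Y.frame.upsR_add_smul (hat_mem hR) (hat_mem hA)]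
  generalize upsL X (curvature X Y.δ ω) = r at *
  generalize upsL X (curvatureVar X Y.δ ω lam) = a at *
  generalize upsL X (bracket Y.δ lam lam) = b at *
  generalize upsR X (hat X (curvature X Y.δ ω)) = r' at *
  generalize upsR X (hat X (curvatureVar X Y.δ ω lam)) = a' at *
  generalize upsR X (hat X (bracket Y.δ lam lam)) = b' at *
  let f : FormsL X → FormsL X → ℂ := fun u v => Y.s (formL Y.toHodgeData Y.frame u v)
  let g : FormsR X → FormsR X → ℂ := fun u v => Y.s (formR Y.toHodgeData Y.frame u v)
  refine wirtinger_quartic (c₀ := -(1 / 4) * (f r r + g r' r'))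
    (c₂ := -(1 / 4) * (f r a + g r' a')) (d₁ := (1 / 4) * (f b r + g b' r'))
    (d₂ := -(1 / 4) * (f a a + g a' a')) (d₃ := (1 / 4) * (f r b + g r' b'))
    (d₄ := (1 / 4) * (f b a + g b' a')) (d₅ := (1 / 4) * (f a b + g a' b'))
    (d₆ := -(1 / 4) * (f b b + g b' b')) fun z => ?_
  rw [action, lagrangian, hL, hRt]
  simp only [map_add, map_smul, map_smulₛₗ, LinearMap.add_apply, LinearMap.smul_apply, smul_eq_mul,
    map_neg, map_mul, Complex.conj_conj, smul_add, pairL, pairR, f, g]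
  ring

end YangMillsModel

end YangMills

end QYM

theorem theorem6p1p5
    {G : Type*} [Ring G] [StarRing G] [HopfAlgebra ℂ G] [StarModule ℂ G]
    {P : Type*} [Ring P] [StarRing P] [Algebra ℂ P] [StarModule ℂ P]
    {Γ : Type*} [Ring Γ] [Algebra ℂ Γ] {𝒢 : ℕ → Submodule ℂ Γ} [GradedAlgebra 𝒢]
    {Ω : Type*} [Ring Ω] [Algebra ℂ Ω] {𝒜 : ℕ → Submodule ℂ Ω} [GradedAlgebra 𝒜]
    {B : QYM.QuantumBundle G P} {C : QYM.GroupCalculus G 𝒢} {X : QYM.BundleCalculus 𝒜 B C}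
    {A : Type*} [CStarAlgebra A] (Y : QYM.YangMillsModel X A)
    (ω : C.inv →ₗ[ℂ] Ω) (hω : QYM.IsQPC X ω) :
    QYM.IsAdjointL Y.toHodgeData Y.frame (QYM.dNablaL X ω) (QYM.dNablaStarL Y.toHodgeData ω) ∧
    QYM.IsAdjointR Y.toHodgeData Y.frame (QYM.dNablaR X ω) (QYM.dNablaStarR Y.toHodgeData ω) ∧
    ∀ (SL : QYM.FormsL X → QYM.FormsL X) (SR : QYM.FormsR X → QYM.FormsR X),
      QYM.IsAdjointL Y.toHodgeData Y.frame (QYM.dSL X Y.δ ω) SL →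
      QYM.IsAdjointR Y.toHodgeData Y.frame (QYM.dSR X Y.δ ω) SR →
      (Y.IsYangMills ω ↔ ∀ lam, QYM.IsDisplacement X lam →
        QYM.pairL Y.toHodgeData Y.frame (QYM.upsL X lam)
            (QYM.dNablaStarL Y.toHodgeData ω (QYM.upsL X (QYM.curvature X Y.δ ω)) -
              SL (QYM.upsL X (QYM.curvature X Y.δ ω))) +
          QYM.pairR Y.toHodgeData Y.frame (QYM.upsR X (QYM.hat X lam))
            (QYM.dNablaStarR Y.toHodgeData ω (QYM.upsR X (QYM.hat X (QYM.curvature X Y.δ ω))) -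
              SR (QYM.upsR X (QYM.hat X (QYM.curvature X Y.δ ω)))) = 0) := by
  have hL := QYM.isAdjointL_dNablaL Y.toHodgeData Y.frame hω
  have hR := QYM.isAdjointR_dNablaR Y.toHodgeData Y.frame hω
  refine ⟨hL, hR, fun SL SR hSL hSR => forall₂_congr fun lam hlam => ?_⟩
  obtain ⟨h1, h2⟩ := Y.wirtinger_action hω hlam
  have h3 : ∀ ψ φ χ, QYM.pairL Y.toHodgeData Y.frame (ψ - φ) χ =
      QYM.pairL Y.toHodgeData Y.frame ψ χ - QYM.pairL Y.toHodgeData Y.frame φ χ := by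
    simp [QYM.pairL]
  have h4 : ∀ ψ φ χ, QYM.pairL Y.toHodgeData Y.frame ψ (φ - χ) =
      QYM.pairL Y.toHodgeData Y.frame ψ φ - QYM.pairL Y.toHodgeData Y.frame ψ χ := by
    simp [QYM.pairL]
  have h5 : ∀ ψ φ χ, QYM.pairR Y.toHodgeData Y.frame (ψ - φ) χ =
      QYM.pairR Y.toHodgeData Y.frame ψ χ - QYM.pairR Y.toHodgeData Y.frame φ χ := by
    simp [QYM.pairR]
  have h6 : ∀ ψ φ χ, QYM.pairR Y.toHodgeData Y.frame ψ (φ - χ) =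
      QYM.pairR Y.toHodgeData Y.frame ψ φ - QYM.pairR Y.toHodgeData Y.frame ψ χ := by
    simp [QYM.pairR]
  rw [h2, Y.upsL_curvatureVar hω hlam, Y.upsR_hat_curvatureVar hω hlam, h3, h4, h5, h6, hL, hR,
    hSL, hSR]
  simp [h1]
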